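/- Let $m>0$ and let $\varphi_{E_6}(\mathbf x)=\mathbf x^T\mathbf F_{E_6}\mathbf x$, $\varphi_{E_6^*}(\mathbf x)=\mathbf x^T\mathbf F_{E_6^*}\mathbf x$ be the positive definite quadratic forms on $\mathbb R^6$ with $$\mathbf F_{E_6}=\frac m2\begin{pmatrix}8&-5&-5&-5&-5&-5\\-5&4&3&3&3&3\\-5&3&4&3&3&3\\-5&3&3&4&3&3\\-5&3&3&3&4&3\\-5&3&3&3&3&4\end{pmatrix},\qquad \mathbf F_{E_6^*}=\frac m4\begin{pmatrix}10&-5&-6&-6&-6&-6\\-5&4&3&3&3&3\\-6&3&6&3&3&3\\-6&3&3&6&3&3\\-6&3&3&3&6&3\\-6&3&3&3&3&6\end{pmatrix}.$$ They are metrical forms for the root lattice $E_6$ and its dual $E_6^*$. Let $\mathcal D_{E_6}$ and $\mathcal D_{E_6^*}$ be the Delaunay tilings of $\mathbb Z^6$ with respect to these forms; a tile is a six-dimensional convex hull of the set of all lattice points on an ellipsoid $\{\mathbf x:\varphi(\mathbf x-\mathbf c)=r\}$ that has no lattice point inside. Let $\mathcal G_{D_4}\subset GL(6,\mathbb Z)$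 be the group of all $\mathbf g$ that leave both forms invariant. Two subsets of $\mathbb R^6$ are homologous if one is the image of the other under a map $\mathbf x\mapsto \mathbf z\pm\mathbf x$ with $\mathbf z\in\mathbb Z^6$. A $\mathbb Z^6$-polytope is a convex polytope each face $F$ of which satisfies $F=\mathrm{conv}(F\cap\mathbb Z^6)$. A $\mathbb Z^6$-tiling is a (locally finite) face-to-face tiling of $\mathbb R^6$ by six-dimensional $\mathbb Z^6$-polytopes. The open cells of the intersection tiling of two tilings are the nonempty intersections of an open cell (relative interior of a face of a tile, of any dimension) of the first with an open cell of the second. Two tilings are commensurate if the closed cells of their intersection tiling are all $\mathbb Z^6$-polytopes. Define reference polytopes as follows. * $T=\mathrm{conv}\{(0,0,0,0,0,0),(0,0,0,0,1,0),(0,0,0,0,0,1),(2,0,1,1,1,1),(-1,0,0,-1,0,0),(-1,0,-1,0,0,0),(0,1,0,0,0,0),(1,0,0,0,1,1),(-1,-1,0,0,0,0)\}$. * $Q=\mathrm{conv}(\Delta_Q^1\cup\Delta_Q^2\cup\Delta_Q^3)$, where $\Delta_Q^1=\mathrm{conv}\{(0,0,0,1,0,0),(0,0,0,0,1,0),(0,0,0,0,0,1)\}$,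 $\Delta_Q^2=\mathrm{conv}\{(0,1,0,0,0,0),(-1,-1,0,0,0,0),(1,0,0,1,1,1)\}$, $\Delta_Q^3=\mathrm{conv}\{(2,0,1,1,1,1),(-1,0,0,0,0,0),(-1,0,-1,0,0,0)\}$. * $R=\mathrm{conv}(S_Q\cup S_G)$, where $S_Q=\mathrm{conv}\{(0,1,0,0,0,0),(2,0,1,1,1,1),(-1,-1,0,0,0,0),(-1,0,0,0,0,0)\}$, $S_G=\mathrm{conv}\{(0,0,1,0,0,0),(0,0,0,1,0,0),(0,0,0,0,1,0),(0,0,0,0,0,1)\}$. The white simplexes of $Q$ are the polytopes $\mathrm{conv}(G'\cap Q\cap\mathbb Z^6)$, where $G'$ runs over the tiles of $\mathcal D_{E_6}$ that have $\Delta_Q^1$ as a face. A T-tope is a polytope $\mathcal G_{D_4}$-equivalent to one homologous to $T$; an R-tope is a polytope $\mathcal G_{D_4}$-equivalent to one homologous to $R$; a white simplex is a polytope $\mathcal G_{D_4}$-equivalent to one homologous to a white simplex of $Q$. **Proposition.** There are exactly $24$ homology classes of T-topes, $12$ homology classes of R-topes and $96$ homology classes of white simplexes; the white simplexes are six-dimensional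 simplexes with vertices in $\mathbb Z^6$. The set $\mathcal D_R$ of all T-topes, R-topes and white simplexes is invariant under translations by $\mathbb Z^6$ and is a $\mathbb Z^6$-tiling of $\mathbb R^6$. It is facet-to-facet: every facet of a tile is a facet of exactly one other tile. $\mathcal D_R$ is commensurate with both $\mathcal D_{E_6}$ and $\mathcal D_{E_6^*}$. -/

import Mathlib

open scoped Matrix Topology

noncomputable section

/-- The ambient space `ℝ⁶`. -/
abbrev R6 : Type := Fin 6 → ℝ

/-- The lattice `ℤ⁶` inside `ℝ⁶`. -/
def Z6 : Set R6 := Set.range (fun (z : Fin 6 → ℤ) (i : Fin 6) => (z i : ℝ))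

/-! ### Lattice polytopes, tilings, commensurability -/

/-- Faces of a closed convex polyhedron (the empty face and `P` itself included): the empty set,
and the sets of maximizers over `P` of the linear functionals. -/
def IsFace (P F : Set R6) : Prop := IsExposed ℝ P F

/-- Facets of a six-dimensional polytope: its five-dimensional faces. -/
def IsFacet (P F : Set R6) : Prop :=
  IsFace P F ∧ F.Nonempty ∧ Module.finrank ℝ (vectorSpan ℝ F) = 5

/-- A convex polytope each face `F` of which is the convex hull of `F ∩ ℤ⁶`
(a bounded `ℤ⁶`-polyhedron). -/
def IsZPolytope (P : Set R6) : Prop :=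
  (∃ S : Set R6, S.Finite ∧ P = convexHull ℝ S) ∧
    ∀ F : Set R6, IsFace P F → convexHull ℝ (F ∩ Z6) = F

/-- A locally finite face-to-face tiling of `ℝ⁶` by six-dimensional `ℤ⁶`-polytopes. A tiling is
given by the set of its closed six-dimensional tiles. -/
structure IsZTiling (D : Set (Set R6)) : Prop where
  polytope : ∀ P ∈ D, IsZPolytope P
  fullDim : ∀ P ∈ D, (interior P).Nonempty
  cover : ⋃₀ D = Set.univ
  disjoint : ∀ P ∈ D, ∀ P' ∈ D, P ≠ P' → Disjoint (interior P) (interior P')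
  faceToFace : ∀ P ∈ D, ∀ P' ∈ D, IsFace P (P ∩ P') ∧ IsFace P' (P ∩ P')
  locallyFinite : ∀ x : R6, ∃ U ∈ 𝓝 x, {P | P ∈ D ∧ (P ∩ U).Nonempty}.Finite

/-- Every facet of a tile is a facet of exactly one other tile. -/
def IsFacetToFacet (D : Set (Set R6)) : Prop :=
  ∀ P ∈ D, ∀ F, IsFacet P F → ∃! P', P' ∈ D ∧ P' ≠ P ∧ IsFacet P' F

/-- The closed cells, of all dimensions, of a tiling: the nonempty faces of its tiles. -/
def cells (D : Set (Set R6)) : Set (Set R6) :=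
  {F | F.Nonempty ∧ ∃ P ∈ D, IsFace P F}

/-- The closed cells of the intersection tiling. Its open cells are the nonempty intersections of
an open cell (the relative interior of a cell) of `D₁` with an open cell of `D₂`; the closure of
such an intersection is the intersection of the two closed cells. -/
def intersectionTiling (D₁ D₂ : Set (Set R6)) : Set (Set R6) :=
  {C | ∃ F₁ ∈ cells D₁, ∃ F₂ ∈ cells D₂,
    (intrinsicInterior ℝ F₁ ∩ intrinsicInterior ℝ F₂).Nonempty ∧ C = F₁ ∩ F₂}

/-- Two tilings are commensurate if their intersection tiling consists of `ℤ⁶`-polytopes only. -/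
def Commensurate (D₁ D₂ : Set (Set R6)) : Prop :=
  ∀ C ∈ intersectionTiling D₁ D₂, IsZPolytope C

/-! ### Homology classes -/

/-- `B` is the image of `A` under `x ↦ z + x` or `x ↦ z - x` for some `z ∈ ℤ⁶`, that is, under a
composition of lattice translations and central inversions in lattice points. -/
def Homologous (A B : Set R6) : Prop :=
  ∃ z ∈ Z6, B = (fun x => z + x) '' A ∨ B = (fun x => z - x) '' A

/-- The set of homology classes of the members of a family `S` of subsets of `ℝ⁶`. -/
def homologyClasses (S : Set (Set R6)) : Set (Set (Set R6)) :=
  (fun A => {B | Homologous A B}) '' S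

/-! ### The two quadratic forms, their Delaunay tilings and invariance groups -/

/-- The quadratic form with coefficient matrix `F`. -/
def quadForm (F : Matrix (Fin 6) (Fin 6) ℝ) (x : R6) : ℝ := x ⬝ᵥ (F *ᵥ x)

/-- The coefficient matrix of the form `φ_{E₆}` with arithmetic minimum `m`. -/
def formE6 (m : ℝ) : Matrix (Fin 6) (Fin 6) ℝ :=
  (m / 2) • !![ 8, -5, -5, -5, -5, -5;
               -5,  4,  3,  3,  3,  3;
               -5,  3,  4,  3,  3,  3;
               -5,  3,  3,  4,  3,  3;
               -5,  3,  3,  3,  4,  3;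
               -5,  3,  3,  3,  3,  4]

/-- The coefficient matrix of the form `φ_{E₆*}` with arithmetic minimum `m`. -/
def formE6Star (m : ℝ) : Matrix (Fin 6) (Fin 6) ℝ :=
  (m / 4) • !![10, -5, -6, -6, -6, -6;
               -5,  4,  3,  3,  3,  3;
               -6,  3,  6,  3,  3,  3;
               -6,  3,  3,  6,  3,  3;
               -6,  3,  3,  3,  6,  3;
               -6,  3,  3,  3,  3,  6]

/-- The (tiles of the) Delaunay tiling of `ℤ⁶` with respect to a positive definite form: the
six-dimensional convex hulls of the sets of all lattice points on an empty ellipsoid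
`{x | F(x - c) = r}`, one with no lattice point inside. -/
def delaunayTiling (F : Matrix (Fin 6) (Fin 6) ℝ) : Set (Set R6) :=
  {P | (interior P).Nonempty ∧ ∃ (c : R6) (r : ℝ), (∀ z ∈ Z6, r ≤ quadForm F (z - c)) ∧
    P = convexHull ℝ {z | z ∈ Z6 ∧ quadForm F (z - c) = r}}

/-- The linear action of `GL(6, ℤ)` on `ℝ⁶`. -/
def act (g : GL (Fin 6) ℤ) (x : R6) : R6 :=
  ((g : Matrix (Fin 6) (Fin 6) ℤ).map (fun a : ℤ => (a : ℝ))) *ᵥ x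

/-- The group `𝒢_{D₄}`, the intersection of the invariance groups `𝒢_{E₆}` and `𝒢_{E₆*}` of the
two forms in `GL(6, ℤ)`. -/
def groupD4 (m : ℝ) : Set (GL (Fin 6) ℤ) :=
  {g | ∀ x, quadForm (formE6 m) (act g x) = quadForm (formE6 m) x} ∩
    {g | ∀ x, quadForm (formE6Star m) (act g x) = quadForm (formE6Star m) x}

/-- The polytopes `𝒢_{D₄}`-equivalent to a polytope homologous to `P`. -/
def equivalentTopes (m : ℝ) (P : Set R6) : Set (Set R6) :=
  {X | ∃ g ∈ groupD4 m, ∃ P', Homologous P P' ∧ X = act g '' P'}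

/-! ### T-topes, Q-topes, R-topes and white simplexes -/

/-- The reference T-tope, the convex hull of three triangles with common centroid. -/
def refT : Set R6 :=
  convexHull ℝ
    ({![0, 0, 0, 0, 0, 0], ![0, 0, 0, 0, 1, 0], ![0, 0, 0, 0, 0, 1]} ∪
     {![2, 0, 1, 1, 1, 1], ![-1, 0, 0, -1, 0, 0], ![-1, 0, -1, 0, 0, 0]} ∪
     {![0, 1, 0, 0, 0, 0], ![1, 0, 0, 0, 1, 1], ![-1, -1, 0, 0, 0, 0]})

/-- The vertices of the triangle `Δ_Q¹`. -/
def vertsQ₁ : Set R6 := {![0, 0, 0, 1, 0, 0], ![0, 0, 0, 0, 1, 0], ![0, 0, 0, 0, 0, 1]}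

/-- The vertices of the triangle `Δ_Q²`. -/
def vertsQ₂ : Set R6 := {![0, 1, 0, 0, 0, 0], ![-1, -1, 0, 0, 0, 0], ![1, 0, 0, 1, 1, 1]}

/-- The vertices of the triangle `Δ_Q³`. -/
def vertsQ₃ : Set R6 := {![2, 0, 1, 1, 1, 1], ![-1, 0, 0, 0, 0, 0], ![-1, 0, -1, 0, 0, 0]}

/-- The reference Q-tope. -/
def refQ : Set R6 := convexHull ℝ (vertsQ₁ ∪ vertsQ₂ ∪ vertsQ₃)

/-- The reference R-tope, the convex hull of the union of the tetrahedra `S_Q` and `S_G`. -/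
def refR : Set R6 :=
  convexHull ℝ
    ({![0, 1, 0, 0, 0, 0], ![2, 0, 1, 1, 1, 1], ![-1, -1, 0, 0, 0, 0], ![-1, 0, 0, 0, 0, 0]} ∪
     {![0, 0, 1, 0, 0, 0], ![0, 0, 0, 1, 0, 0], ![0, 0, 0, 0, 1, 0], ![0, 0, 0, 0, 0, 1]})

/-- The white simplexes of the reference Q-tope `Q`: the polytopes `conv(G' ∩ Q ∩ ℤ⁶)`, where `G'`
runs over the tiles of `𝒟_{E₆}` that have the triangle `Δ_Q¹` as a face. -/
def refWhite (m : ℝ) : Set (Set R6) :=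
  {W | ∃ G' ∈ delaunayTiling (formE6 m), IsFace G' (convexHull ℝ vertsQ₁) ∧
    W = convexHull ℝ (G' ∩ refQ ∩ Z6)}

def TTopes (m : ℝ) : Set (Set R6) := equivalentTopes m refT

def RTopes (m : ℝ) : Set (Set R6) := equivalentTopes m refR

/-- The white simplexes of all Q-topes, a Q-tope being a polytope `𝒢_{D₄}`-equivalent to a polytope
homologous to the reference Q-tope; the white simplexes are carried along. -/
def whiteSimplexes (m : ℝ) : Set (Set R6) :=
  {X | ∃ W ∈ refWhite m, X ∈ equivalentTopes m W}

/-- The family `𝒟_R` of all T-topes, R-topes and white simplexes. -/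
def tilingDR (m : ℝ) : Set (Set R6) := TTopes m ∪ RTopes m ∪ whiteSimplexes m

end

/-!
The proof rests on a third Delaunay tiling. In the normalization `form1 = (2 / m) φ_{E₆}` and
`form2 = (4 / m) φ_{E₆*}`, the vertices of each of the reference polytopes `T`, `R` and of a white
simplex are *all* the lattice points on an empty ellipsoid of the form `form1 + form2`. The family
`𝒟_R` consists of the images of these three polytopes under the affine symmetries `symGroup` of the
lattice and the forms (`equivalentTopes_eq`, `whiteSimplexes_eq`), and it is the Delaunay tiling of
`form1 + form2`.

*Empty ellipsoids.* Every nonzero class of `ℤ⁶` modulo `2` has a representative which is shortest in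
its class for both forms at once (`V6.minimal_in_class`). A lattice vector `z` which is not such a
minimal vector is a sum of two shorter vectors with nonnegative scalar product, so that an
inequality `a · z ≤ N φ(z)` has to be tested on the 63 pairs of minimal vectors only, and the cases
of equality can be followed through the decomposition (`V6.nonneg_of_minimalVectors`). This turns
emptiness of an ellipsoid, and the determination of the lattice points on it, into finite integer
tests.

*The tiling.* The deviations `φ(x - c) - r` from two ellipsoids of the same form differ by an affine
function. This function separates two Delaunay polytopes and exhibits their intersection as a face
of both (`Tile.exists_separation`). Each of the three polytopes is a free sum of simplexes: a union
of blocks of vertices with a common centroid, spanning complementary spaces. Its facets omit one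
vertex of each block (`Tile.exists_rest_of_isFacet`). If each facet of each tile of a family is
shared with another tile of the family, then the tile with the least deviation at a point `x`
contains `x`, since beyond a facet the neighbour has a smaller deviation (`Tile.cover`). For the
three reference tiles the neighbours are listed, and the list is checked
(`facetClosed_tileFamily`).

*Commensurability.* A polytope which is covered by simplexes (or other polytopes) with vertices on
empty ellipsoids of `φ` meets every Delaunay polytope of `φ` in the convex hull of common lattice
points, again because deviations differ by affine functions (`commensurate_of_flatCovered`). The
reference polytopes have such covers for both forms, by the covering of a free sum by the simplexes
that contain one block and omit a vertex of each other block (`BlockFrame.exists_mem_piece`).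

*White simplexes.* The Q-tope is covered by six Delaunay polytopes of `E₆` which have the triangle
`Δ_Q¹` as a face (`exists_white`, `isFace_triangle`), and near the centroid of the triangle an
interior point of any other such polytope would lie in one of the six (`delaunay_eq_white`). The six
white simplexes so obtained are equivalent under the symmetries.

*Counting.* Homology classes of images of a tile correspond to classes modulo `ℤ⁶` and sign of the
images of its centroid (`Tile.homologous_iff_c`). The linear parts of the symmetries are words in
five involutions, by a stabilizer chain along a basis of `ℤ⁶` (`exists_word`), so that the orbits of
the three centroids are found by closing up under the five involutions.
-/

/-! ### Integer vectors and the two forms -/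

/-- An integer vector with six named coordinates, a presentation of `ℤ⁶` in which finite
verifications evaluate quickly. -/
@[ext] structure V6 where
  x0 : ℤ
  x1 : ℤ
  x2 : ℤ
  x3 : ℤ
  x4 : ℤ
  x5 : ℤ
deriving DecidableEq

namespace V6

/-- The zero vector. -/
def zero : V6 := ⟨0, 0, 0, 0, 0, 0⟩

def add (u w : V6) : V6 :=
  ⟨u.x0 + w.x0, u.x1 + w.x1, u.x2 + w.x2, u.x3 + w.x3, u.x4 + w.x4, u.x5 + w.x5⟩

def neg (u : V6) : V6 := ⟨-u.x0, -u.x1, -u.x2, -u.x3, -u.x4, -u.x5⟩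

def sub (u w : V6) : V6 :=
  ⟨u.x0 - w.x0, u.x1 - w.x1, u.x2 - w.x2, u.x3 - w.x3, u.x4 - w.x4, u.x5 - w.x5⟩

def smul (k : ℤ) (u : V6) : V6 :=
  ⟨k * u.x0, k * u.x1, k * u.x2, k * u.x3, k * u.x4, k * u.x5⟩

def dot (u w : V6) : ℤ :=
  u.x0 * w.x0 + u.x1 * w.x1 + u.x2 * w.x2 + u.x3 * w.x3 + u.x4 * w.x4 + u.x5 * w.x5

/-- The vector as a point of `ℝ⁶`. -/
def toR (u : V6) : R6 := ![(u.x0 : ℝ), u.x1, u.x2, u.x3, u.x4, u.x5]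

/-- The image of `u` under `(2 / m) F_{E₆}`. -/
def F1 (u : V6) : V6 :=
  let s := u.x1 + u.x2 + u.x3 + u.x4 + u.x5
  let t := 3 * s - 5 * u.x0
  ⟨8 * u.x0 - 5 * s, t + u.x1, t + u.x2, t + u.x3, t + u.x4, t + u.x5⟩

/-- The image of `u` under `(4 / m) F_{E₆*}`. -/
def F2 (u : V6) : V6 :=
  let s := u.x2 + u.x3 + u.x4 + u.x5
  let t := 3 * s + 3 * u.x1 - 6 * u.x0
  ⟨10 * u.x0 - 5 * u.x1 - 6 * s, 4 * u.x1 + 3 * s - 5 * u.x0,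
    t + 3 * u.x2, t + 3 * u.x3, t + 3 * u.x4, t + 3 * u.x5⟩

/-- The bilinear form of `α (2 / m) φ_{E₆} + β (4 / m) φ_{E₆*}`. -/
def bil (α β : ℕ) (u w : V6) : ℤ := α * dot (F1 u) w + β * dot (F2 u) w

end V6

/-- The symmetric bilinear form with matrix `(2 / m) F_{E₆}`. -/
def form1 (x y : R6) : ℝ :=
  8 * x 0 * y 0 - 5 * x 0 * (y 1 + y 2 + y 3 + y 4 + y 5)
    - 5 * y 0 * (x 1 + x 2 + x 3 + x 4 + x 5)
    + 3 * (x 1 + x 2 + x 3 + x 4 + x 5) * (y 1 + y 2 + y 3 + y 4 + y 5)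
    + (x 1 * y 1 + x 2 * y 2 + x 3 * y 3 + x 4 * y 4 + x 5 * y 5)

/-- The symmetric bilinear form with matrix `(4 / m) F_{E₆*}`. -/
def form2 (x y : R6) : ℝ :=
  10 * x 0 * y 0 - 5 * (x 0 * y 1 + y 0 * x 1) - 6 * x 0 * (y 2 + y 3 + y 4 + y 5)
    - 6 * y 0 * (x 2 + x 3 + x 4 + x 5) + x 1 * y 1
    + 3 * (x 1 + x 2 + x 3 + x 4 + x 5) * (y 1 + y 2 + y 3 + y 4 + y 5)
    + 3 * (x 2 * y 2 + x 3 * y 3 + x 4 * y 4 + x 5 * y 5)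

/-- The bilinear form of `α (2 / m) φ_{E₆} + β (4 / m) φ_{E₆*}` on `ℝ⁶`. -/
def bf (α β : ℕ) (x y : R6) : ℝ := α * form1 x y + β * form2 x y

/-- The quadratic form `α (2 / m) φ_{E₆} + β (4 / m) φ_{E₆*}` on `ℝ⁶`. -/
def qf (α β : ℕ) (x : R6) : ℝ := bf α β x x

/-- Completing squares shows that both forms are at least `|x|² / 8`. -/
theorem form1_lower (x : R6) :
    (1 / 8) * (x 0 ^ 2 + x 1 ^ 2 + x 2 ^ 2 + x 3 ^ 2 + x 4 ^ 2 + x 5 ^ 2) ≤ form1 x x := by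
  have key : form1 x x
      - (1 / 8) * (x 0 ^ 2 + x 1 ^ 2 + x 2 ^ 2 + x 3 ^ 2 + x 4 ^ 2 + x 5 ^ 2)
      = 63 / 8 * (x 0 - 40 / 63 * (x 1 + x 2 + x 3 + x 4 + x 5)) ^ 2
        + 353 / 504 * (x 1 - 88 / 353 * (x 2 + x 3 + x 4 + x 5)) ^ 2
        + 1855 / 2824 * (x 2 - 88 / 265 * (x 3 + x 4 + x 5)) ^ 2
        + 1239 / 2120 * (x 3 - 88 / 177 * (x 4 + x 5)) ^ 2
        + 623 / 1416 * (x 4 - 88 / 89 * x 5) ^ 2 + 7 / 712 * x 5 ^ 2 := by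
    unfold form1; ring
  have : 0 ≤ form1 x x
      - (1 / 8) * (x 0 ^ 2 + x 1 ^ 2 + x 2 ^ 2 + x 3 ^ 2 + x 4 ^ 2 + x 5 ^ 2) := by
    rw [key]; positivity
  linarith

theorem form2_lower (x : R6) :
    (1 / 8) * (x 0 ^ 2 + x 1 ^ 2 + x 2 ^ 2 + x 3 ^ 2 + x 4 ^ 2 + x 5 ^ 2) ≤ form2 x x := by
  have key : form2 x x
      - (1 / 8) * (x 0 ^ 2 + x 1 ^ 2 + x 2 ^ 2 + x 3 ^ 2 + x 4 ^ 2 + x 5 ^ 2)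
      = 79 / 8 * (x 0 - 40 / 79 * x 1 - 48 / 79 * (x 2 + x 3 + x 4 + x 5)) ^ 2
        + 849 / 632 * (x 1 - 8 / 283 * (x 2 + x 3 + x 4 + x 5)) ^ 2
        + 5045 / 2264 * (x 2 - 1464 / 5045 * (x 3 + x 4 + x 5)) ^ 2
        + 82363 / 40360 * (x 3 - 1464 / 3581 * (x 4 + x 5)) ^ 2
        + 48691 / 28648 * (x 4 - 1464 / 2117 * x 5) ^ 2 + 15019 / 16936 * x 5 ^ 2 := by
    unfold form2; ring
  have : 0 ≤ form2 x x
      - (1 / 8) * (x 0 ^ 2 + x 1 ^ 2 + x 2 ^ 2 + x 3 ^ 2 + x 4 ^ 2 + x 5 ^ 2) := by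
    rw [key]; positivity
  linarith

theorem qf_lower {α β : ℕ} (h : 0 < α + β) (x : R6) :
    (1 / 8) * (x 0 ^ 2 + x 1 ^ 2 + x 2 ^ 2 + x 3 ^ 2 + x 4 ^ 2 + x 5 ^ 2) ≤ qf α β x := by
  have h1 := form1_lower x
  have h2 := form2_lower x
  have h3 : (1 : ℝ) ≤ α + β := by exact_mod_cast h
  set S := (1 / 8) * (x 0 ^ 2 + x 1 ^ 2 + x 2 ^ 2 + x 3 ^ 2 + x 4 ^ 2 + x 5 ^ 2) with hS
  have hS0 : 0 ≤ S := by positivity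
  have ha : (α : ℝ) * S ≤ α * form1 x x := by gcongr
  have hb : (β : ℝ) * S ≤ β * form2 x x := by gcongr
  have : S ≤ (α + β) * S := le_mul_of_one_le_left hS0 h3
  unfold qf bf
  nlinarith

theorem qf_nonneg (α β : ℕ) (x : R6) : 0 ≤ qf α β x := by
  rcases Nat.eq_zero_or_pos (α + β) with h | h
  · obtain ⟨rfl, rfl⟩ : α = 0 ∧ β = 0 := by omega
    simp [qf, bf]
  · exact le_trans (by positivity) (qf_lower h x)

theorem eq_zero_of_qf {α β : ℕ} (h : 0 < α + β) {x : R6} (hx : qf α β x = 0) : x = 0 := by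
  have h1 := qf_lower h x
  rw [hx] at h1
  ext i
  have : x i ^ 2 ≤ 0 := by
    fin_cases i <;> simp only [Fin.zero_eta, Fin.mk_one, Fin.reduceFinMk] <;>
    nlinarith [sq_nonneg (x 0), sq_nonneg (x 1), sq_nonneg (x 2), sq_nonneg (x 3),
      sq_nonneg (x 4), sq_nonneg (x 5)]
  simpa using pow_eq_zero_iff (two_ne_zero) |>.1 (le_antisymm this (sq_nonneg _))

namespace V6

@[simp] theorem toR_0 (u : V6) : u.toR 0 = u.x0 := rfl
@[simp] theorem toR_1 (u : V6) : u.toR 1 = u.x1 := rfl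
@[simp] theorem toR_2 (u : V6) : u.toR 2 = u.x2 := rfl
@[simp] theorem toR_3 (u : V6) : u.toR 3 = u.x3 := rfl
@[simp] theorem toR_4 (u : V6) : u.toR 4 = u.x4 := rfl
@[simp] theorem toR_5 (u : V6) : u.toR 5 = u.x5 := rfl

end V6

theorem R6_ext {x y : R6} (h0 : x 0 = y 0) (h1 : x 1 = y 1) (h2 : x 2 = y 2) (h3 : x 3 = y 3)
    (h4 : x 4 = y 4) (h5 : x 5 = y 5) : x = y := by
  ext i; fin_cases i <;> assumption

namespace V6

theorem toR_injective : Function.Injective toR := by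
  intro u w h
  ext
  · exact Int.cast_injective (α := ℝ) (congrFun h 0)
  · exact Int.cast_injective (α := ℝ) (congrFun h 1)
  · exact Int.cast_injective (α := ℝ) (congrFun h 2)
  · exact Int.cast_injective (α := ℝ) (congrFun h 3)
  · exact Int.cast_injective (α := ℝ) (congrFun h 4)
  · exact Int.cast_injective (α := ℝ) (congrFun h 5)

theorem toR_add (u w : V6) : (add u w).toR = u.toR + w.toR := by
  apply R6_ext <;> simp [add]

theorem toR_sub (u w : V6) : (sub u w).toR = u.toR - w.toR := by
  apply R6_ext <;> simp [sub]

theorem toR_neg (u : V6) : (neg u).toR = -u.toR := by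
  apply R6_ext <;> simp [neg]

theorem toR_smul (k : ℤ) (u : V6) : (smul k u).toR = (k : ℝ) • u.toR := by
  apply R6_ext <;> simp [smul]

theorem toR_zero : zero.toR = 0 := by
  apply R6_ext <;> simp [zero]

theorem mem_Z6 (u : V6) : u.toR ∈ Z6 := by
  refine ⟨![u.x0, u.x1, u.x2, u.x3, u.x4, u.x5], ?_⟩
  apply R6_ext <;> simp

theorem bf_toR (α β : ℕ) (u w : V6) : bf α β u.toR w.toR = (bil α β u w : ℤ) := by
  simp only [bf, form1, form2, bil, dot, F1, F2, toR_0, toR_1, toR_2, toR_3, toR_4, toR_5]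
  push_cast
  ring

theorem qf_toR (α β : ℕ) (u : V6) : qf α β u.toR = (bil α β u u : ℤ) := bf_toR α β u u

theorem bil_nonneg (α β : ℕ) (u : V6) : 0 ≤ bil α β u u := by
  have := qf_nonneg α β u.toR
  rw [qf_toR] at this
  exact_mod_cast this

theorem eq_zero_of_bil {α β : ℕ} (h : 0 < α + β) {u : V6} (hu : bil α β u u = 0) : u = zero := by
  apply toR_injective
  rw [toR_zero]
  apply eq_zero_of_qf h
  rw [qf_toR, hu, Int.cast_zero]

end V6

theorem mem_Z6_iff {x : R6} : x ∈ Z6 ↔ ∃ u : V6, u.toR = x := by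
  constructor
  · rintro ⟨z, rfl⟩
    exact ⟨⟨z 0, z 1, z 2, z 3, z 4, z 5⟩, by apply R6_ext <;> simp⟩
  · rintro ⟨u, rfl⟩
    exact u.mem_Z6

/-! ### Minimal vectors of the classes modulo two -/

namespace V6

/-- One vector from each pair `±u` of minimal vectors of the nonzero classes of `ℤ⁶` modulo two.
The same vectors are minimal for both forms. -/
def minimalVectors : List V6 :=
  [⟨1, 1, 0, 0, 0, 0⟩, ⟨1, 0, 1, 0, 0, 0⟩, ⟨1, 0, 0, 1, 0, 0⟩, ⟨1, 0, 0, 0, 1, 0⟩,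
   ⟨1, 0, 0, 0, 0, 1⟩, ⟨0, 1, 0, 0, 0, -1⟩, ⟨0, 1, 0, 0, -1, 0⟩, ⟨0, 1, 0, -1, 0, 0⟩,
   ⟨0, 1, -1, 0, 0, 0⟩, ⟨1, 1, 1, 0, 0, 0⟩, ⟨1, 1, 0, 1, 0, 0⟩, ⟨1, 1, 0, 0, 1, 0⟩,
   ⟨1, 1, 0, 0, 0, 1⟩, ⟨1, 0, 1, 1, 0, 0⟩, ⟨1, 0, 1, 0, 1, 0⟩, ⟨1, 0, 1, 0, 0, 1⟩,
   ⟨1, 0, 0, 1, 1, 0⟩, ⟨1, 0, 0, 1, 0, 1⟩, ⟨1, 0, 0, 0, 1, 1⟩, ⟨2, 0, 1, 1, 1, 0⟩,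
   ⟨2, 0, 1, 1, 0, 1⟩, ⟨2, 0, 1, 0, 1, 1⟩, ⟨2, 0, 0, 1, 1, 1⟩, ⟨3, 1, 1, 1, 1, 1⟩,
   ⟨0, 0, 1, 0, 0, -1⟩, ⟨0, 0, 1, 0, -1, 0⟩, ⟨0, 0, 1, -1, 0, 0⟩, ⟨0, 0, 0, 1, 0, -1⟩,
   ⟨0, 0, 0, 1, -1, 0⟩, ⟨0, 0, 0, 0, 1, -1⟩, ⟨2, 1, 1, 1, 0, 0⟩, ⟨2, 1, 1, 0, 1, 0⟩,
   ⟨2, 1, 1, 0, 0, 1⟩, ⟨2, 1, 0, 1, 1, 0⟩, ⟨2, 1, 0, 1, 0, 1⟩, ⟨2, 1, 0, 0, 1, 1⟩,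
   ⟨0, 1, 0, 0, 0, 0⟩, ⟨2, 0, 1, 1, 1, 1⟩, ⟨2, -1, 1, 1, 1, 1⟩, ⟨0, 0, 1, 0, 0, 0⟩,
   ⟨0, 0, 0, 1, 0, 0⟩, ⟨0, 0, 0, 0, 1, 0⟩, ⟨0, 0, 0, 0, 0, 1⟩, ⟨1, 2, 0, 0, 0, 0⟩,
   ⟨1, -1, 1, 1, 0, 0⟩, ⟨1, -1, 1, 0, 1, 0⟩, ⟨1, -1, 1, 0, 0, 1⟩, ⟨1, -1, 0, 1, 1, 0⟩,
   ⟨1, -1, 0, 1, 0, 1⟩, ⟨1, -1, 0, 0, 1, 1⟩, ⟨1, -1, 1, 1, 1, 0⟩, ⟨1, -1, 1, 1, 0, 1⟩,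
   ⟨1, -1, 1, 0, 1, 1⟩, ⟨1, -1, 0, 1, 1, 1⟩, ⟨2, 1, 1, 1, 1, 0⟩, ⟨2, 1, 1, 1, 0, 1⟩,
   ⟨2, 1, 1, 0, 1, 1⟩, ⟨2, 1, 0, 1, 1, 1⟩, ⟨3, 0, 1, 1, 1, 1⟩, ⟨3, 0, 2, 1, 1, 1⟩,
   ⟨3, 0, 1, 2, 1, 1⟩, ⟨3, 0, 1, 1, 2, 1⟩, ⟨3, 0, 1, 1, 1, 2⟩]

/-- Evenness of all coordinates of `w - u`. -/
def sameParity (u w : V6) : Bool :=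
  decide ((w.x0 - u.x0) % 2 = 0) && decide ((w.x1 - u.x1) % 2 = 0) &&
  decide ((w.x2 - u.x2) % 2 = 0) && decide ((w.x3 - u.x3) % 2 = 0) &&
  decide ((w.x4 - u.x4) % 2 = 0) && decide ((w.x5 - u.x5) % 2 = 0)

theorem exists_sameParity_bits :
    ∀ p0 ∈ [(0 : ℤ), 1], ∀ p1 ∈ [(0 : ℤ), 1], ∀ p2 ∈ [(0 : ℤ), 1], ∀ p3 ∈ [(0 : ℤ), 1],
    ∀ p4 ∈ [(0 : ℤ), 1], ∀ p5 ∈ [(0 : ℤ), 1],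
      (zero :: minimalVectors).any (fun u => sameParity u ⟨p0, p1, p2, p3, p4, p5⟩) = true := by
  decide +kernel

theorem exists_sameParity (z : V6) :
    ∃ u ∈ zero :: minimalVectors, ∃ y : V6, z = add u (add y y) := by
  have hm : ∀ a : ℤ, a % 2 ∈ [(0 : ℤ), 1] := by
    intro a
    rcases Int.emod_two_eq_zero_or_one a with h | h <;> simp [h]
  have h := exists_sameParity_bits _ (hm z.x0) _ (hm z.x1) _ (hm z.x2) _ (hm z.x3) _ (hm z.x4)
    _ (hm z.x5)
  rw [List.any_eq_true] at h
  obtain ⟨u, hu, hp⟩ := h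
  simp only [sameParity, Bool.and_eq_true, decide_eq_true_eq] at hp
  obtain ⟨⟨⟨⟨⟨h0, h1⟩, h2⟩, h3⟩, h4⟩, h5⟩ := hp
  refine ⟨u, hu, ⟨(z.x0 - u.x0) / 2, (z.x1 - u.x1) / 2, (z.x2 - u.x2) / 2, (z.x3 - u.x3) / 2,
    (z.x4 - u.x4) / 2, (z.x5 - u.x5) / 2⟩, ?_⟩
  ext <;> simp only [add] <;> omega

theorem minimalVectors_norms : ∀ u ∈ minimalVectors,
    (bil 1 0 u u = 2 ∨ bil 1 0 u u = 4) ∧ (bil 0 1 u u = 4 ∨ bil 0 1 u u = 6) := by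
  decide +kernel

theorem bil_eq (α β : ℕ) (u w : V6) : bil α β u w = α * bil 1 0 u w + β * bil 0 1 u w := by
  simp [bil]

theorem bil_add_left (α β : ℕ) (u v w : V6) : bil α β (add u v) w = bil α β u w + bil α β v w := by
  simp only [bil, dot, F1, F2, add]; ring

theorem bil_comm (α β : ℕ) (u w : V6) : bil α β u w = bil α β w u := by
  simp only [bil, dot, F1, F2]; ring

theorem bil_add_right (α β : ℕ) (u v w : V6) :
    bil α β u (add v w) = bil α β u v + bil α β u w := by
  rw [bil_comm, bil_add_left, bil_comm α β v, bil_comm α β w]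

theorem bil_neg_neg (α β : ℕ) (u w : V6) : bil α β (neg u) (neg w) = bil α β u w := by
  simp only [bil, dot, F1, F2, neg]; ring

theorem dot_add (a u w : V6) : dot a (add u w) = dot a u + dot a w := by
  simp only [dot, add]; ring

theorem dot_neg (a u : V6) : dot a (neg u) = -dot a u := by
  simp only [dot, neg]; ring

/-- The second form takes the values `0` and `1` modulo three only. -/
theorem bil_two_mod_three (u : V6) : ∃ k, bil 0 1 u u = (u.x0 + u.x1) ^ 2 + 3 * k := by
  refine ⟨3 * u.x0 ^ 2 + u.x1 ^ 2 - 4 * u.x0 * u.x1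
    + (u.x2 + u.x3 + u.x4 + u.x5) * (2 * u.x1 - 4 * u.x0 + (u.x2 + u.x3 + u.x4 + u.x5))
    + (u.x2 ^ 2 + u.x3 ^ 2 + u.x4 ^ 2 + u.x5 ^ 2), ?_⟩
  simp only [bil, dot, F1, F2]
  push_cast
  ring

/-- Modulo four the forms depend only on the class modulo two, and modulo three the second form is
a square; hence no vector of the class of `u` is shorter than `u`. -/
theorem minimal_in_class {u : V6} (hu : u ∈ zero :: minimalVectors) (y : V6) :
    bil 1 0 u u ≤ bil 1 0 (add u (add y y)) (add u (add y y)) ∧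
    bil 0 1 u u ≤ bil 0 1 (add u (add y y)) (add u (add y y)) := by
  rcases List.mem_cons.1 hu with rfl | hu
  · have h1 : bil 1 0 zero zero = 0 := by decide
    have h2 : bil 0 1 zero zero = 0 := by decide
    rw [h1, h2]
    exact ⟨bil_nonneg _ _ _, bil_nonneg _ _ _⟩
  obtain ⟨h1, h2⟩ := minimalVectors_norms u hu
  set z := add u (add y y) with hz
  have e1 : bil 1 0 z z = bil 1 0 u u + 4 * bil 1 0 u y + 4 * bil 1 0 y y := by
    simp only [hz, bil_add_left, bil_add_right, bil_comm 1 0 y u]; ring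
  have e2 : bil 0 1 z z = bil 0 1 u u + 4 * bil 0 1 u y + 4 * bil 0 1 y y := by
    simp only [hz, bil_add_left, bil_add_right, bil_comm 0 1 y u]; ring
  have n1 := bil_nonneg 1 0 z
  have n2 := bil_nonneg 0 1 z
  have z1 : bil 1 0 z z ≠ 0 ∧ bil 0 1 z z ≠ 0 := by
    -- If `z = 0`, then `u = -2 y` has four times the norms of `y`; this forces the first norm of
    -- `y` to be one, but the first form is even.
    suffices hne : z ≠ zero from
      ⟨fun h => hne (eq_zero_of_bil (by norm_num) h), fun h => hne (eq_zero_of_bil (by norm_num) h)⟩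
    intro h0
    have hh : u = add (neg y) (neg y) := by
      have := congrArg V6.x0 h0; have := congrArg V6.x1 h0; have := congrArg V6.x2 h0
      have := congrArg V6.x3 h0; have := congrArg V6.x4 h0; have := congrArg V6.x5 h0
      simp only [hz, add, zero] at *
      ext <;> simp only [neg] <;> linarith
    have e3 : bil 1 0 u u = 4 * bil 1 0 y y := by
      rw [hh]; simp only [bil_add_left, bil_add_right, bil_neg_neg]; ring
    have e4 : bil 0 1 u u = 4 * bil 0 1 y y := by
      rw [hh]; simp only [bil_add_left, bil_add_right, bil_neg_neg]; ring
    obtain ⟨k, hk⟩ := bil_two_mod_three y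
    have f1 : bil 1 0 y y = 1 := by omega
    have : ∃ k, bil 1 0 y y = 2 * k := by
      refine ⟨4 * y.x0 ^ 2 - 5 * y.x0 * (y.x1 + y.x2 + y.x3 + y.x4 + y.x5)
        + 2 * (y.x1 ^ 2 + y.x2 ^ 2 + y.x3 ^ 2 + y.x4 ^ 2 + y.x5 ^ 2)
        + 3 * (y.x1 * y.x2 + y.x1 * y.x3 + y.x1 * y.x4 + y.x1 * y.x5 + y.x2 * y.x3 + y.x2 * y.x4
          + y.x2 * y.x5 + y.x3 * y.x4 + y.x3 * y.x5 + y.x4 * y.x5), ?_⟩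
      simp only [bil, dot, F1, F2]
      push_cast
      ring
    omega
  obtain ⟨k, hk⟩ := bil_two_mod_three z
  have hsq : (z.x0 + z.x1) ^ 2 % 3 = 0 ∨ (z.x0 + z.x1) ^ 2 % 3 = 1 := by
    have : (z.x0 + z.x1) % 3 = 0 ∨ (z.x0 + z.x1) % 3 = 1 ∨ (z.x0 + z.x1) % 3 = 2 := by omega
    rcases this with h | h | h <;> simp [pow_two, Int.mul_emod, h]
  omega

/-- An induction principle for inequalities `a · z ≤ N φ(z)`: a vector `z` in the class of a minimal
vector `u` is the sum of the shorter vectors `(z ± u) / 2`, whose scalar product is nonnegative as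
`u` is not longer than `z`. So only minimal vectors have to be tested; the vectors with equality
arise from minimal ones by sums of orthogonal vectors. -/
theorem nonneg_of_minimalVectors {α β : ℕ} (h : 0 < α + β) (N : ℕ) (a : V6) (p : V6 → Prop)
    (h0 : p zero)
    (hu : ∀ u ∈ minimalVectors, (dot a u ≤ N * bil α β u u ∧ -dot a u ≤ N * bil α β u u) ∧
      (dot a u = N * bil α β u u → p u) ∧ (-dot a u = N * bil α β u u → p (neg u)))
    (hadd : ∀ x y, p x → p y → bil α β x y = 0 → p (add x y)) (hN : 0 < N) (z : V6) :
    dot a z ≤ N * bil α β z z ∧ (dot a z = N * bil α β z z → p z) := by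
  induction hn : (bil α β z z).toNat using Nat.strong_induction_on generalizing z with
  | _ n ih =>
  subst hn
  obtain ⟨u, hmem, y, hz⟩ := exists_sameParity z
  have hmin : bil α β u u ≤ bil α β z z := by
    have := minimal_in_class hmem y
    rw [← hz] at this
    rw [bil_eq α β u u, bil_eq α β z z]
    have ha : (0 : ℤ) ≤ α := by positivity
    have hb : (0 : ℤ) ≤ β := by positivity
    nlinarith [mul_le_mul_of_nonneg_left this.1 ha, mul_le_mul_of_nonneg_left this.2 hb]
  by_cases hzz : z = zero
  · subst hzz
    refine ⟨?_, fun _ => h0⟩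
    simp [dot, bil, F1, F2, zero]
  have hcase : ∀ w, w = z → w ∈ zero :: minimalVectors →
      dot a z ≤ N * bil α β z z ∧ (dot a z = N * bil α β z z → p z) := by
    rintro w rfl hw
    rcases List.mem_cons.1 hw with rfl | hw
    · exact absurd rfl hzz
    · exact ⟨(hu w hw).1.1, (hu w hw).2.1⟩
  by_cases hy : y = zero
  · refine hcase u ?_ hmem
    rw [hz, hy]; ext <;> simp [add, zero]
  by_cases hx : add u y = zero
  · have hzy : z = y := by
      have := congrArg V6.x0 hx; have := congrArg V6.x1 hx; have := congrArg V6.x2 hx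
      have := congrArg V6.x3 hx; have := congrArg V6.x4 hx; have := congrArg V6.x5 hx
      rw [hz]
      simp only [add, zero] at *
      ext <;> simp only <;> linarith
    have hzu : z = neg u := by
      have := congrArg V6.x0 hx; have := congrArg V6.x1 hx; have := congrArg V6.x2 hx
      have := congrArg V6.x3 hx; have := congrArg V6.x4 hx; have := congrArg V6.x5 hx
      rw [hzy]
      simp only [add, zero, neg] at *
      ext <;> simp only <;> linarith
    rcases List.mem_cons.1 hmem with rfl | hw
    · exact absurd (hzu.trans (by decide)) hzz
    · have := hu u hw
      rw [hzu, dot_neg, bil_neg_neg]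
      exact ⟨this.1.2, this.2.2⟩
  set x := add u y with hxdef
  have hzxy : z = add x y := by
    rw [hz, hxdef]; ext <;> simp only [add] <;> ring
  have qz : bil α β z z = bil α β x x + 2 * bil α β x y + bil α β y y := by
    rw [hzxy]; simp only [bil_add_left, bil_add_right, bil_comm α β y x]; ring
  have qu : bil α β u u = bil α β x x - 2 * bil α β x y + bil α β y y := by
    simp only [hxdef, bil_add_left, bil_add_right, bil_comm α β y u]; ring
  have hxy : 0 ≤ bil α β x y := by linarith
  have posx : 0 < bil α β x x :=
    lt_of_le_of_ne (bil_nonneg _ _ _) fun h' => hx (eq_zero_of_bil h h'.symm)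
  have posy : 0 < bil α β y y :=
    lt_of_le_of_ne (bil_nonneg _ _ _) fun h' => hy (eq_zero_of_bil h h'.symm)
  have ihx := ih (bil α β x x).toNat (by omega) x rfl
  have ihy := ih (bil α β y y).toNat (by omega) y rfl
  have hNxy : 0 ≤ (N : ℤ) * bil α β x y := by positivity
  have hd : dot a z = dot a x + dot a y := by rw [hzxy, dot_add]
  constructor
  · rw [hd, qz]; nlinarith [ihx.1, ihy.1]
  · intro heq
    rw [hd, qz] at heq
    have h1 : dot a x = N * bil α β x x := by nlinarith [ihx.1, ihy.1]
    have h2 : dot a y = N * bil α β y y := by nlinarith [ihx.1, ihy.1]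
    have h3 : (N : ℤ) * bil α β x y = 0 := by nlinarith
    have h4 : bil α β x y = 0 := by
      rcases mul_eq_zero.1 h3 with h' | h'
      · omega
      · exact h'
    rw [hzxy]
    exact hadd x y (ihx.2 h1) (ihy.2 h2) h4

end V6

/-! ### Empty ellipsoids -/

/-- The deviation of `x` from the ellipsoid with centre `c` and squared radius `r` of the form
`qf α β`: negative inside, zero on the ellipsoid. -/
def dev (α β : ℕ) (c : R6) (r : ℝ) (x : R6) : ℝ := qf α β (x - c) - r

namespace V6

/-- The linear part, scaled by `N`, of the deviation from the ellipsoid with centre `C / N` through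
`v`, as a function of `z - v`. -/
def slope (α β N : ℕ) (C v : V6) : V6 :=
  let d := sub (smul N v) C
  smul (-2) (add (smul α (F1 d)) (smul β (F2 d)))

/-- The test on minimal vectors that the ellipsoid with centre `C / N` through `v` is empty. -/
def emptyCheck (α β N : ℕ) (C v : V6) : Bool :=
  let a := slope α β N C v
  minimalVectors.all fun u => decide (dot a u ≤ N * bil α β u u) &&
    decide (-dot a u ≤ N * bil α β u u)

/-- The test that `L` contains all lattice points on the ellipsoid with centre `C / N` through `v`,
given that the ellipsoid is empty. -/
def contactCheck (α β N : ℕ) (C v : V6) (L : List V6) : Bool :=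
  let a := slope α β N C v
  decide (v ∈ L) &&
  minimalVectors.all (fun u =>
    (decide (dot a u = N * bil α β u u) → decide (add v u ∈ L)) &&
    (decide (-dot a u = N * bil α β u u) → decide (add v (neg u) ∈ L))) &&
  L.all fun x => L.all fun y =>
    decide (bil α β (sub x v) (sub y v) = 0) → decide (sub (add x y) v ∈ L)

/-- The test that `w` lies on the ellipsoid with centre `C / N` through `v`. -/
def onCheck (α β N : ℕ) (C v w : V6) : Bool :=
  decide (dot (slope α β N C v) (sub w v) = N * bil α β (sub w v) (sub w v))

/-- The point `C / N`. -/
noncomputable def quot (N : ℕ) (C : V6) : R6 := (N : ℝ)⁻¹ • C.toR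

theorem dev_toR {α β N : ℕ} (hN : 0 < N) (C v z : V6) :
    N * dev α β (quot N C) (qf α β (v.toR - quot N C)) z.toR =
      ((N * bil α β (sub z v) (sub z v) - dot (slope α β N C v) (sub z v) : ℤ) : ℝ) := by
  have hN' : (N : ℝ) ≠ 0 := by positivity
  obtain ⟨D, hD⟩ : ∃ D : R6, D = quot N C := ⟨_, rfl⟩
  have hC : ∀ i, C.toR i = N * D i := by
    intro i
    rw [hD, quot, Pi.smul_apply, smul_eq_mul, ← mul_assoc, mul_inv_cancel₀ hN', one_mul]
  have h0 := hC 0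
  have h1 := hC 1
  have h2 := hC 2
  have h3 := hC 3
  have h4 := hC 4
  have h5 := hC 5
  simp only [toR_0, toR_1, toR_2, toR_3, toR_4, toR_5] at h0 h1 h2 h3 h4 h5
  rw [← hD]
  simp only [dev, qf, bf, form1, form2, bil, dot, F1, F2, slope, sub, smul, add, toR_0, toR_1,
    toR_2, toR_3, toR_4, toR_5, Pi.sub_apply]
  push_cast
  rw [h0, h1, h2, h3, h4, h5]
  ring

theorem dev_nonneg_of_check {α β N : ℕ} {C v : V6} (h : 0 < α + β) (hN : 0 < N)
    (hc : emptyCheck α β N C v = true) {z : R6} (hz : z ∈ Z6) :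
    0 ≤ dev α β (quot N C) (qf α β (v.toR - quot N C)) z := by
  obtain ⟨z, rfl⟩ := mem_Z6_iff.1 hz
  have hN' : (0 : ℝ) < N := by positivity
  have key := nonneg_of_minimalVectors h N (slope α β N C v) (fun _ => True) trivial
    (by
      intro u hu
      simp only [emptyCheck, List.all_eq_true, Bool.and_eq_true, decide_eq_true_eq] at hc
      exact ⟨hc u hu, fun _ => trivial, fun _ => trivial⟩) (fun _ _ _ _ _ => trivial) hN (sub z v)
  refine nonneg_of_mul_nonneg_right (a := (N : ℝ)) ?_ hN'
  rw [dev_toR hN]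
  exact_mod_cast sub_nonneg.2 key.1

theorem mem_of_dev_eq_zero {α β N : ℕ} {C v : V6} {L : List V6} (h : 0 < α + β) (hN : 0 < N)
    (hc : emptyCheck α β N C v = true) (hL : contactCheck α β N C v L = true) {z : R6}
    (hz : z ∈ Z6) (h0 : dev α β (quot N C) (qf α β (v.toR - quot N C)) z = 0) :
    ∃ w ∈ L, w.toR = z := by
  obtain ⟨z, rfl⟩ := mem_Z6_iff.1 hz
  refine ⟨z, ?_, rfl⟩
  simp only [emptyCheck, List.all_eq_true, Bool.and_eq_true, decide_eq_true_eq] at hc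
  simp only [contactCheck, List.all_eq_true, Bool.and_eq_true, decide_eq_true_eq] at hL
  obtain ⟨⟨hv, hu⟩, hadd⟩ := hL
  have e0 : ∀ x : V6, add v (sub x v) = x := by
    intro x; ext <;> simp only [add, sub] <;> ring
  have e1 : ∀ x : V6, sub (add v x) v = x := by
    intro x; ext <;> simp only [add, sub] <;> ring
  have key := nonneg_of_minimalVectors h N (slope α β N C v) (fun x => add v x ∈ L)
    (by convert hv using 1; ext <;> simp [add, zero])
    (fun u hm => ⟨hc u hm, (hu u hm).1, (hu u hm).2⟩)
    (by
      intro x y hx hy hxy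
      have := hadd _ hx _ hy
      rw [e1, e1] at this
      have h2 := this hxy
      convert h2 using 1
      ext <;> simp only [add, sub] <;> ring) hN (sub z v)
  have h1 := dev_toR hN C v z (α := α) (β := β)
  rw [h0, mul_zero] at h1
  have h2 : (N : ℤ) * bil α β (sub z v) (sub z v) - dot (slope α β N C v) (sub z v) = 0 := by
    exact_mod_cast h1.symm
  have := key.2 (by linarith)
  rwa [e0] at this

theorem dev_eq_zero_iff {α β N : ℕ} {C v w : V6} (hN : 0 < N) :
    dev α β (quot N C) (qf α β (v.toR - quot N C)) w.toR = 0 ↔ onCheck α β N C v w = true := by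
  have hN' : (N : ℝ) ≠ 0 := by positivity
  have h1 := dev_toR hN C v w (α := α) (β := β)
  rw [onCheck, decide_eq_true_eq]
  constructor
  · intro h
    rw [h, mul_zero] at h1
    have h2 : (N : ℤ) * bil α β (sub w v) (sub w v) - dot (slope α β N C v) (sub w v) = 0 := by
      exact_mod_cast h1.symm
    linarith
  · intro h
    rw [h, sub_self, Int.cast_zero] at h1
    exact (mul_eq_zero.1 h1).resolve_left hN'

end V6

/-! ### Deviations and affine functions -/

theorem qf_eq (α β : ℕ) (x : R6) : qf α β x = α * qf 1 0 x + β * qf 0 1 x := by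
  simp [qf, bf]

theorem qf_neg (α β : ℕ) (x : R6) : qf α β (-x) = qf α β x := by
  simp only [qf, bf, form1, form2, Pi.neg_apply]; ring

/-- The difference of the deviations from two ellipsoids of the same form is affine. -/
theorem exists_affine_dev_sub (α β : ℕ) (c c' : R6) (r r' : ℝ) :
    ∃ A : R6 →ᵃ[ℝ] ℝ, ∀ x, A x = dev α β c r x - dev α β c' r' x := by
  let L : R6 →ₗ[ℝ] ℝ :=
    { toFun := fun x => bf α β (2 • (c' - c)) x
      map_add' := by
        intro x y; simp only [bf, form1, form2, Pi.add_apply]; ring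
      map_smul' := by
        intro k x
        simp only [bf, form1, form2, Pi.smul_apply, smul_eq_mul, RingHom.id_apply]; ring }
  refine ⟨L.toAffineMap + AffineMap.const ℝ R6 (qf α β c - r - (qf α β c' - r')), fun x => ?_⟩
  simp only [AffineMap.coe_add, Pi.add_apply, LinearMap.coe_toAffineMap, AffineMap.const_apply]
  change bf α β (2 • (c' - c)) x + _ = _
  simp only [dev, qf, bf, form1, form2, Pi.smul_apply, Pi.sub_apply, nsmul_eq_mul, Nat.cast_ofNat]
  ring

theorem convex_dev_nonpos (α β : ℕ) (c : R6) (r : ℝ) : Convex ℝ {x | dev α β c r x ≤ 0} := by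
  intro x hx y hy a b ha hb hab
  simp only [Set.mem_ofPred_eq] at *
  have key : dev α β c r (a • x + b • y)
      = a * dev α β c r x + b * dev α β c r y - a * b * qf α β (x - y) := by
    obtain rfl : b = 1 - a := by linarith
    simp only [dev, qf, bf, form1, form2, Pi.sub_apply, Pi.add_apply, Pi.smul_apply, smul_eq_mul]
    ring
  rw [key]
  have := qf_nonneg α β (x - y)
  nlinarith [mul_nonneg (mul_nonneg ha hb) this, mul_nonneg ha (neg_nonneg.2 hx),
    mul_nonneg hb (neg_nonneg.2 hy)]

/-- The lattice points in the convex hull of lattice points on an empty ellipsoid lie on it. -/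
theorem dev_eq_zero_of_mem_convexHull {α β : ℕ} {c : R6} {r : ℝ}
    (h : ∀ z ∈ Z6, 0 ≤ dev α β c r z) {S : Set R6} (hS : ∀ z ∈ S, dev α β c r z = 0) {z : R6}
    (hz : z ∈ Z6) (hzS : z ∈ convexHull ℝ S) : dev α β c r z = 0 :=
  le_antisymm (convexHull_min (fun s hs => (hS s hs).le) (convex_dev_nonpos α β c r) hzS) (h z hz)

theorem affine_apply (A : R6 →ᵃ[ℝ] ℝ) (x : R6) : A x = A.linear x + A 0 := by
  have := A.map_vadd 0 x
  simpa using this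

theorem affine_comb (A : R6 →ᵃ[ℝ] ℝ) {x y : R6} {a b : ℝ} (hab : a + b = 1) :
    A (a • x + b • y) = a * A x + b * A y := by
  obtain rfl : a = 1 - b := by linarith
  have h1 : (1 - b) • x + b • y = AffineMap.lineMap x y b := by
    rw [AffineMap.lineMap_apply_module]
  rw [h1, A.apply_lineMap, AffineMap.lineMap_apply_module]
  simp

theorem affine_nonneg_of_mem_convexHull {V : Set R6} {A : R6 →ᵃ[ℝ] ℝ} (hA : ∀ v ∈ V, 0 ≤ A v)
    {x : R6} (hx : x ∈ convexHull ℝ V) : 0 ≤ A x := by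
  refine convexHull_min (t := {x | 0 ≤ A x}) hA ?_ hx
  intro x hx y hy a b ha hb hab
  simp only [Set.mem_ofPred_eq] at *
  rw [affine_comb A hab]
  positivity

/-- The zero set, on a convex hull, of an affine function which is nonnegative there. -/
theorem mem_convexHull_zero {V : Set R6} {A : R6 →ᵃ[ℝ] ℝ} (hA : ∀ v ∈ V, 0 ≤ A v)
    {x : R6} (hx : x ∈ convexHull ℝ V) (h0 : A x = 0) : x ∈ convexHull ℝ {v ∈ V | A v = 0} := by
  suffices h : x ∈ {x | 0 ≤ A x ∧ (A x = 0 → x ∈ convexHull ℝ {v ∈ V | A v = 0})} from h.2 h0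
  refine convexHull_min (t := {x | 0 ≤ A x ∧ (A x = 0 → x ∈ convexHull ℝ {v ∈ V | A v = 0})})
    (fun v hv => ⟨hA v hv, fun h => subset_convexHull ℝ _ ⟨hv, h⟩⟩) ?_ hx
  rintro x ⟨hx, hx'⟩ y ⟨hy, hy'⟩ a b ha hb hab
  simp only [Set.mem_ofPred_eq]
  rw [affine_comb A hab]
  refine ⟨by positivity, fun h => ?_⟩
  have h1 : a * A x = 0 := by nlinarith [mul_nonneg ha hx, mul_nonneg hb hy]
  have h2 : b * A y = 0 := by nlinarith [mul_nonneg ha hx, mul_nonneg hb hy]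
  rcases mul_eq_zero.1 h1 with rfl | h1
  · obtain rfl : b = 1 := by linarith
    simpa using hy' (by simpa using h2)
  · rcases mul_eq_zero.1 h2 with rfl | h2
    · obtain rfl : a = 1 := by linarith
      simpa using hx' (by simpa using h1)
    · exact convex_convexHull ℝ _ (hx' h1) (hy' h2) ha hb hab

theorem isFace_zero {P : Set R6} (A : R6 →ᵃ[ℝ] ℝ) (hA : ∀ x ∈ P, 0 ≤ A x) :
    IsFace P {x ∈ P | A x = 0} := by
  have hd := affine_apply A
  rintro ⟨b, hbP, hb⟩
  refine ⟨-(LinearMap.toContinuousLinearMap A.linear), ?_⟩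
  ext x
  simp only [Set.mem_ofPred_eq, neg_apply,
    LinearMap.coe_toContinuousLinearMap', neg_le_neg_iff]
  refine and_congr_right fun hx => ⟨fun h y hy => ?_, fun h => ?_⟩
  · have := hA y hy
    linarith [hd x, hd y]
  · exact le_antisymm (by linarith [h b hbP, hd x, hd b]) (hA x hx)

/-- A nonempty face is the zero set of an affine function which is nonnegative on the polytope. -/
theorem IsFace.exists_affine {P F : Set R6} (h : IsFace P F) (hF : F.Nonempty) :
    ∃ A : R6 →ᵃ[ℝ] ℝ, (∀ x ∈ P, 0 ≤ A x) ∧ F = {x ∈ P | A x = 0} := by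
  obtain ⟨l, hl⟩ := h hF
  obtain ⟨b, hb⟩ := hF
  have hb' := hb
  rw [hl] at hb'
  refine ⟨AffineMap.const ℝ R6 (l b) - l.toLinearMap.toAffineMap, fun x hx => ?_, ?_⟩
  · simpa using hb'.2 x hx
  · rw [hl]
    ext x
    simp only [Set.mem_ofPred_eq]
    refine and_congr_right fun hx => ⟨fun h => ?_, fun h y hy => ?_⟩
    · simpa [sub_eq_zero] using le_antisymm (h b hb'.1) (hb'.2 x hx)
    · have : l b = l x := by simpa [sub_eq_zero] using h
      rw [← this]; exact hb'.2 y hy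

theorem affine_eq_zero_of_interior {P : Set R6} {A : R6 →ᵃ[ℝ] ℝ} (hA : ∀ x ∈ P, 0 ≤ A x)
    {y : R6} (hy : y ∈ interior P) (h0 : A y = 0) (x : R6) : A x = 0 := by
  have hd := affine_apply A
  have hlin : ∀ d, 0 ≤ A.linear d := by
    intro d
    have hc : Filter.Tendsto (fun t : ℝ => y + t • d) (𝓝[>] 0) (𝓝 y) := by
      have : Continuous fun t : ℝ => y + t • d := by fun_prop
      have h := this.tendsto 0
      rw [zero_smul, add_zero] at h
      exact h.mono_left nhdsWithin_le_nhds
    have h1 := hc.eventually (mem_interior_iff_mem_nhds.1 hy)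
    obtain ⟨t, ht, ht0⟩ := (h1.and self_mem_nhdsWithin).exists
    have h2 := hA _ ht
    rw [hd, map_add, map_smul, smul_eq_mul] at h2
    rw [hd] at h0
    have ht0 : 0 < t := ht0
    exact nonneg_of_mul_nonneg_right (by linarith : 0 ≤ t * A.linear d) ht0
  have hz : ∀ d, A.linear d = 0 := fun d =>
    le_antisymm (by have := hlin (-d); rw [map_neg] at this; linarith) (hlin d)
  rw [hd] at h0 ⊢
  rw [hz] at h0 ⊢
  exact h0

theorem isZPolytope_convexHull {S : Set R6} (hS : S.Finite) (hZ : S ⊆ Z6) :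
    IsZPolytope (convexHull ℝ S) := by
  refine ⟨⟨S, hS, rfl⟩, fun F hF => ?_⟩
  rcases F.eq_empty_or_nonempty with rfl | hne
  · simp
  obtain ⟨A, hA, rfl⟩ := IsFace.exists_affine hF hne
  apply Set.Subset.antisymm
  · refine convexHull_min Set.inter_subset_left ?_
    rintro x ⟨hx, hx0⟩ y ⟨hy, hy0⟩ a b ha hb hab
    refine ⟨convex_convexHull ℝ S hx hy ha hb hab, ?_⟩
    rw [affine_comb A hab, hx0, hy0]; ring
  · rintro x ⟨hx, hx0⟩
    refine convexHull_mono ?_ (mem_convexHull_zero (fun v hv => hA v (subset_convexHull ℝ S hv))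
      hx hx0)
    rintro v ⟨hv, hv0⟩
    exact ⟨⟨subset_convexHull ℝ S hv, hv0⟩, hZ hv⟩

/-! ### Free sums of simplexes -/

theorem mem_convexHull_image {n : ℕ} {v : Fin n → R6} {S : Set (Fin n)} {x : R6} :
    x ∈ convexHull ℝ (v '' S) ↔ ∃ t : Fin n → ℝ, (∀ i, 0 ≤ t i) ∧ ∑ i, t i = 1 ∧
      (∀ i, i ∉ S → t i = 0) ∧ ∑ i, t i • v i = x := by
  classical
  constructor
  · intro hx
    refine convexHull_min (t := {x | ∃ t : Fin n → ℝ, (∀ i, 0 ≤ t i) ∧ ∑ i, t i = 1 ∧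
      (∀ i, i ∉ S → t i = 0) ∧ ∑ i, t i • v i = x}) ?_ ?_ hx
    · rintro _ ⟨i, hi, rfl⟩
      refine ⟨fun j => if j = i then 1 else 0, fun j => ?_, by simp, fun j hj => if_neg ?_, by simp⟩
      · by_cases h : j = i <;> simp [h]
      · rintro rfl
        exact hj hi
    · rintro _ ⟨t, t0, t1, tS, rfl⟩ _ ⟨u, u0, u1, uS, rfl⟩ a b ha hb hab
      refine ⟨fun i => a * t i + b * u i, fun i => ?_, ?_, fun i hi => ?_, ?_⟩
      · have := t0 i; have := u0 i; positivity
      · rw [Finset.sum_add_distrib, ← Finset.mul_sum, ← Finset.mul_sum, t1, u1]; linarith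
      · simp [tS i hi, uS i hi]
      · simp only [add_smul, mul_smul, Finset.sum_add_distrib, Finset.smul_sum]
  · rintro ⟨t, t0, t1, tS, rfl⟩
    have hs : ∑ i, t i • v i = ∑ i ∈ Finset.univ.filter (· ∈ S), t i • v i := by
      rw [Finset.sum_filter]
      refine Finset.sum_congr rfl fun i _ => ?_
      split_ifs with h
      · rfl
      · rw [tS i h, zero_smul]
    rw [hs]
    refine (convex_convexHull ℝ (v '' S)).sum_mem (fun i _ => t0 i) ?_ fun i hi =>
      subset_convexHull ℝ _ ⟨i, (Finset.mem_filter.1 hi).2, rfl⟩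
    rw [← t1, Finset.sum_filter]
    refine Finset.sum_congr rfl fun i _ => ?_
    split_ifs with h
    · rfl
    · rw [tS i h]

/-- A family of points of `ℝ⁶` divided into `k` blocks with the common centroid `c`, each block
being the vertex set of a simplex, in such a way that the spaces spanned by the simplexes form a
direct sum. The functions `a i` are the coordinates with respect to the blocks:
`x = c + ∑ a i x • v i`, where the coordinates of each block have sum zero. -/
structure BlockFrame (n k : ℕ) where
  blk : Fin n → Fin k
  v : Fin n → R6
  c : R6
  a : Fin n → R6 →ᵃ[ℝ] ℝ
  /-- The number of points in a block. -/
  s : Fin k → ℝ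
  s_eq : ∀ K, ((Finset.univ.filter (blk · = K)).card : ℝ) = s K
  s_pos : ∀ K, 0 < s K
  k_pos : 0 < k
  coord : ∀ i j, a i (v j) = (if i = j then 1 else 0) - (if blk i = blk j then (s (blk i))⁻¹ else 0)
  recon : ∀ x, x = c + ∑ i, a i x • v i
  zero_sum : ∀ K x, ∑ i ∈ Finset.univ.filter (blk · = K), a i x = 0
  cent : ∀ K, ∑ i ∈ Finset.univ.filter (blk · = K), v i = s K • c

namespace BlockFrame

variable {n k : ℕ} (B : BlockFrame n k)

/-- The free sum: the convex hull of all blocks. -/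
def hull : Set R6 := convexHull ℝ (Set.range B.v)

theorem mem_hull {x : R6} :
    x ∈ B.hull ↔ ∃ t : Fin n → ℝ, (∀ i, 0 ≤ t i) ∧ ∑ i, t i = 1 ∧ ∑ i, t i • B.v i = x := by
  rw [hull, ← Set.image_univ, mem_convexHull_image]
  simp

theorem v_mem_hull (i : Fin n) : B.v i ∈ B.hull := subset_convexHull ℝ _ ⟨i, rfl⟩

theorem sum_blocks {M : Type*} [AddCommMonoid M] (f : Fin n → M) :
    ∑ i, f i = ∑ K, ∑ i ∈ Finset.univ.filter (B.blk · = K), f i :=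
  (Finset.sum_fiberwise Finset.univ B.blk f).symm

theorem sum_a (x : R6) : ∑ i, B.a i x = 0 := by
  rw [B.sum_blocks]
  exact Finset.sum_eq_zero fun K _ => B.zero_sum K x

/-- An affine function in terms of its values on the points of the frame. -/
theorem affine_eq (A : R6 →ᵃ[ℝ] ℝ) (x : R6) : A x = A B.c + ∑ i, B.a i x * A (B.v i) := by
  have hd := affine_apply A
  have h1 : A x = A.linear (B.c + ∑ i, B.a i x • B.v i) + A 0 := by rw [← B.recon x]; exact hd x
  have h2 : ∑ i, B.a i x * A (B.v i) = ∑ i, B.a i x * A.linear (B.v i) := by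
    have : ∀ i, B.a i x * A (B.v i) = B.a i x * A.linear (B.v i) + B.a i x * A 0 := fun i => by
      rw [hd (B.v i), mul_add]
    rw [Finset.sum_congr rfl fun i _ => this i, Finset.sum_add_distrib, ← Finset.sum_mul, B.sum_a,
      zero_mul, add_zero]
  rw [h1, h2, map_add, map_sum, hd B.c]
  simp only [map_smul, smul_eq_mul]
  ring

theorem affine_c (A : R6 →ᵃ[ℝ] ℝ) (K : Fin k) :
    B.s K * A B.c = ∑ i ∈ Finset.univ.filter (B.blk · = K), A (B.v i) := by
  have hd := affine_apply A
  have h := congrArg A.linear (B.cent K)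
  rw [map_sum, map_smul, smul_eq_mul] at h
  rw [hd, mul_add, ← h, Finset.sum_congr rfl fun i _ => hd (B.v i), Finset.sum_add_distrib]
  simp [B.s_eq]

theorem a_c (i : Fin n) : B.a i B.c = 0 := by
  have h := B.affine_c (B.a i) (B.blk i)
  have hs := B.s_pos (B.blk i)
  rw [Finset.sum_congr rfl fun j _ => B.coord i j, Finset.sum_sub_distrib] at h
  rw [Finset.sum_congr rfl (g := fun _ => (B.s (B.blk i))⁻¹) (fun j hj => if_pos
    (Finset.mem_filter.1 hj).2.symm)] at h
  rw [Finset.sum_const, nsmul_eq_mul, B.s_eq, mul_inv_cancel₀ hs.ne', Finset.sum_ite_eq] at h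
  simpa [hs.ne'] using h

/-- All coordinates vanish at `c`, so that the weights of nearby points are close to those of `c`,
which are positive. -/
theorem c_mem_interior : B.c ∈ interior B.hull := by
  have hk : (0 : ℝ) < k := by exact_mod_cast B.k_pos
  rw [mem_interior]
  refine ⟨⋂ i, {x | 0 < B.a i x + (k * B.s (B.blk i))⁻¹}, ?_, ?_, ?_⟩
  · intro x hx
    simp only [Set.mem_iInter, Set.mem_ofPred_eq] at hx
    rw [B.mem_hull]
    have hsum : ∀ K, ∑ i ∈ Finset.univ.filter (B.blk · = K), (k * B.s (B.blk i))⁻¹ =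
        (k : ℝ)⁻¹ := by
      intro K
      have := B.s_pos K
      rw [Finset.sum_congr rfl (g := fun _ => (k * B.s K)⁻¹) fun i hi => by
        rw [(Finset.mem_filter.1 hi).2], Finset.sum_const, nsmul_eq_mul, B.s_eq]
      field_simp
    refine ⟨fun i => B.a i x + (k * B.s (B.blk i))⁻¹, fun i => (hx i).le, ?_, ?_⟩
    · rw [Finset.sum_add_distrib, B.sum_a, B.sum_blocks, Finset.sum_congr rfl fun K _ => hsum K]
      simp [hk.ne']
    · simp only [add_smul, Finset.sum_add_distrib]
      have : ∑ i, (k * B.s (B.blk i))⁻¹ • B.v i = B.c := by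
        rw [B.sum_blocks]
        have h1 : ∀ K, ∑ i ∈ Finset.univ.filter (B.blk · = K), (k * B.s (B.blk i))⁻¹ • B.v i =
            (k : ℝ)⁻¹ • B.c := by
          intro K
          have := B.s_pos K
          rw [Finset.sum_congr rfl (g := fun i => (k * B.s K)⁻¹ • B.v i) fun i hi => by
            rw [(Finset.mem_filter.1 hi).2], ← Finset.smul_sum, B.cent, smul_smul]
          congr 1
          field_simp
        rw [Finset.sum_congr rfl fun K _ => h1 K, Finset.sum_const, ← Nat.cast_smul_eq_nsmul ℝ,
          smul_smul]
        simp [hk.ne']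
      rw [this, add_comm]
      exact (B.recon x).symm
  · refine isOpen_iInter_of_finite fun i => ?_
    have := (B.a i).continuous_of_finiteDimensional
    exact isOpen_lt continuous_const (by fun_prop)
  · simp only [Set.mem_iInter, Set.mem_ofPred_eq]
    intro i
    have := B.s_pos (B.blk i)
    rw [B.a_c, zero_add]
    positivity

/-- A choice of one point from each block. -/
def IsTransversal (w : Fin k → Fin n) : Prop := ∀ K, B.blk (w K) = K

/-- The points left when the points of a transversal are omitted: the vertices of a facet. -/
def rest (w : Fin k → Fin n) : Set (Fin n) := {i | i ≠ w (B.blk i)}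

/-- The affine function vanishing on the facet which omits a transversal, with value one
at `c`. -/
def facetFun (w : Fin k → Fin n) (x : R6) : ℝ := 1 + ∑ K, B.s K * B.a (w K) x

theorem facetFun_v {w : Fin k → Fin n} (hw : B.IsTransversal w) (i : Fin n) :
    B.facetFun w (B.v i) = if i = w (B.blk i) then B.s (B.blk i) else 0 := by
  have h1 : ∀ K, B.s K * B.a (w K) (B.v i) =
      if B.blk i = K then (if i = w (B.blk i) then B.s (B.blk i) else 0) - 1 else 0 := by
    intro K
    have := B.s_pos K
    rw [B.coord, hw K]
    by_cases h : B.blk i = K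
    · subst h
      simp only [eq_comm (a := w (B.blk i)), if_true, mul_sub, mul_inv_cancel₀ this.ne']
      split_ifs <;> simp
    · have h2 : w K ≠ i := by
        rintro rfl
        exact h (hw K)
      rw [if_neg h2, if_neg h, if_neg fun h' => h h'.symm, sub_zero, mul_zero]
  rw [facetFun, Finset.sum_congr rfl fun K _ => h1 K, Finset.sum_ite_eq]
  simp

/-- An affine function vanishing on a facet is a multiple of the facet function. -/
theorem affine_eq_facetFun {w : Fin k → Fin n} (hw : B.IsTransversal w) {A : R6 →ᵃ[ℝ] ℝ}
    (hA : ∀ i ∈ B.rest w, A (B.v i) = 0) (x : R6) : A x = A B.c * B.facetFun w x := by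
  have h1 : ∀ K, A (B.v (w K)) = B.s K * A B.c := by
    intro K
    rw [B.affine_c A K, Finset.sum_eq_single (w K)]
    · intro i hi hne
      refine hA i ?_
      rw [rest, Set.mem_ofPred_eq, (Finset.mem_filter.1 hi).2]
      exact hne
    · intro h
      exact absurd (by simpa using hw K) h
  have h2 : ∑ i, B.a i x * A (B.v i) = ∑ K, B.a (w K) x * (B.s K * A B.c) := by
    rw [B.sum_blocks]
    refine Finset.sum_congr rfl fun K _ => ?_
    rw [Finset.sum_eq_single (w K), h1]
    · intro i hi hne
      rw [hA i, mul_zero]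
      rw [rest, Set.mem_ofPred_eq, (Finset.mem_filter.1 hi).2]
      exact hne
    · intro h
      exact absurd (by simpa using hw K) h
  rw [B.affine_eq A x, h2, facetFun, mul_add, mul_one, Finset.mul_sum]
  congr 1
  exact Finset.sum_congr rfl fun K _ => by ring

/-- A point of least weight in each block. -/
theorem exists_min (t : Fin n → ℝ) :
    ∃ w, B.IsTransversal w ∧ ∀ i, t (w (B.blk i)) ≤ t i := by
  have h : ∀ K, ∃ i, B.blk i = K ∧ ∀ j, B.blk j = K → t i ≤ t j := by
    intro K
    have hne : (Finset.univ.filter (B.blk · = K)).Nonempty := by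
      rw [← Finset.card_pos]
      have := B.s_pos K
      rw [← B.s_eq] at this
      exact_mod_cast this
    obtain ⟨i, hi, hmin⟩ := Finset.exists_min_image _ t hne
    exact ⟨i, (Finset.mem_filter.1 hi).2, fun j hj => hmin j
      (Finset.mem_filter.2 ⟨Finset.mem_univ _, hj⟩)⟩
  choose w hw hmin using h
  exact ⟨w, hw, fun i => hmin _ i rfl⟩

/-- The free sum is cut out by its facet functions: subtracting from the coordinates their minima in
the blocks leaves a convex combination of the points and `c`, in which the weight of `c` is the
facet function of the transversal of minima. -/
theorem mem_hull_of_facetFun {x : R6} (hx : ∀ w, B.IsTransversal w → 0 ≤ B.facetFun w x) :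
    x ∈ B.hull := by
  obtain ⟨w, hw, hmin⟩ := B.exists_min (fun i => B.a i x)
  have h0 := hx w hw
  rw [facetFun] at h0
  have hc : B.c ∈ B.hull := interior_subset B.c_mem_interior
  rw [B.mem_hull] at hc ⊢
  obtain ⟨u, u0, u1, uc⟩ := hc
  set σ := 1 + ∑ K, B.s K * B.a (w K) x with hσ
  have hblock : ∀ K, ∑ i ∈ Finset.univ.filter (B.blk · = K), B.a (w (B.blk i)) x =
      B.s K * B.a (w K) x := by
    intro K
    rw [Finset.sum_congr rfl (g := fun _ => B.a (w K) x) fun i hi => by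
      rw [(Finset.mem_filter.1 hi).2], Finset.sum_const, nsmul_eq_mul, B.s_eq]
  have hblockv : ∀ K, ∑ i ∈ Finset.univ.filter (B.blk · = K), B.a (w (B.blk i)) x • B.v i =
      (B.s K * B.a (w K) x) • B.c := by
    intro K
    rw [Finset.sum_congr rfl (g := fun i => B.a (w K) x • B.v i) fun i hi => by
      rw [(Finset.mem_filter.1 hi).2], ← Finset.smul_sum, B.cent, smul_smul, mul_comm]
  refine ⟨fun i => B.a i x - B.a (w (B.blk i)) x + σ * u i, fun i => ?_, ?_, ?_⟩
  · have := hmin i; have := mul_nonneg h0 (u0 i); linarith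
  · rw [Finset.sum_add_distrib, Finset.sum_sub_distrib, B.sum_a, ← Finset.mul_sum, u1,
      B.sum_blocks (fun i => B.a (w (B.blk i)) x), Finset.sum_congr rfl fun K _ => hblock K]
    ring
  · simp only [add_smul, sub_smul, mul_smul, Finset.sum_add_distrib, Finset.sum_sub_distrib,
      ← Finset.smul_sum, uc]
    rw [B.sum_blocks (fun i => B.a (w (B.blk i)) x • B.v i),
      Finset.sum_congr rfl fun K _ => hblockv K, ← Finset.sum_smul, hσ, add_smul, one_smul]
    conv_rhs => rw [B.recon x]
    abel

/-- Moving weight from the other blocks to the block `K₀` shows that the simplexes which contain the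
block `K₀` and omit a point of each other block cover the free sum. -/
theorem exists_mem_piece (K₀ : Fin k) {x : R6} (hx : x ∈ B.hull) :
    ∃ w, B.IsTransversal w ∧
      x ∈ convexHull ℝ (B.v '' {i | B.blk i = K₀ ∨ i ≠ w (B.blk i)}) := by
  rw [B.mem_hull] at hx
  obtain ⟨t, t0, t1, rfl⟩ := hx
  obtain ⟨w, hw, hmin⟩ := B.exists_min t
  refine ⟨w, hw, mem_convexHull_image.2 ?_⟩
  have hs0 := B.s_pos K₀
  obtain ⟨m, hm0, hm⟩ : ∃ m : Fin k → ℝ,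
      m K₀ = -(∑ J ∈ Finset.univ.erase K₀, B.s J * t (w J)) / B.s K₀ ∧
      ∀ K, K ≠ K₀ → m K = t (w K) :=
    ⟨fun K => if K = K₀ then -(∑ J ∈ Finset.univ.erase K₀, B.s J * t (w J)) / B.s K₀ else t (w K),
      if_pos rfl, fun K hK => if_neg hK⟩
  have hmsum : ∑ K, B.s K * m K = 0 := by
    have h : ∑ K ∈ Finset.univ.erase K₀, B.s K * m K =
        ∑ K ∈ Finset.univ.erase K₀, B.s K * t (w K) :=
      Finset.sum_congr rfl fun K hK => by rw [hm K (Finset.ne_of_mem_erase hK)]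
    rw [← Finset.add_sum_erase _ _ (Finset.mem_univ K₀), hm0, mul_div_cancel₀ _ hs0.ne', h]
    ring
  refine ⟨fun i => t i - m (B.blk i), fun i => ?_, ?_, fun i hi => ?_, ?_⟩
  · by_cases h : B.blk i = K₀
    · have h1 : 0 ≤ ∑ J ∈ Finset.univ.erase K₀, B.s J * t (w J) :=
        Finset.sum_nonneg fun J _ => mul_nonneg (B.s_pos J).le (t0 (w J))
      have h2 : m (B.blk i) ≤ 0 := by
        rw [h, hm0]
        exact div_nonpos_of_nonpos_of_nonneg (neg_nonpos.2 h1) hs0.le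
      have := t0 i
      linarith
    · have := hmin i
      have := hm _ h
      simp only
      linarith
  · rw [Finset.sum_sub_distrib, t1, B.sum_blocks (fun i => m (B.blk i))]
    rw [Finset.sum_congr rfl (g := fun K => B.s K * m K) fun K _ => by
      rw [Finset.sum_congr rfl (g := fun _ => m K) fun i hi => by
        rw [(Finset.mem_filter.1 hi).2], Finset.sum_const, nsmul_eq_mul, B.s_eq], hmsum, sub_zero]
  · simp only [Set.mem_ofPred_eq, not_or, not_not] at hi
    simp only
    rw [hm _ hi.1, ← hi.2, sub_self]
  · simp only [sub_smul, Finset.sum_sub_distrib]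
    rw [B.sum_blocks (fun i => m (B.blk i) • B.v i)]
    rw [Finset.sum_congr rfl (g := fun K => (B.s K * m K) • B.c) fun K _ => by
      rw [Finset.sum_congr rfl (g := fun i => m K • B.v i) fun i hi => by
        rw [(Finset.mem_filter.1 hi).2], ← Finset.smul_sum, B.cent, smul_smul, mul_comm],
      ← Finset.sum_smul, hmsum, zero_smul, sub_zero]

/-- The only affine dependences are the differences of the blocks. -/
theorem dependence {u : Fin n → ℝ} (h0 : ∑ i, u i = 0) (h1 : ∑ i, u i • B.v i = 0) (i : Fin n) :
    B.s (B.blk i) * u i = ∑ j ∈ Finset.univ.filter (B.blk · = B.blk i), u j := by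
  have hd := affine_apply (B.a i)
  have hs := B.s_pos (B.blk i)
  have h2 : ∑ j, u j * B.a i (B.v j) = 0 := by
    have := congrArg (B.a i).linear h1
    rw [map_sum, map_zero] at this
    simp only [map_smul, smul_eq_mul] at this
    rw [Finset.sum_congr rfl (g := fun j => u j * (B.a i).linear (B.v j) + u j * B.a i 0)
      fun j _ => by rw [hd (B.v j), mul_add], Finset.sum_add_distrib, this, ← Finset.sum_mul, h0]
    simp
  simp only [B.coord, mul_sub, mul_ite, mul_one, mul_zero, Finset.sum_sub_distrib,
    Finset.sum_ite_eq, Finset.mem_univ, if_true] at h2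
  rw [← Finset.sum_filter, ← Finset.sum_mul] at h2
  rw [Finset.filter_congr (q := fun j => B.blk i = B.blk j) fun j _ => eq_comm]
  field_simp at h2
  linarith

theorem affineIndependent_v (B : BlockFrame n 1) : AffineIndependent ℝ B.v := by
  rw [affineIndependent_iff_of_fintype]
  intro u hu0 hu1 i
  rw [Finset.weightedVSub_eq_weightedVSubOfPoint_of_sum_eq_zero _ u _ hu0 (0 : R6),
    Finset.weightedVSubOfPoint_apply] at hu1
  simp only [vsub_eq_sub, sub_zero] at hu1
  have h := B.dependence hu0 hu1 i
  rw [Finset.filter_true_of_mem fun j _ => Subsingleton.elim _ _, hu0] at h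
  exact (mul_eq_zero.1 h).resolve_left (B.s_pos _).ne'

end BlockFrame

/-! ### Tilings by Delaunay polytopes which are free sums of simplexes -/

theorem qf_sub_comm (α β : ℕ) (x y : R6) : qf α β (x - y) = qf α β (y - x) := by
  rw [← qf_neg, neg_sub]

theorem qf_triangle (α β : ℕ) (x y z : R6) :
    qf α β (x - z) ≤ 2 * (qf α β (x - y) + qf α β (y - z)) := by
  have h := qf_nonneg α β ((x - y) - (y - z))
  have e : 2 * (qf α β (x - y) + qf α β (y - z)) - qf α β (x - z) =
      qf α β ((x - y) - (y - z)) := by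
    simp only [qf, bf, form1, form2, Pi.sub_apply]; ring
  linarith

theorem continuous_qf (α β : ℕ) : Continuous (qf α β) := by
  unfold qf bf form1 form2
  fun_prop

theorem finite_lattice_ball (x : R6) (K : ℝ) : {z | z ∈ Z6 ∧ qf 1 1 (z - x) ≤ K}.Finite := by
  refine ((Set.finite_Icc (fun i => ⌊x i - (8 * K + 1)⌋) (fun i => ⌈x i + (8 * K + 1)⌉)).image
    (fun (z : Fin 6 → ℤ) (i : Fin 6) => (z i : ℝ))).subset ?_
  rintro _ ⟨⟨z, rfl⟩, hz⟩
  refine ⟨z, ?_, rfl⟩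
  have h := (qf_lower (by norm_num) _).trans hz
  simp only [Pi.sub_apply] at h
  have hi : ∀ i, ((z i : ℝ) - x i) ^ 2 ≤ 8 * K := by
    intro i
    fin_cases i <;> simp only [Fin.zero_eta, Fin.mk_one, Fin.reduceFinMk] <;>
    nlinarith [sq_nonneg ((z 0 : ℝ) - x 0), sq_nonneg ((z 1 : ℝ) - x 1),
      sq_nonneg ((z 2 : ℝ) - x 2), sq_nonneg ((z 3 : ℝ) - x 3), sq_nonneg ((z 4 : ℝ) - x 4),
      sq_nonneg ((z 5 : ℝ) - x 5)]
  have hb : ∀ i, -(8 * K + 1) ≤ (z i : ℝ) - x i ∧ (z i : ℝ) - x i ≤ 8 * K + 1 := by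
    intro i
    have := hi i
    constructor <;> nlinarith [sq_nonneg ((z i : ℝ) - x i - 1), sq_nonneg ((z i : ℝ) - x i + 1)]
  constructor
  · intro i
    have : (⌊x i - (8 * K + 1)⌋ : ℝ) ≤ z i := (Int.floor_le _).trans (by linarith [(hb i).1])
    exact_mod_cast this
  · intro i
    have : (z i : ℝ) ≤ (⌈x i + (8 * K + 1)⌉ : ℝ) :=
      le_trans (by linarith [(hb i).2]) (Int.le_ceil _)
    exact_mod_cast this

/-- A Delaunay polytope for the form `qf 1 1` which is a six-dimensional free sum of simplexes: the
frame consists of all lattice points on an empty ellipsoid. -/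
structure Tile where
  n : ℕ
  k : ℕ
  B : BlockFrame n k
  card : n = 6 + k
  /-- The centre of the ellipsoid. -/
  o : R6
  /-- The squared radius of the ellipsoid. -/
  r : ℝ
  /-- A common bound for the radii, which makes families of tiles locally finite. -/
  r_le : r ≤ 4
  v_mem : ∀ i, B.v i ∈ Z6
  on : ∀ i, dev 1 1 o r (B.v i) = 0
  empty : ∀ z ∈ Z6, 0 ≤ dev 1 1 o r z
  contact : ∀ z ∈ Z6, dev 1 1 o r z = 0 → z ∈ Set.range B.v

namespace Tile

variable (t t' : Tile)

theorem hull_inter_Z6 : t.B.hull ∩ Z6 = Set.range t.B.v := by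
  apply Set.Subset.antisymm
  · rintro z ⟨hz, hzZ⟩
    refine t.contact z hzZ (dev_eq_zero_of_mem_convexHull t.empty ?_ hzZ hz)
    rintro _ ⟨i, rfl⟩
    exact t.on i
  · rintro _ ⟨i, rfl⟩
    exact ⟨t.B.v_mem_hull i, t.v_mem i⟩

variable {t t'}

theorem range_eq_of_dev_eq (h : ∀ x, dev 1 1 t.o t.r x = dev 1 1 t'.o t'.r x) :
    Set.range t.B.v = Set.range t'.B.v := by
  apply Set.Subset.antisymm
  · rintro _ ⟨i, rfl⟩
    exact t'.contact _ (t.v_mem i) (by rw [← h, t.on])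
  · rintro _ ⟨i, rfl⟩
    exact t.contact _ (t'.v_mem i) (by rw [h, t'.on])

theorem hull_eq_of_dev_eq (h : ∀ x, dev 1 1 t.o t.r x = dev 1 1 t'.o t'.r x) :
    t.B.hull = t'.B.hull := by
  rw [BlockFrame.hull, BlockFrame.hull, range_eq_of_dev_eq h]

theorem dev_eq_of_hull_eq (h : t.B.hull = t'.B.hull) (x : R6) :
    dev 1 1 t.o t.r x = dev 1 1 t'.o t'.r x := by
  have hr : Set.range t.B.v = Set.range t'.B.v := by
    rw [← hull_inter_Z6, ← hull_inter_Z6, h]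
  obtain ⟨A, hA⟩ := exists_affine_dev_sub 1 1 t.o t'.o t.r t'.r
  have h0 : ∀ i, A (t.B.v i) = 0 := by
    intro i
    obtain ⟨j, hj⟩ : t.B.v i ∈ Set.range t'.B.v := hr ▸ ⟨i, rfl⟩
    rw [hA, t.on, ← hj, t'.on, sub_zero]
  have hK := t.B.affine_c A ⟨0, t.B.k_pos⟩
  rw [Finset.sum_eq_zero fun i _ => h0 i] at hK
  have hc := (mul_eq_zero.1 hK).resolve_left (t.B.s_pos _).ne'
  have := t.B.affine_eq A x
  rw [hc, Finset.sum_eq_zero fun i _ => by rw [h0 i, mul_zero], hA] at this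
  linarith

/-- The difference of the deviations from the ellipsoids of two tiles is affine, nonnegative on the
one tile and nonpositive on the other, and vanishes on their intersection only. -/
theorem exists_separation (t t' : Tile) : ∃ A : R6 →ᵃ[ℝ] ℝ,
    (∀ x, A x = dev 1 1 t'.o t'.r x - dev 1 1 t.o t.r x) ∧
    (∀ x ∈ t.B.hull, 0 ≤ A x) ∧ (∀ x ∈ t'.B.hull, A x ≤ 0) ∧
    t.B.hull ∩ t'.B.hull = {x ∈ t.B.hull | A x = 0} ∧
    t.B.hull ∩ t'.B.hull = convexHull ℝ (Set.range t.B.v ∩ Set.range t'.B.v) := by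
  obtain ⟨A, hA⟩ := exists_affine_dev_sub 1 1 t'.o t.o t'.r t.r
  have h1 : ∀ v ∈ Set.range t.B.v, 0 ≤ A v := by
    rintro _ ⟨i, rfl⟩
    rw [hA, t.on, sub_zero]
    exact t'.empty _ (t.v_mem i)
  have h2 : ∀ v ∈ Set.range t'.B.v, 0 ≤ (-A) v := by
    rintro _ ⟨i, rfl⟩
    simp only [AffineMap.coe_neg, Pi.neg_apply]
    rw [hA, t'.on, zero_sub, neg_neg]
    exact t.empty _ (t'.v_mem i)
  have h1' : ∀ x ∈ t.B.hull, 0 ≤ A x := fun x hx => affine_nonneg_of_mem_convexHull h1 hx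
  have h2' : ∀ x ∈ t'.B.hull, A x ≤ 0 := fun x hx => by
    have := affine_nonneg_of_mem_convexHull h2 hx
    simpa using this
  have hsub : ∀ x ∈ t.B.hull, A x = 0 →
      x ∈ convexHull ℝ (Set.range t.B.v ∩ Set.range t'.B.v) := by
    intro x hx h0
    refine convexHull_mono ?_ (mem_convexHull_zero h1 hx h0)
    rintro _ ⟨⟨i, rfl⟩, hv⟩
    refine ⟨⟨i, rfl⟩, t'.contact _ (t.v_mem i) ?_⟩
    rwa [hA, t.on, sub_zero] at hv
  have hsup : convexHull ℝ (Set.range t.B.v ∩ Set.range t'.B.v) ⊆ t.B.hull ∩ t'.B.hull :=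
    Set.subset_inter (convexHull_mono Set.inter_subset_left)
      (convexHull_mono Set.inter_subset_right)
  refine ⟨A, hA, h1', h2', ?_, ?_⟩
  · apply Set.Subset.antisymm
    · rintro x ⟨hx, hx'⟩
      exact ⟨hx, le_antisymm (h2' x hx') (h1' x hx)⟩
    · rintro x ⟨hx, h0⟩
      exact hsup (hsub x hx h0)
  · refine Set.Subset.antisymm ?_ hsup
    rintro x ⟨hx, hx'⟩
    exact hsub x hx (le_antisymm (h2' x hx') (h1' x hx))

theorem isFace_inter (t t' : Tile) : IsFace t.B.hull (t.B.hull ∩ t'.B.hull) := by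
  obtain ⟨A, -, h1, -, h3, -⟩ := exists_separation t t'
  rw [h3]
  exact isFace_zero A h1

/-- Distinct tiles have disjoint interiors. -/
theorem hull_eq_of_mem_interior {y : R6} (hy : y ∈ interior t.B.hull) (hy' : y ∈ t'.B.hull) :
    t.B.hull = t'.B.hull := by
  obtain ⟨A, hA, h1, h2, -, -⟩ := exists_separation t t'
  have h0 : A y = 0 := le_antisymm (h2 y hy') (h1 y (interior_subset hy))
  refine hull_eq_of_dev_eq fun x => ?_
  have := affine_eq_zero_of_interior h1 hy h0 x
  rw [hA] at this
  linarith

/-- A tile shares no complete block of vertices with another tile, as it would then share the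
centroid of the block, an interior point. -/
theorem exists_not_mem_of_ne {S : Set R6} (hne : t.B.hull ≠ t'.B.hull)
    (hS : S ⊆ t'.B.hull) (K : Fin t.k) : ∃ i, t.B.blk i = K ∧ t.B.v i ∉ S := by
  by_contra hcon
  push Not at hcon
  refine hne (hull_eq_of_mem_interior t.B.c_mem_interior ?_)
  have hs := t.B.s_pos K
  have hc : t.B.c = ∑ i ∈ Finset.univ.filter (t.B.blk · = K), (t.B.s K)⁻¹ • t.B.v i := by
    rw [← Finset.smul_sum, t.B.cent, smul_smul, inv_mul_cancel₀ hs.ne', one_smul]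
  rw [hc]
  refine (convex_convexHull ℝ _).sum_mem (fun _ _ => (inv_pos.2 hs).le) ?_ fun i hi =>
    hS (hcon i (Finset.mem_filter.1 hi).2)
  rw [Finset.sum_const, nsmul_eq_mul, t.B.s_eq, mul_inv_cancel₀ hs.ne']

theorem finrank_vectorSpan_of_interior {P : Set R6} (hP : (interior P).Nonempty) :
    Module.finrank ℝ (vectorSpan ℝ P) = 6 := by
  have h : affineSpan ℝ P = ⊤ := by
    refine eq_top_iff.2 ?_
    rw [← isOpen_interior.affineSpan_eq_top hP]
    exact affineSpan_mono ℝ interior_subset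
  rw [← direction_affineSpan, h, AffineSubspace.direction_top, finrank_top]
  simp

/-- The facets of a free sum of simplexes omit just one vertex of each simplex. -/
theorem exists_rest_of_isFacet {F : Set R6} (hF : IsFacet t.B.hull F) :
    ∃ w, t.B.IsTransversal w ∧ F = convexHull ℝ (t.B.v '' t.B.rest w) := by
  classical
  obtain ⟨hface, hne, hdim⟩ := hF
  obtain ⟨A, hA, hFA⟩ := IsFace.exists_affine hface hne
  set S : Finset (Fin t.n) := Finset.univ.filter fun i => A (t.B.v i) = 0 with hSdef
  have hFS : F = convexHull ℝ (t.B.v '' (S : Set (Fin t.n))) := by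
    apply Set.Subset.antisymm
    · intro x hx
      rw [hFA] at hx
      refine convexHull_mono ?_ (mem_convexHull_zero
        (fun v hv => hA v (subset_convexHull ℝ _ hv)) hx.1 hx.2)
      rintro _ ⟨⟨i, rfl⟩, hi⟩
      exact ⟨i, by simpa [S] using hi, rfl⟩
    · rw [hFA]
      refine convexHull_min ?_ ?_
      · rintro _ ⟨i, hi, rfl⟩
        exact ⟨t.B.v_mem_hull i, by simpa [S] using hi⟩
      · rintro x ⟨hx, hx0⟩ y ⟨hy, hy0⟩ a b ha hb hab
        exact ⟨convex_convexHull ℝ _ hx hy ha hb hab, by rw [affine_comb A hab, hx0, hy0]; ring⟩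
  have hmiss : ∀ K, ∃ i, t.B.blk i = K ∧ i ∉ S := by
    intro K
    by_contra hcon
    push Not at hcon
    have h1 := t.B.affine_c A K
    rw [Finset.sum_eq_zero fun i hi => by
      have := hcon i (Finset.mem_filter.1 hi).2
      simpa [S] using this] at h1
    have hc := (mul_eq_zero.1 h1).resolve_left (t.B.s_pos _).ne'
    have h2 := affine_eq_zero_of_interior hA t.B.c_mem_interior hc
    have : F = t.B.hull := by
      rw [hFA]
      exact Set.sep_eq_self_iff_mem_true.2 fun x _ => h2 x
    rw [this, finrank_vectorSpan_of_interior ⟨_, t.B.c_mem_interior⟩] at hdim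
    omega
  choose w hw hwS using hmiss
  refine ⟨w, hw, ?_⟩
  rw [hFS]
  have hsub : S ⊆ Finset.univ \ Finset.univ.image w := by
    intro i hi
    simp only [Finset.mem_sdiff, Finset.mem_univ, Finset.mem_image, true_and, not_exists]
    rintro K rfl
    exact hwS K hi
  have hwinj : Function.Injective w := fun K J h => by rw [← hw K, ← hw J, h]
  have hcard : (Finset.univ \ Finset.univ.image w).card = 6 := by
    rw [Finset.card_sdiff_of_subset (Finset.subset_univ _),
      Finset.card_image_of_injective _ hwinj]
    simp [t.card]
  -- Only `6 = n - k` points remain outside a transversal, and a five-dimensional face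
  -- needs them all.
  have hS6 : 6 ≤ S.card := by
    have hSne : 0 < S.card := by
      rw [Finset.card_pos]
      by_contra hcon
      rw [Finset.not_nonempty_iff_eq_empty] at hcon
      rw [hFS, hcon] at hne
      simp at hne
    have h1 : Module.finrank ℝ (vectorSpan ℝ (t.B.v '' (S : Set (Fin t.n)))) = 5 := by
      rw [← hdim, hFS, ← direction_affineSpan ℝ (convexHull ℝ _), affineSpan_convexHull,
        direction_affineSpan]
    have h2 := finrank_vectorSpan_image_finset_le ℝ t.B.v S (n := S.card - 1) (by omega)
    rw [Finset.coe_image, h1] at h2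
    omega
  have hSeq : S = Finset.univ \ Finset.univ.image w :=
    Finset.eq_of_subset_of_card_le hsub (by omega)
  congr 2
  ext i
  simp only [hSeq, Finset.coe_sdiff, Finset.coe_univ, Finset.coe_image, Set.image_univ,
    Set.mem_sdiff, Set.mem_univ, Set.mem_range, true_and, BlockFrame.rest, Set.mem_ofPred_eq]
  refine not_congr ⟨?_, fun h => ⟨_, h.symm⟩⟩
  rintro ⟨K, rfl⟩
  rw [hw]

/-- Across a facet the deviation decreases: the difference of the deviations from the ellipsoids of
two tiles which share a facet is a negative multiple of the facet function. -/
theorem exists_slope {w : Fin t.k → Fin t.n} (hw : t.B.IsTransversal w)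
    (hne : t'.B.hull ≠ t.B.hull) (hr : ∀ i ∈ t.B.rest w, t.B.v i ∈ Set.range t'.B.v) :
    ∃ δ < 0, ∀ x, dev 1 1 t'.o t'.r x = dev 1 1 t.o t.r x - δ * t.B.facetFun w x := by
  obtain ⟨A, hA⟩ := exists_affine_dev_sub 1 1 t.o t'.o t.r t'.r
  have h0 : ∀ i ∈ t.B.rest w, A (t.B.v i) = 0 := by
    intro i hi
    obtain ⟨j, hj⟩ := hr i hi
    rw [hA, t.on, ← hj, t'.on, sub_zero]
  have h1 := t.B.affine_eq_facetFun hw h0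
  have h2 : ∀ x, dev 1 1 t'.o t'.r x = dev 1 1 t.o t.r x - A t.B.c * t.B.facetFun w x := by
    intro x
    have := h1 x
    rw [hA] at this
    linarith
  refine ⟨A t.B.c, lt_of_le_of_ne ?_ fun hc => hne ?_, h2⟩
  · have K : Fin t.k := ⟨0, t.B.k_pos⟩
    have h3 := h2 (t.B.v (w K))
    rw [t.on, t.B.facetFun_v hw, hw K, if_pos rfl, zero_sub] at h3
    have h4 := t'.empty _ (t.v_mem (w K))
    have := t.B.s_pos K
    nlinarith
  · refine hull_eq_of_dev_eq fun x => ?_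
    rw [h2, hc]; ring

/-- Two tiles on the other side of a facet of a third one coincide: both have the deviation of the
third tile minus multiples of the facet function, and the steeper multiple is negative on the
vertices of the other tile. -/
theorem hull_eq_of_common_facet {t₁ t₂ : Tile} {w : Fin t.k → Fin t.n}
    (hw : t.B.IsTransversal w) (h₁ : t₁.B.hull ≠ t.B.hull) (h₂ : t₂.B.hull ≠ t.B.hull)
    (hr₁ : ∀ i ∈ t.B.rest w, t.B.v i ∈ Set.range t₁.B.v)
    (hr₂ : ∀ i ∈ t.B.rest w, t.B.v i ∈ Set.range t₂.B.v) : t₁.B.hull = t₂.B.hull := by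
  obtain ⟨δ₁, hδ₁, e₁⟩ := exists_slope hw h₁ hr₁
  obtain ⟨δ₂, hδ₂, e₂⟩ := exists_slope hw h₂ hr₂
  have key : ∀ (s₁ s₂ : Tile) (a b : ℝ), b < 0 → s₂.B.hull ≠ t.B.hull →
      (∀ x, dev 1 1 s₁.o s₁.r x = dev 1 1 t.o t.r x - a * t.B.facetFun w x) →
      (∀ x, dev 1 1 s₂.o s₂.r x = dev 1 1 t.o t.r x - b * t.B.facetFun w x) → ¬ a < b := by
    intro s₁ s₂ a b hb hs e₁ e₂ hab
    refine hs (hull_eq_of_mem_interior s₂.B.c_mem_interior ?_)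
    refine convexHull_mono ?_ (interior_subset s₂.B.c_mem_interior)
    rintro _ ⟨i, rfl⟩
    have h1 := e₁ (s₂.B.v i)
    have h2 := e₂ (s₂.B.v i)
    have h3 := s₁.empty _ (s₂.v_mem i)
    have h4 := t.empty _ (s₂.v_mem i)
    rw [s₂.on] at h2
    have h5 : t.B.facetFun w (s₂.B.v i) ≤ 0 := by nlinarith
    have h6 : 0 ≤ t.B.facetFun w (s₂.B.v i) := by nlinarith
    have h7 : t.B.facetFun w (s₂.B.v i) = 0 := le_antisymm h5 h6
    refine t.contact _ (s₂.v_mem i) ?_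
    rw [h7] at h2
    linarith
  have hδ : δ₁ = δ₂ :=
    le_antisymm (not_lt.1 (key t₂ t₁ δ₂ δ₁ hδ₁ h₁ e₂ e₁)) (not_lt.1 (key t₁ t₂ δ₁ δ₂ hδ₂ h₂ e₁ e₂))
  exact hull_eq_of_dev_eq fun x => by rw [e₁, e₂, hδ]

/-- A tile whose deviation at `x` is bounded has its vertices in a ball around `x`. -/
theorem finite_hulls (x : R6) (M : ℝ) :
    {P | ∃ t : Tile, t.B.hull = P ∧ dev 1 1 t.o t.r x ≤ M}.Finite := by
  refine ((finite_lattice_ball x (2 * (4 + (M + 4)))).finite_subsets.image (convexHull ℝ)).subset ?_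
  rintro _ ⟨t, rfl, ht⟩
  refine ⟨Set.range t.B.v, ?_, rfl⟩
  rintro _ ⟨i, rfl⟩
  refine ⟨t.v_mem i, (qf_triangle 1 1 _ t.o _).trans ?_⟩
  have h1 := t.on i
  have h2 := t.r_le
  rw [dev] at h1 ht
  rw [qf_sub_comm 1 1 t.o x]
  linarith

/-- Every facet of a tile of the family is shared with another tile of the family. -/
def FacetClosed (𝒟 : Set Tile) : Prop :=
  ∀ t ∈ 𝒟, ∀ w, t.B.IsTransversal w → ∃ t' ∈ 𝒟, t'.B.hull ≠ t.B.hull ∧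
    ∀ i ∈ t.B.rest w, t.B.v i ∈ Set.range t'.B.v

/-- A tile with the least deviation at `x` contains `x`: otherwise `x` lies beyond one of its
facets, and the deviation of the neighbour is smaller. -/
theorem cover {𝒟 : Set Tile} (h : FacetClosed 𝒟) (hne : 𝒟.Nonempty) (x : R6) :
    ∃ t ∈ 𝒟, x ∈ t.B.hull := by
  obtain ⟨t₀, ht₀⟩ := hne
  set 𝒞 := {P | ∃ t ∈ 𝒟, t.B.hull = P ∧ dev 1 1 t.o t.r x ≤ dev 1 1 t₀.o t₀.r x} with h𝒞
  have hfin : 𝒞.Finite :=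
    (finite_hulls x _).subset fun P ⟨t, _, h1, h2⟩ => ⟨t, h1, h2⟩
  have hex : ∀ P, ∃ t : Tile, P ∈ 𝒞 → t ∈ 𝒟 ∧ t.B.hull = P ∧
      dev 1 1 t.o t.r x ≤ dev 1 1 t₀.o t₀.r x := by
    intro P
    by_cases hP : P ∈ 𝒞
    · obtain ⟨t, h1⟩ := hP
      exact ⟨t, fun _ => h1⟩
    · exact ⟨t₀, fun h => absurd h hP⟩
  choose T hT using hex
  obtain ⟨P, hP, hmin⟩ := Set.exists_min_image 𝒞 (fun P => dev 1 1 (T P).o (T P).r x) hfin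
    ⟨_, t₀, ht₀, rfl, le_rfl⟩
  obtain ⟨htD, htP, htle⟩ := hT P hP
  refine ⟨T P, htD, (T P).B.mem_hull_of_facetFun fun w hw => ?_⟩
  by_contra hneg
  obtain ⟨t', ht'D, ht'ne, hr⟩ := h _ htD w hw
  obtain ⟨δ, hδ, e⟩ := exists_slope hw ht'ne hr
  have hlt : dev 1 1 t'.o t'.r x < dev 1 1 (T P).o (T P).r x := by
    rw [e]; nlinarith
  have ht'P : t'.B.hull ∈ 𝒞 := ⟨t', ht'D, rfl, hlt.le.trans htle⟩
  have h1 := hmin _ ht'P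
  have h2 := dev_eq_of_hull_eq (hT _ ht'P).2.1 x
  rw [h2] at h1
  linarith

theorem isZTiling {𝒟 : Set Tile} (h : FacetClosed 𝒟) (hne : 𝒟.Nonempty) :
    IsZTiling ((fun t => t.B.hull) '' 𝒟) where
  polytope := by
    rintro _ ⟨t, -, rfl⟩
    refine isZPolytope_convexHull (Set.finite_range _) ?_
    rintro _ ⟨i, rfl⟩
    exact t.v_mem i
  fullDim := by
    rintro _ ⟨t, -, rfl⟩
    exact ⟨_, t.B.c_mem_interior⟩
  cover := by
    refine Set.eq_univ_of_forall fun x => ?_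
    obtain ⟨t, ht, hx⟩ := cover h hne x
    exact ⟨_, ⟨t, ht, rfl⟩, hx⟩
  disjoint := by
    rintro _ ⟨t, -, rfl⟩ _ ⟨t', -, rfl⟩ hne
    rw [Set.disjoint_left]
    exact fun y hy hy' => hne (hull_eq_of_mem_interior hy (interior_subset hy'))
  faceToFace := by
    rintro _ ⟨t, -, rfl⟩ _ ⟨t', -, rfl⟩
    refine ⟨isFace_inter t t', ?_⟩
    have := isFace_inter t' t
    rwa [Set.inter_comm] at this
  locallyFinite := by
    intro x
    refine ⟨{y | qf 1 1 (x - y) < 1}, ?_, ?_⟩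
    · refine IsOpen.mem_nhds (isOpen_lt ?_ continuous_const) ?_
      · exact (continuous_qf 1 1).comp (continuous_const.sub continuous_id)
      · simp [qf, bf, form1, form2]
    · refine (finite_hulls x 20).subset ?_
      rintro _ ⟨⟨t, -, rfl⟩, y, hy, hyx⟩
      refine ⟨t, rfl, ?_⟩
      have h1 : dev 1 1 t.o t.r y ≤ 0 := by
        refine convexHull_min ?_ (convex_dev_nonpos 1 1 t.o t.r) hy
        rintro _ ⟨i, rfl⟩
        exact (t.on i).le
      have h2 := qf_triangle 1 1 x y t.o
      have h3 : 0 ≤ t.r := by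
        have := t.on ⟨0, by have := t.card; omega⟩
        rw [dev] at this
        have := qf_nonneg 1 1 (t.B.v ⟨0, by have := t.card; omega⟩ - t.o)
        linarith
      have h4 := t.r_le
      simp only [Set.mem_ofPred_eq] at hyx
      rw [dev] at h1 ⊢
      linarith

theorem isFacetToFacet {𝒟 : Set Tile} (h : FacetClosed 𝒟) :
    IsFacetToFacet ((fun t => t.B.hull) '' 𝒟) := by
  rintro _ ⟨t, ht, rfl⟩ F hF
  simp only at hF
  obtain ⟨w, hw, hFw⟩ := exists_rest_of_isFacet hF
  obtain ⟨t', ht', hne', hr⟩ := h t ht w hw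
  refine ⟨t'.B.hull, ⟨⟨t', ht', rfl⟩, hne', ?_, hF.2⟩, ?_⟩
  · have hVV : Set.range t.B.v ∩ Set.range t'.B.v = t.B.v '' t.B.rest w := by
      apply Set.Subset.antisymm
      · rintro _ ⟨⟨i, rfl⟩, hi⟩
        refine ⟨i, fun hiw => ?_, rfl⟩
        obtain ⟨j, hj, hjn⟩ := exists_not_mem_of_ne hne'.symm
          (subset_convexHull ℝ (Set.range t'.B.v)) (t.B.blk i)
        by_cases hjw : j = w (t.B.blk j)
        · rw [hj, ← hiw] at hjw
          exact hjn (hjw ▸ hi)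
        · exact hjn (hr j hjw)
      · rintro _ ⟨i, hi, rfl⟩
        exact ⟨⟨i, rfl⟩, hr i hi⟩
    obtain ⟨A, -, -, -, -, h5⟩ := exists_separation t t'
    rw [hFw, ← hVV, ← h5, Set.inter_comm]
    exact isFace_inter t' t
  · rintro _ ⟨⟨t'', -, rfl⟩, hne'', hF''⟩
    refine hull_eq_of_common_facet hw hne'' hne' (fun i hi => ?_) hr
    rw [← hull_inter_Z6]
    refine ⟨hF''.1.subset ?_, t.v_mem i⟩
    rw [hFw]
    exact subset_convexHull ℝ _ ⟨i, hi, rfl⟩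

end Tile

/-! ### Symmetries -/

/-- The affine symmetries of the lattice `ℤ⁶` preserving both forms: the compositions of elements of
`𝒢_{D₄}` with lattice translations. -/
def symGroup : Subgroup (R6 ≃ᵃ[ℝ] R6) where
  carrier := {τ | (∀ x, τ x ∈ Z6 ↔ x ∈ Z6) ∧ ∀ α β x y, qf α β (τ x - τ y) = qf α β (x - y)}
  mul_mem' := by
    rintro σ τ ⟨h1, h2⟩ ⟨h3, h4⟩
    exact ⟨fun x => (h1 _).trans (h3 x), fun α β x y => (h2 α β _ _).trans (h4 α β x y)⟩
  one_mem' := ⟨fun _ => Iff.rfl, fun _ _ _ _ => rfl⟩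
  inv_mem' := by
    rintro τ ⟨h1, h2⟩
    have e : ∀ x, τ (τ⁻¹ x) = x := fun x => τ.apply_symm_apply x
    refine ⟨fun x => ?_, fun α β x y => ?_⟩
    · rw [← h1, e]
    · rw [← h2, e, e]

theorem mem_symGroup {τ : R6 ≃ᵃ[ℝ] R6} : τ ∈ symGroup ↔
    (∀ x, τ x ∈ Z6 ↔ x ∈ Z6) ∧ ∀ α β x y, qf α β (τ x - τ y) = qf α β (x - y) := Iff.rfl

theorem dev_map {τ : R6 ≃ᵃ[ℝ] R6} (hτ : τ ∈ symGroup) (α β : ℕ) (c x : R6) (r : ℝ) :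
    dev α β (τ c) r (τ x) = dev α β c r x := by
  rw [dev, dev, hτ.2]

theorem dev_map' {τ : R6 ≃ᵃ[ℝ] R6} (hτ : τ ∈ symGroup) (α β : ℕ) (c x : R6) (r : ℝ) :
    dev α β (τ c) r x = dev α β c r (τ⁻¹ x) := by
  have e : τ (τ⁻¹ x) = x := τ.apply_symm_apply x
  rw [← dev_map hτ α β c (τ⁻¹ x), e]

/-- The image of a frame under an affine equivalence. -/
def BlockFrame.map {n k : ℕ} (B : BlockFrame n k) (τ : R6 ≃ᵃ[ℝ] R6) : BlockFrame n k where
  blk := B.blk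
  v i := τ (B.v i)
  c := τ B.c
  a i := (B.a i).comp (τ.symm : R6 →ᵃ[ℝ] R6)
  s := B.s
  s_eq := B.s_eq
  s_pos := B.s_pos
  k_pos := B.k_pos
  coord i j := by simpa using B.coord i j
  recon x := by
    have hd : ∀ x, τ x = τ.linear x + τ 0 := fun x => by
      have := (τ : R6 →ᵃ[ℝ] R6).map_vadd 0 x
      simpa using this
    have h1 : ∑ i, B.a i (τ.symm x) • τ 0 = 0 := by
      rw [← Finset.sum_smul, B.sum_a, zero_smul]
    have h2 := congrArg τ (B.recon (τ.symm x))
    rw [τ.apply_symm_apply, hd, map_add, map_sum] at h2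
    rw [hd B.c]
    simp only [AffineMap.coe_comp, AffineEquiv.coe_coe, Function.comp_apply]
    have h3 : ∀ i, B.a i (τ.symm x) • τ (B.v i) =
        B.a i (τ.symm x) • τ.linear (B.v i) + B.a i (τ.symm x) • τ 0 := fun i => by
      rw [hd (B.v i), smul_add]
    rw [Finset.sum_congr rfl fun i _ => h3 i, Finset.sum_add_distrib, h1, add_zero]
    simp only [map_smul] at h2
    conv_lhs => rw [h2]
    abel
  zero_sum K x := by simpa using B.zero_sum K (τ.symm x)
  cent K := by
    have hd : ∀ x, τ x = τ.linear x + τ 0 := fun x => by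
      have := (τ : R6 →ᵃ[ℝ] R6).map_vadd 0 x
      simpa using this
    have h := congrArg τ.linear (B.cent K)
    rw [map_sum, map_smul] at h
    rw [hd B.c, smul_add, ← h, Finset.sum_congr rfl fun i _ => hd (B.v i), Finset.sum_add_distrib,
      Finset.sum_const, ← Nat.cast_smul_eq_nsmul ℝ, B.s_eq]

theorem image_convexHull (τ : R6 ≃ᵃ[ℝ] R6) (S : Set R6) :
    τ '' convexHull ℝ S = convexHull ℝ (τ '' S) :=
  (τ : R6 →ᵃ[ℝ] R6).image_convexHull S

theorem BlockFrame.map_hull {n k : ℕ} (B : BlockFrame n k) (τ : R6 ≃ᵃ[ℝ] R6) :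
    (B.map τ).hull = τ '' B.hull := by
  rw [hull, hull, image_convexHull, ← Set.range_comp]
  rfl

/-- The image of a tile under a symmetry. -/
def Tile.map (t : Tile) (τ : R6 ≃ᵃ[ℝ] R6) (hτ : τ ∈ symGroup) : Tile where
  n := t.n
  k := t.k
  B := t.B.map τ
  card := t.card
  o := τ t.o
  r := t.r
  r_le := t.r_le
  v_mem i := (hτ.1 _).2 (t.v_mem i)
  on i := (dev_map hτ 1 1 _ _ _).trans (t.on i)
  empty z hz := by
    rw [dev_map' hτ]
    exact t.empty _ (((inv_mem hτ).1 z).2 hz)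
  contact z hz h := by
    rw [dev_map' hτ] at h
    obtain ⟨i, hi⟩ := t.contact _ (((inv_mem hτ).1 z).2 hz) h
    refine ⟨i, ?_⟩
    change τ (t.B.v i) = z
    rw [hi]
    exact τ.apply_symm_apply z

/-- The orbit of a set under the symmetries. -/
def symOrbit (P : Set R6) : Set (Set R6) := {X | ∃ τ ∈ symGroup, X = τ '' P}

theorem image_mul (σ τ : R6 ≃ᵃ[ℝ] R6) (P : Set R6) : (σ * τ) '' P = σ '' (τ '' P) := by
  rw [Set.image_image]; rfl

theorem quadForm_formE6 (m : ℝ) (x : R6) : quadForm (formE6 m) x = m / 2 * qf 1 0 x := by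
  simp only [quadForm, formE6, qf, bf, form1, form2, Matrix.smul_mulVec, dotProduct_smul,
    smul_eq_mul]
  simp [Matrix.mulVec, dotProduct, Fin.sum_univ_six]
  ring_nf
  simp

theorem quadForm_formE6Star (m : ℝ) (x : R6) : quadForm (formE6Star m) x = m / 4 * qf 0 1 x := by
  simp only [quadForm, formE6Star, qf, bf, form1, form2, Matrix.smul_mulVec, dotProduct_smul,
    smul_eq_mul]
  simp [Matrix.mulVec, dotProduct, Fin.sum_univ_six]
  ring_nf
  simp

/-! ### The group `𝒢_{D₄}` and the symmetries -/

theorem act_add (g : GL (Fin 6) ℤ) (x y : R6) : act g (x + y) = act g x + act g y :=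
  Matrix.mulVec_add _ _ _

theorem act_mul (g h : GL (Fin 6) ℤ) (x : R6) : act (g * h) x = act g (act h x) := by
  have : ((g * h : GL (Fin 6) ℤ) : Matrix (Fin 6) (Fin 6) ℤ).map (fun a : ℤ => (a : ℝ)) =
      (g : Matrix (Fin 6) (Fin 6) ℤ).map (fun a : ℤ => (a : ℝ)) *
        (h : Matrix (Fin 6) (Fin 6) ℤ).map (fun a : ℤ => (a : ℝ)) := by
    have := Matrix.map_mul (L := (g : Matrix (Fin 6) (Fin 6) ℤ))
      (M := (h : Matrix (Fin 6) (Fin 6) ℤ)) (f := Int.castRingHom ℝ)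
    exact this
  rw [act, act, act, this, Matrix.mulVec_mulVec]

theorem act_one (x : R6) : act 1 x = x := by
  have : ((1 : GL (Fin 6) ℤ) : Matrix (Fin 6) (Fin 6) ℤ).map (fun a : ℤ => (a : ℝ)) = 1 :=
    Matrix.map_one _ Int.cast_zero Int.cast_one
  rw [act, this, Matrix.one_mulVec]

/-- The action of an integer matrix as an affine equivalence. -/
noncomputable def actEquiv (g : GL (Fin 6) ℤ) : R6 ≃ᵃ[ℝ] R6 :=
  LinearEquiv.toAffineEquiv
    { toFun := act g
      map_add' := act_add g
      map_smul' := fun k x => Matrix.mulVec_smul _ k x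
      invFun := act g⁻¹
      left_inv := fun x => by rw [← act_mul, inv_mul_cancel, act_one]
      right_inv := fun x => by rw [← act_mul, mul_inv_cancel, act_one] }

@[simp] theorem actEquiv_apply (g : GL (Fin 6) ℤ) (x : R6) : actEquiv g x = act g x := rfl

theorem act_mem_Z6 (g : GL (Fin 6) ℤ) {x : R6} (hx : x ∈ Z6) : act g x ∈ Z6 := by
  obtain ⟨z, rfl⟩ := hx
  refine ⟨(g : Matrix (Fin 6) (Fin 6) ℤ) *ᵥ z, ?_⟩
  ext i
  simp [act, Matrix.mulVec, dotProduct]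

theorem act_sub (g : GL (Fin 6) ℤ) (x y : R6) : act g x - act g y = act g (x - y) :=
  (Matrix.mulVec_sub _ _ _).symm

theorem mem_groupD4_iff {m : ℝ} (hm : 0 < m) (g : GL (Fin 6) ℤ) :
    g ∈ groupD4 m ↔ ∀ α β x, qf α β (act g x) = qf α β x := by
  have h2 : m / 2 ≠ 0 := by positivity
  have h4 : m / 4 ≠ 0 := by positivity
  simp only [groupD4, Set.mem_inter_iff, Set.mem_ofPred_eq, quadForm_formE6, quadForm_formE6Star,
    mul_right_inj' h2, mul_right_inj' h4]
  constructor
  · rintro ⟨h1, h2⟩ α β x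
    rw [qf_eq, h1, h2, ← qf_eq]
  · exact fun h => ⟨h 1 0, h 0 1⟩

theorem actEquiv_mem {g : GL (Fin 6) ℤ} (h : ∀ α β x, qf α β (act g x) = qf α β x) :
    actEquiv g ∈ symGroup := by
  refine mem_symGroup.2 ⟨fun x => ⟨fun hx => ?_, act_mem_Z6 g⟩, fun α β x y => ?_⟩
  · have := act_mem_Z6 g⁻¹ hx
    rwa [actEquiv_apply, ← act_mul, inv_mul_cancel, act_one] at this
  · rw [actEquiv_apply, actEquiv_apply, act_sub, h]

theorem add_mem_Z6 {x y : R6} (hx : x ∈ Z6) (hy : y ∈ Z6) : x + y ∈ Z6 := by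
  obtain ⟨u, rfl⟩ := mem_Z6_iff.1 hx
  obtain ⟨w, rfl⟩ := mem_Z6_iff.1 hy
  rw [← V6.toR_add]
  exact V6.mem_Z6 _

theorem neg_mem_Z6 {x : R6} (hx : x ∈ Z6) : -x ∈ Z6 := by
  obtain ⟨u, rfl⟩ := mem_Z6_iff.1 hx
  rw [← V6.toR_neg]
  exact V6.mem_Z6 _

theorem zero_mem_Z6 : (0 : R6) ∈ Z6 := by
  rw [← V6.toR_zero]
  exact V6.mem_Z6 _

theorem translation_mem {z : R6} (hz : z ∈ Z6) : AffineEquiv.constVAdd ℝ R6 z ∈ symGroup := by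
  refine mem_symGroup.2 ⟨fun x => ⟨fun h => ?_, fun h => add_mem_Z6 hz h⟩, fun α β x y => ?_⟩
  · have := add_mem_Z6 (neg_mem_Z6 hz) h
    simpa using this
  · simp

theorem neg_mem_symGroup : (LinearEquiv.neg ℝ : R6 ≃ₗ[ℝ] R6).toAffineEquiv ∈ symGroup := by
  refine mem_symGroup.2 ⟨fun x => ⟨fun h => ?_, fun h => neg_mem_Z6 h⟩, fun α β x y => ?_⟩
  · have := neg_mem_Z6 h
    simpa using this
  · rw [← qf_neg]
    simp [add_comm, sub_eq_add_neg]

/-- The linear part of a symmetry is an integer matrix. -/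
theorem exists_matrix {τ : R6 ≃ᵃ[ℝ] R6} (hτ : τ ∈ symGroup) :
    ∃ M : Matrix (Fin 6) (Fin 6) ℤ, ∀ x, τ.linear x = M.map (fun a : ℤ => (a : ℝ)) *ᵥ x := by
  have h : ∀ j : Fin 6, ∃ z : Fin 6 → ℤ, (fun i => (z i : ℝ)) = τ.linear (Pi.single j 1) := by
    intro j
    have h1 : (Pi.single j 1 : R6) ∈ Z6 := by
      refine ⟨Pi.single j 1, ?_⟩
      ext i
      by_cases hij : i = j
      · subst hij; simp
      · simp [hij]
    have h2 : τ.linear (Pi.single j 1) = τ (Pi.single j 1) + -τ 0 := by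
      have := (τ : R6 →ᵃ[ℝ] R6).linearMap_vsub (Pi.single j 1) 0
      simpa [sub_eq_add_neg] using this
    have h3 : τ.linear (Pi.single j 1) ∈ Z6 := by
      rw [h2]
      exact add_mem_Z6 ((hτ.1 _).2 h1) (neg_mem_Z6 ((hτ.1 _).2 zero_mem_Z6))
    exact h3
  choose M hM using h
  refine ⟨Matrix.of fun i j => M j i, fun x => ?_⟩
  conv_lhs => rw [pi_eq_sum_univ' x]
  rw [map_sum]
  simp only [map_smul]
  ext i
  simp only [Finset.sum_apply, Pi.smul_apply, smul_eq_mul, Matrix.mulVec, dotProduct,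
    Matrix.map_apply, Matrix.of_apply]
  refine Finset.sum_congr rfl fun j _ => ?_
  have := congrFun (hM j) i
  rw [this, mul_comm]

theorem exists_act {τ : R6 ≃ᵃ[ℝ] R6} (hτ : τ ∈ symGroup) :
    ∃ g : GL (Fin 6) ℤ, ∀ x, act g x = τ.linear x := by
  obtain ⟨M, hM⟩ := exists_matrix hτ
  obtain ⟨M', hM'⟩ := exists_matrix (inv_mem hτ)
  have key : ∀ {A B : Matrix (Fin 6) (Fin 6) ℤ}, (∀ x : R6, A.map (fun a : ℤ => (a : ℝ)) *ᵥ
      (B.map (fun a : ℤ => (a : ℝ)) *ᵥ x) = x) → A * B = 1 := by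
    intro A B h
    have h1 : (A * B).map (fun a : ℤ => (a : ℝ)) = 1 := by
      have h2 : (A * B).map (fun a : ℤ => (a : ℝ)) =
          A.map (fun a : ℤ => (a : ℝ)) * B.map (fun a : ℤ => (a : ℝ)) :=
        Matrix.map_mul (L := A) (M := B) (f := Int.castRingHom ℝ)
      rw [h2]
      refine Matrix.ext_of_mulVec_single fun j => ?_
      rw [← Matrix.mulVec_mulVec, h, Matrix.one_mulVec]
    have h3 : (1 : Matrix (Fin 6) (Fin 6) ℤ).map (fun a : ℤ => (a : ℝ)) = 1 :=
      Matrix.map_one _ Int.cast_zero Int.cast_one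
    ext i j
    have := congrFun (congrFun (h1.trans h3.symm) i) j
    exact Int.cast_injective (α := ℝ) this
  have e1 : ∀ x, τ.linear ((τ⁻¹ : R6 ≃ᵃ[ℝ] R6).linear x) = x := fun x =>
    τ.linear.apply_symm_apply x
  have e2 : ∀ x, (τ⁻¹ : R6 ≃ᵃ[ℝ] R6).linear (τ.linear x) = x := fun x =>
    τ.linear.symm_apply_apply x
  exact ⟨⟨M, M', key fun x => by rw [← hM', ← hM, e1], key fun x => by rw [← hM, ← hM', e2]⟩,
    fun x => (hM x).symm⟩

/-- A symmetry is a translation by a lattice vector followed by an element of `𝒢_{D₄}`. -/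
theorem equivalentTopes_eq {m : ℝ} (hm : 0 < m) (P : Set R6) :
    equivalentTopes m P = symOrbit P := by
  apply Set.Subset.antisymm
  · rintro X ⟨g, hg, P', ⟨z, hz, hP'⟩, rfl⟩
    have hg' := actEquiv_mem ((mem_groupD4_iff hm g).1 hg)
    rcases hP' with rfl | rfl
    · refine ⟨_, mul_mem hg' (translation_mem hz), ?_⟩
      rw [image_mul]; rfl
    · refine ⟨_, mul_mem hg' (mul_mem (translation_mem hz) neg_mem_symGroup), ?_⟩
      rw [image_mul]
      congr 1
  · rintro X ⟨τ, hτ, rfl⟩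
    obtain ⟨g, hg⟩ := exists_act hτ
    have hd : ∀ x y, τ x - τ y = act g (x - y) := fun x y => by
      have := (τ : R6 →ᵃ[ℝ] R6).linearMap_vsub x y
      rw [hg]
      simpa using this.symm
    refine ⟨g, (mem_groupD4_iff hm g).2 fun α β x => ?_, _,
      ⟨-(τ⁻¹ : R6 ≃ᵃ[ℝ] R6) 0, neg_mem_Z6 (((inv_mem hτ).1 _).2 zero_mem_Z6), Or.inl rfl⟩, ?_⟩
    · have h := hτ.2 α β x 0
      rwa [hd, sub_zero] at h
    · rw [Set.image_image]
      refine Set.image_congr fun x _ => ?_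
      have h1 := hd x ((τ⁻¹ : R6 ≃ᵃ[ℝ] R6) 0)
      have h2 : τ ((τ⁻¹ : R6 ≃ᵃ[ℝ] R6) 0) = 0 := τ.apply_symm_apply 0
      rw [h2, sub_zero] at h1
      rw [h1, sub_eq_neg_add]

theorem symOrbit_image {P : Set R6} {τ : R6 ≃ᵃ[ℝ] R6} (hτ : τ ∈ symGroup) {X : Set R6}
    (hX : X ∈ symOrbit P) : τ '' X ∈ symOrbit P := by
  obtain ⟨σ, hσ, rfl⟩ := hX
  exact ⟨τ * σ, mul_mem hτ hσ, (image_mul _ _ _).symm⟩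

/-! ### Commensurability -/

/-- `S` lies on an empty ellipsoid of the form `qf α β`. -/
def IsFlat (α β : ℕ) (S : Set R6) : Prop :=
  ∃ c r, (∀ z ∈ Z6, 0 ≤ dev α β c r z) ∧ ∀ v ∈ S, dev α β c r v = 0

/-- `P` is covered by the convex hulls of sets of its lattice points which lie on empty
ellipsoids. -/
def FlatCovered (α β : ℕ) (P : Set R6) : Prop :=
  ∀ x ∈ P, ∃ S ⊆ P ∩ Z6, IsFlat α β S ∧ x ∈ convexHull ℝ S

theorem IsFlat.map {α β : ℕ} {S : Set R6} (h : IsFlat α β S) {τ : R6 ≃ᵃ[ℝ] R6}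
    (hτ : τ ∈ symGroup) : IsFlat α β (τ '' S) := by
  obtain ⟨c, r, h1, h2⟩ := h
  refine ⟨τ c, r, fun z hz => ?_, ?_⟩
  · rw [dev_map' hτ]
    exact h1 _ (((inv_mem hτ).1 z).2 hz)
  · rintro _ ⟨v, hv, rfl⟩
    rw [dev_map hτ]
    exact h2 v hv

theorem FlatCovered.map {α β : ℕ} {P : Set R6} (h : FlatCovered α β P) {τ : R6 ≃ᵃ[ℝ] R6}
    (hτ : τ ∈ symGroup) : FlatCovered α β (τ '' P) := by
  rintro _ ⟨x, hx, rfl⟩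
  obtain ⟨S, hS, hf, hxS⟩ := h x hx
  refine ⟨τ '' S, ?_, hf.map hτ, ?_⟩
  · rintro _ ⟨v, hv, rfl⟩
    exact ⟨⟨v, (hS hv).1, rfl⟩, (hτ.1 v).2 (hS hv).2⟩
  · rw [← image_convexHull]
    exact ⟨x, hxS, rfl⟩

/-- The tiles of a Delaunay tiling in terms of deviations. -/
theorem mem_delaunayTiling {F : Matrix (Fin 6) (Fin 6) ℝ} {κ : ℝ} (hκ : 0 < κ) {α β : ℕ}
    (hF : ∀ x, quadForm F x = κ * qf α β x) {P : Set R6} :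
    P ∈ delaunayTiling F ↔ (interior P).Nonempty ∧ ∃ c r, (∀ z ∈ Z6, 0 ≤ dev α β c r z) ∧
      P = convexHull ℝ {z | z ∈ Z6 ∧ dev α β c r z = 0} := by
  refine and_congr_right fun _ => ⟨?_, ?_⟩
  · rintro ⟨c, r, h1, rfl⟩
    refine ⟨c, r / κ, fun z hz => ?_, ?_⟩
    · have := h1 z hz
      rw [hF] at this
      rw [dev, sub_nonneg, div_le_iff₀ hκ]
      linarith
    · congr 1
      ext z
      refine and_congr_right fun _ => ?_
      rw [dev, sub_eq_zero, eq_div_iff hκ.ne', hF, mul_comm]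
  · rintro ⟨c, r, h1, rfl⟩
    refine ⟨c, κ * r, fun z hz => ?_, ?_⟩
    · have := h1 z hz
      rw [dev, sub_nonneg] at this
      rw [hF]
      gcongr
    · congr 1
      ext z
      refine and_congr_right fun _ => ?_
      rw [dev, sub_eq_zero, hF, mul_right_inj' hκ.ne']

/-- A point of a face which is in the convex hull of some points of the polytope is in the convex
hull of those among them which lie on the face. -/
theorem face_mem_convexHull {P F V : Set R6} (hF : IsFace P F) (hV : V ⊆ P) {x : R6} (hx : x ∈ F)
    (hxV : x ∈ convexHull ℝ V) : x ∈ convexHull ℝ (V ∩ F) := by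
  obtain ⟨A, hA, rfl⟩ := IsFace.exists_affine hF ⟨x, hx⟩
  refine convexHull_mono ?_ (mem_convexHull_zero (fun v hv => hA v (hV hv)) hxV hx.2)
  rintro v ⟨hv, hv0⟩
  exact ⟨hv, hV hv, hv0⟩

theorem IsFace.convex {P F : Set R6} (hF : IsFace P F) (hP : Convex ℝ P) : Convex ℝ F :=
  IsExposed.convex hF hP

/-- The difference of the deviations from a Delaunay ellipsoid and the ellipsoid of a flat set is
affine, and on a common point of the convex hulls it can only vanish; so the common point is in the
convex hull of common lattice points. -/
theorem commensurate_of_flatCovered {D : Set (Set R6)} {F : Matrix (Fin 6) (Fin 6) ℝ} {κ : ℝ}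
    (hκ : 0 < κ) {α β : ℕ} (hF : ∀ x, quadForm F x = κ * qf α β x)
    (hD : ∀ P ∈ D, Convex ℝ P ∧ (P ∩ Z6).Finite ∧ FlatCovered α β P) :
    Commensurate D (delaunayTiling F) := by
  rintro _ ⟨F₁, ⟨-, P₁, hP₁, hF₁⟩, F₂, ⟨-, P₂, hP₂, hF₂⟩, -, rfl⟩
  obtain ⟨hconv, hfin, hcov⟩ := hD P₁ hP₁
  obtain ⟨-, c, r, hemp, hP₂⟩ := (mem_delaunayTiling hκ hF).1 hP₂
  have key : ∀ x ∈ P₁, x ∈ P₂ → x ∈ convexHull ℝ (P₁ ∩ P₂ ∩ Z6) := by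
    intro x hx₁ hx₂
    obtain ⟨S, hS, ⟨c', r', hemp', hon⟩, hxS⟩ := hcov x hx₁
    obtain ⟨A, hA⟩ := exists_affine_dev_sub α β c c' r r'
    have h1 : ∀ v ∈ S, 0 ≤ A v := by
      intro v hv
      rw [hA, hon v hv, sub_zero]
      exact hemp v (hS hv).2
    have h2 : 0 ≤ (-A) x := by
      rw [hP₂] at hx₂
      refine affine_nonneg_of_mem_convexHull ?_ hx₂
      rintro v ⟨hv, hv0⟩
      simp only [AffineMap.coe_neg, Pi.neg_apply]
      rw [hA, hv0, zero_sub, neg_neg]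
      exact hemp' v hv
    have h3 : A x = 0 := by
      refine le_antisymm ?_ (affine_nonneg_of_mem_convexHull h1 hxS)
      simpa using h2
    refine convexHull_mono ?_ (mem_convexHull_zero h1 hxS h3)
    rintro v ⟨hv, hv0⟩
    refine ⟨⟨(hS hv).1, ?_⟩, (hS hv).2⟩
    rw [hP₂]
    refine subset_convexHull ℝ _ ⟨(hS hv).2, ?_⟩
    rwa [hA, hon v hv, sub_zero] at hv0
  have hP₂c : Convex ℝ P₂ := hP₂ ▸ convex_convexHull ℝ _
  have hsub : F₁ ∩ F₂ = convexHull ℝ (P₁ ∩ P₂ ∩ Z6 ∩ F₁ ∩ F₂) := by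
    apply Set.Subset.antisymm
    · rintro x ⟨hx₁, hx₂⟩
      have h1 := face_mem_convexHull hF₁ (fun v hv => hv.1.1) hx₁
        (key x (hF₁.subset hx₁) (hF₂.subset hx₂))
      exact face_mem_convexHull hF₂ (fun v hv => hv.1.1.2) hx₂ h1
    · refine convexHull_min (fun v hv => ⟨hv.1.2, hv.2⟩) ?_
      exact (hF₁.convex hconv).inter (hF₂.convex hP₂c)
  rw [hsub]
  refine isZPolytope_convexHull (hfin.subset ?_) ?_
  · exact fun v hv => ⟨hv.1.1.1.1, hv.1.1.2⟩
  · exact fun v hv => hv.1.1.2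

/-! ### Generators of the symmetry group -/

/-- Five involutions in `𝒢_{D₄}`, which generate the group (see `exists_word`); the remaining values
of the index give the identity. -/
def gen (i : ℕ) (u : V6) : V6 :=
  match i with
  | 0 =>
    ⟨u.x0, u.x1, u.x2, u.x3, u.x5, u.x4⟩
  | 1 =>
    ⟨-u.x0 + 2 * u.x4 + 2 * u.x5, -u.x0 + u.x1 + u.x4 + u.x5, -u.x0 + u.x2 + u.x4 + u.x5,
      -u.x0 + u.x3 + u.x4 + u.x5, u.x4, u.x5⟩
  | 2 =>
    ⟨u.x0, u.x1, u.x2, u.x4, u.x3, u.x5⟩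
  | 3 =>
    ⟨-u.x2 - u.x3 - u.x4 + u.x5, -2 * u.x0 + u.x1 + u.x2 + u.x3 + u.x4 + 2 * u.x5, -u.x4, -u.x3,
      -u.x2, u.x0 - u.x2 - u.x3 - u.x4⟩
  | 4 =>
    ⟨-u.x0 + 2 * u.x1 + 2 * u.x5, u.x5, -u.x0 + u.x1 + u.x2 + u.x5, -u.x0 + u.x1 + u.x3 + u.x5,
      -u.x0 + u.x1 + u.x4 + u.x5, u.x1⟩
  | _ => u

/-- The generators on `ℝ⁶`. -/
noncomputable def genR (i : ℕ) (x : R6) : R6 :=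
  match i with
  | 0 =>
    ![x 0, x 1, x 2, x 3, x 5, x 4]
  | 1 =>
    ![-x 0 + 2 * x 4 + 2 * x 5, -x 0 + x 1 + x 4 + x 5, -x 0 + x 2 + x 4 + x 5,
      -x 0 + x 3 + x 4 + x 5, x 4, x 5]
  | 2 =>
    ![x 0, x 1, x 2, x 4, x 3, x 5]
  | 3 =>
    ![-x 2 - x 3 - x 4 + x 5, -2 * x 0 + x 1 + x 2 + x 3 + x 4 + 2 * x 5, -x 4, -x 3, -x 2,
      x 0 - x 2 - x 3 - x 4]
  | 4 =>
    ![-x 0 + 2 * x 1 + 2 * x 5, x 5, -x 0 + x 1 + x 2 + x 5, -x 0 + x 1 + x 3 + x 5,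
      -x 0 + x 1 + x 4 + x 5, x 1]
  | _ => x

theorem genR_toR (i : ℕ) (u : V6) : genR i u.toR = (gen i u).toR := by
  unfold genR gen
  split <;> first | rfl | (apply R6_ext <;> simp)

theorem genR_add (i : ℕ) (x y : R6) : genR i (x + y) = genR i x + genR i y := by
  unfold genR
  split <;> first | rfl | (apply R6_ext <;> simp <;> ring)

theorem genR_smul (i : ℕ) (k : ℝ) (x : R6) : genR i (k • x) = k • genR i x := by
  unfold genR
  split <;> first | rfl | (apply R6_ext <;> simp <;> ring)

theorem genR_genR (i : ℕ) (x : R6) : genR i (genR i x) = x := by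
  unfold genR
  split <;> first | rfl | (apply R6_ext <;> simp <;> ring)

theorem form1_genR (i : ℕ) (x : R6) : form1 (genR i x) (genR i x) = form1 x x := by
  unfold genR
  split <;> first | rfl | (simp [form1]; try ring)

theorem form2_genR (i : ℕ) (x : R6) : form2 (genR i x) (genR i x) = form2 x x := by
  unfold genR
  split <;> first | rfl | (simp [form2]; try ring)

/-- A generator as an affine equivalence. -/
noncomputable def genEquiv (i : ℕ) : R6 ≃ᵃ[ℝ] R6 :=
  LinearEquiv.toAffineEquiv
    { toFun := genR i
      map_add' := genR_add i
      map_smul' := genR_smul i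
      invFun := genR i
      left_inv := genR_genR i
      right_inv := genR_genR i }

theorem genEquiv_apply (i : ℕ) (x : R6) : genEquiv i x = genR i x := rfl

theorem genEquiv_mem (i : ℕ) : genEquiv i ∈ symGroup := by
  have hZ : ∀ x ∈ Z6, genR i x ∈ Z6 := by
    intro x hx
    obtain ⟨u, rfl⟩ := mem_Z6_iff.1 hx
    rw [genR_toR]
    exact V6.mem_Z6 _
  refine mem_symGroup.2 ⟨fun x => ⟨fun h => ?_, hZ x⟩, fun α β x y => ?_⟩
  · have := hZ _ h
    rwa [genEquiv_apply, genR_genR] at this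
  · have h : genR i (x - y) = genR i x - genR i y := by
      rw [sub_eq_add_neg, genR_add, ← neg_one_smul ℝ y, genR_smul, neg_one_smul, sub_eq_add_neg]
    rw [genEquiv_apply, genEquiv_apply, ← h]
    simp only [qf, bf, form1_genR, form2_genR]

/-- The action of a word in the generators. -/
def applyWord (w : List ℕ) (u : V6) : V6 := w.foldr gen u

/-- A word in the generators as an affine equivalence. -/
noncomputable def wordEquiv : List ℕ → R6 ≃ᵃ[ℝ] R6
  | [] => 1
  | i :: w => genEquiv i * wordEquiv w

theorem wordEquiv_mem (w : List ℕ) : wordEquiv w ∈ symGroup := by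
  induction w with
  | nil => exact one_mem _
  | cons i w ih => exact mul_mem (genEquiv_mem i) ih

theorem wordEquiv_toR (w : List ℕ) (u : V6) : wordEquiv w u.toR = (applyWord w u).toR := by
  induction w with
  | nil => rfl
  | cons i w ih =>
    change genR i (wordEquiv w u.toR) = _
    rw [ih, genR_toR]
    rfl

theorem wordEquiv_append (w w' : List ℕ) : wordEquiv (w ++ w') = wordEquiv w * wordEquiv w' := by
  induction w with
  | nil => rw [List.nil_append, wordEquiv, one_mul]
  | cons i w ih => rw [List.cons_append, wordEquiv, wordEquiv, ih, mul_assoc]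

/-- The symmetry `u ↦ z + w u`. -/
noncomputable def moveEquiv (w : List ℕ) (z : V6) : R6 ≃ᵃ[ℝ] R6 :=
  AffineEquiv.constVAdd ℝ R6 z.toR * wordEquiv w

theorem moveEquiv_mem (w : List ℕ) (z : V6) : moveEquiv w z ∈ symGroup :=
  mul_mem (translation_mem z.mem_Z6) (wordEquiv_mem w)

theorem moveEquiv_toR (w : List ℕ) (z u : V6) :
    moveEquiv w z u.toR = (V6.add z (applyWord w u)).toR := by
  change z.toR + wordEquiv w u.toR = _
  rw [wordEquiv_toR, V6.toR_add]

/-! ### The symmetry group is generated by the five involutions -/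

namespace V6

/-- The vectors of norm at most six of the second form are minimal in their classes modulo two,
as the second form has minimum four. -/
theorem mem_minimalVectors {z : V6} (h0 : z ≠ zero) (h : bil 0 1 z z ≤ 6) :
    z ∈ minimalVectors ∨ neg z ∈ minimalVectors := by
  obtain ⟨u, hmem, y, hz⟩ := exists_sameParity z
  have hmin := (minimal_in_class hmem y).2
  rw [← hz] at hmin
  have four_le : ∀ x, x ≠ zero → 4 ≤ bil 0 1 x x := by
    intro x hx
    have h1 : 0 < bil 0 1 x x :=
      lt_of_le_of_ne (bil_nonneg _ _ _) fun h' => hx (eq_zero_of_bil (by norm_num) h'.symm)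
    obtain ⟨k, hk⟩ := bil_two_mod_three x
    have hsq : (x.x0 + x.x1) ^ 2 % 3 = 0 ∨ (x.x0 + x.x1) ^ 2 % 3 = 1 := by
      have : (x.x0 + x.x1) % 3 = 0 ∨ (x.x0 + x.x1) % 3 = 1 ∨ (x.x0 + x.x1) % 3 = 2 := by omega
      rcases this with h | h | h <;> simp [pow_two, Int.mul_emod, h]
    have h2 : ∃ k, bil 0 1 x x = 2 * k := by
      refine ⟨5 * x.x0 ^ 2 + 2 * x.x1 ^ 2 - 5 * x.x0 * x.x1
        + 3 * (x.x1 - 2 * x.x0) * (x.x2 + x.x3 + x.x4 + x.x5)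
        + 3 * (x.x2 ^ 2 + x.x3 ^ 2 + x.x4 ^ 2 + x.x5 ^ 2)
        + 3 * (x.x2 * x.x3 + x.x2 * x.x4 + x.x2 * x.x5 + x.x3 * x.x4 + x.x3 * x.x5
          + x.x4 * x.x5), ?_⟩
      simp only [bil, dot, F1, F2]
      push_cast
      ring
    omega
  have hnil : ∀ w : V6, w = z → w ∈ zero :: minimalVectors → w ∈ minimalVectors := by
    rintro w rfl hw
    exact (List.mem_cons.1 hw).resolve_left h0
  by_cases hy : y = zero
  · have hzu : u = z := by rw [hz, hy]; ext <;> simp [add, zero]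
    exact Or.inl (hzu ▸ hnil u hzu hmem)
  by_cases hx : add u y = zero
  · have hzu : neg z = u := by
      have := congrArg V6.x0 hx; have := congrArg V6.x1 hx; have := congrArg V6.x2 hx
      have := congrArg V6.x3 hx; have := congrArg V6.x4 hx; have := congrArg V6.x5 hx
      rw [hz]
      simp only [add, zero] at *
      ext <;> simp only [neg] <;> linarith
    rcases List.mem_cons.1 hmem with hu0 | hu
    · refine absurd ?_ h0
      rw [hu0] at hzu
      have := congrArg neg hzu
      simpa [neg, zero, V6.ext_iff] using this
    · exact Or.inr (hzu ▸ hu)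
  exfalso
  have h1 := four_le _ hy
  have h2 := four_le _ hx
  have qz : bil 0 1 z z = bil 0 1 u u + 4 * bil 0 1 u y + 4 * bil 0 1 y y := by
    rw [hz]; simp only [bil_add_left, bil_add_right, bil_comm 0 1 y u]; ring
  have qx : bil 0 1 (add u y) (add u y) = bil 0 1 u u + 2 * bil 0 1 u y + bil 0 1 y y := by
    simp only [bil_add_left, bil_add_right, bil_comm 0 1 y u]; ring
  omega

end V6

/-- The scalar products of `z` and `b`, for both forms, with each other and with the vectors of a
list agree. -/
def sameProducts (pre : List V6) (b z : V6) : Bool :=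
  decide (V6.bil 1 0 z z = V6.bil 1 0 b b) && decide (V6.bil 0 1 z z = V6.bil 0 1 b b) &&
    pre.all fun p => decide (V6.bil 1 0 p z = V6.bil 1 0 p b) &&
      decide (V6.bil 0 1 p z = V6.bil 0 1 p b)

/-- The test that every short vector with the scalar products of `b` is the image of `b` under a
word which fixes the preceding vectors, for all vectors `b` of a list. -/
def chainCheck : List V6 → List (V6 × List (List ℕ)) → Bool
  | _, [] => true
  | pre, (b, ws) :: l =>
    decide (b ≠ V6.zero) && decide (V6.bil 0 1 b b ≤ 6) &&
    (V6.minimalVectors ++ V6.minimalVectors.map V6.neg).all (fun z =>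
      !sameProducts pre b z ||
        ws.any fun w => decide (applyWord w b = z) &&
          pre.all fun p => decide (applyWord w p = p)) &&
    chainCheck (pre ++ [b]) l

/-- A basis of `ℤ⁶`, and for each basis vector words which fix the preceding vectors and move the
vector to all its images under the stabilizer of the preceding vectors. -/
def stabilizerChain : List (V6 × List (List ℕ)) :=
  [(⟨1, 1, 0, 0, 0, 0⟩,
     [[], [1], [3], [4], [2, 1], [3, 1], [4, 1], [0, 3], [1, 3], [4, 3], [0, 2, 1], [3, 2, 1],
     [4, 2, 1], [4, 3, 1], [3, 4, 1], [1, 0, 3], [2, 0, 3], [4, 0, 3], [3, 1, 3], [4, 1, 3],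
     [3, 4, 3], [4, 3, 2, 1], [3, 4, 2, 1], [3, 4, 3, 1], [3, 1, 0, 3], [4, 1, 0, 3],
     [3, 2, 0, 3], [4, 2, 0, 3], [3, 4, 0, 3], [4, 3, 1, 3], [3, 4, 1, 3], [1, 3, 4, 3],
     [4, 3, 4, 3], [3, 4, 3, 2, 1], [2, 3, 4, 2, 1], [1, 3, 4, 3, 1], [4, 3, 4, 3, 1],
     [1, 3, 1, 0, 3], [4, 3, 1, 0, 3], [3, 4, 2, 0, 3], [4, 3, 4, 0, 3], [4, 3, 4, 1, 3],
     [3, 1, 3, 4, 3], [4, 1, 3, 4, 3], [4, 3, 4, 3, 2, 1], [4, 1, 3, 4, 3, 1],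
     [3, 1, 3, 1, 0, 3], [4, 3, 4, 2, 0, 3]]),
   (⟨0, 1, 0, 0, 0, 0⟩,
     [[], [4, 3, 4]]),
   (⟨0, 0, 1, 0, 0, 0⟩,
     [[], [3, 2, 3], [2, 3, 2, 3], [0, 2, 3, 2, 3]]),
   (⟨0, 0, 0, 1, 0, 0⟩,
     [[], [2], [0, 2]]),
   (⟨0, 0, 0, 0, 1, 0⟩,
     [[], [0]]),
   (⟨0, 0, 0, 0, 0, 1⟩,
     [[]])]

theorem chainCheck_stabilizerChain : chainCheck [] stabilizerChain = true := by
  decide +kernel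

theorem sub_eq_linear {τ : R6 ≃ᵃ[ℝ] R6} (x y : R6) : τ x - τ y = τ.linear (x - y) := by
  have := (τ : R6 →ᵃ[ℝ] R6).linearMap_vsub x y
  simpa using this.symm

theorem qf_linear {τ : R6 ≃ᵃ[ℝ] R6} (hτ : τ ∈ symGroup) (α β : ℕ) (x : R6) :
    qf α β (τ.linear x) = qf α β x := by
  have := hτ.2 α β x 0
  rwa [sub_eq_linear, sub_zero] at this

theorem bf_eq_qf (α β : ℕ) (x y : R6) :
    bf α β x y = (qf α β (x + y) - qf α β x - qf α β y) / 2 := by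
  simp only [qf, bf, form1, form2, Pi.add_apply]; ring

theorem bf_linear {τ : R6 ≃ᵃ[ℝ] R6} (hτ : τ ∈ symGroup) (α β : ℕ) (x y : R6) :
    bf α β (τ.linear x) (τ.linear y) = bf α β x y := by
  rw [bf_eq_qf, bf_eq_qf, ← map_add, qf_linear hτ, qf_linear hτ, qf_linear hτ]

theorem linear_mem_Z6 {τ : R6 ≃ᵃ[ℝ] R6} (hτ : τ ∈ symGroup) {x : R6} (hx : x ∈ Z6) :
    τ.linear x ∈ Z6 := by
  have h : τ.linear x = τ x + -τ 0 := by
    rw [← sub_eq_add_neg, sub_eq_linear, sub_zero]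
  rw [h]
  exact add_mem_Z6 ((hτ.1 _).2 hx) (neg_mem_Z6 ((hτ.1 _).2 zero_mem_Z6))

theorem linear_mul (σ τ : R6 ≃ᵃ[ℝ] R6) (x : R6) : (σ * τ).linear x = σ.linear (τ.linear x) := rfl

theorem wordEquiv_linear (w : List ℕ) (x : R6) : (wordEquiv w).linear x = wordEquiv w x := by
  induction w generalizing x with
  | nil => rfl
  | cons i w ih =>
    rw [wordEquiv, linear_mul, ih]
    rfl

/-- A symmetry moves `b` to a short vector with the same scalar products; a word of the chain undoes
this, and what remains fixes one more vector. -/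
theorem exists_word_of_chainCheck (l : List (V6 × List (List ℕ))) :
    ∀ pre, chainCheck pre l = true → ∀ τ ∈ symGroup, (∀ p ∈ pre, τ.linear p.toR = p.toR) →
      ∃ w : List ℕ, ∃ σ ∈ symGroup, (∀ x, τ.linear x = wordEquiv w (σ.linear x)) ∧
        ∀ p ∈ pre ++ l.map Prod.fst, σ.linear p.toR = p.toR := by
  induction l with
  | nil =>
    intro pre _ τ hτ hfix
    exact ⟨[], τ, hτ, fun _ => rfl, by simpa using hfix⟩
  | cons e l ih =>
    obtain ⟨b, ws⟩ := e
    intro pre hc τ hτ hfix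
    simp only [chainCheck, Bool.and_eq_true, decide_eq_true_eq, List.all_eq_true, Bool.or_eq_true,
      Bool.not_eq_true', List.any_eq_true] at hc
    obtain ⟨⟨⟨hb0, hb6⟩, hall⟩, hrest⟩ := hc
    obtain ⟨z, hz⟩ := mem_Z6_iff.1 (linear_mem_Z6 hτ b.mem_Z6)
    have hbil : ∀ α β, V6.bil α β z z = V6.bil α β b b := by
      intro α β
      have := bf_linear hτ α β b.toR b.toR
      rw [← hz, V6.bf_toR, V6.bf_toR] at this
      exact_mod_cast this
    have hpre : ∀ α β, ∀ p ∈ pre, V6.bil α β p z = V6.bil α β p b := by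
      intro α β p hp
      have := bf_linear hτ α β p.toR b.toR
      rw [hfix p hp, ← hz, V6.bf_toR, V6.bf_toR] at this
      exact_mod_cast this
    have hz0 : z ≠ V6.zero := by
      rintro rfl
      refine hb0 (V6.eq_zero_of_bil (α := 0) (β := 1) (by norm_num) ?_)
      rw [← hbil]
      decide
    have hmem : z ∈ V6.minimalVectors ++ V6.minimalVectors.map V6.neg := by
      rw [List.mem_append, List.mem_map]
      refine (V6.mem_minimalVectors hz0 ((hbil 0 1).trans_le hb6)).imp_right fun h => ⟨_, h, ?_⟩
      simp [V6.neg]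
    have hsame : sameProducts pre b z = true := by
      simp only [sameProducts, Bool.and_eq_true, decide_eq_true_eq, List.all_eq_true]
      exact ⟨⟨hbil 1 0, hbil 0 1⟩, fun p hp => ⟨hpre 1 0 p hp, hpre 0 1 p hp⟩⟩
    rcases hall z hmem with h | ⟨w, -, hwb, hwp⟩
    · rw [hsame] at h
      exact absurd h (by decide)
    have hinv : ∀ u u' : V6, applyWord w u = u' →
        ((wordEquiv w)⁻¹ : R6 ≃ᵃ[ℝ] R6).linear u'.toR = u.toR := by
      intro u u' h
      have h1 : u'.toR = (wordEquiv w).linear u.toR := by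
        rw [wordEquiv_linear, wordEquiv_toR, h]
      rw [h1]
      exact (wordEquiv w).linear.symm_apply_apply _
    obtain ⟨w', σ, hσ, h1, h2⟩ := ih (pre ++ [b]) hrest ((wordEquiv w)⁻¹ * τ)
      (mul_mem (inv_mem (wordEquiv_mem w)) hτ) (by
        intro p hp
        rw [linear_mul]
        rcases List.mem_append.1 hp with hp | hp
        · rw [hfix p hp]
          exact hinv _ _ (hwp p hp)
        · obtain rfl := List.mem_singleton.1 hp
          rw [← hz]
          exact hinv _ _ hwb)
    refine ⟨w ++ w', σ, hσ, fun x => ?_, by simpa using h2⟩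
    have h3 := congrArg (wordEquiv w) (h1 x)
    rw [linear_mul] at h3
    have h4 : wordEquiv w (((wordEquiv w)⁻¹ : R6 ≃ᵃ[ℝ] R6).linear (τ.linear x)) = τ.linear x := by
      rw [← wordEquiv_linear]
      exact (wordEquiv w).linear.apply_symm_apply _
    rw [h4] at h3
    rw [h3, wordEquiv_append]
    rfl

/-- The linear part of a symmetry is a word in the five involutions. -/
theorem exists_word {τ : R6 ≃ᵃ[ℝ] R6} (hτ : τ ∈ symGroup) :
    ∃ w : List ℕ, ∀ x, τ.linear x = wordEquiv w x := by
  obtain ⟨w, σ, -, h1, h2⟩ :=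
    exists_word_of_chainCheck _ [] chainCheck_stabilizerChain τ hτ (by simp)
  refine ⟨w, fun x => ?_⟩
  rw [h1]
  congr 1
  simp only [stabilizerChain, List.map_cons, List.map_nil, List.nil_append, List.mem_cons,
    List.not_mem_nil, or_false, forall_eq_or_imp, forall_eq] at h2
  obtain ⟨e1, e2, e3, e4, e5, e6⟩ := h2
  have hx : x = x 0 • (⟨1, 1, 0, 0, 0, 0⟩ : V6).toR + (x 1 - x 0) • (⟨0, 1, 0, 0, 0, 0⟩ : V6).toR
      + x 2 • (⟨0, 0, 1, 0, 0, 0⟩ : V6).toR + x 3 • (⟨0, 0, 0, 1, 0, 0⟩ : V6).toR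
      + x 4 • (⟨0, 0, 0, 0, 1, 0⟩ : V6).toR + x 5 • (⟨0, 0, 0, 0, 0, 1⟩ : V6).toR := by
    apply R6_ext <;> simp
  conv_lhs => rw [hx]
  simp only [map_add, map_smul, e1, e2, e3, e4, e5, e6]
  exact hx.symm

/-! ### Frames and tiles with integer data -/

/-- A coordinate of an integer vector. -/
def V6.get (u : V6) : Fin 6 → ℤ := ![u.x0, u.x1, u.x2, u.x3, u.x4, u.x5]

theorem V6.toR_apply (u : V6) (i : Fin 6) : u.toR i = u.get i := by
  fin_cases i <;> rfl

theorem V6.dot_eq_sum (u w : V6) : dot u w = ∑ i, u.get i * w.get i := by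
  rw [Fin.sum_univ_six]; rfl

/-- The affine function `x ↦ (α ⬝ x + d) / N`. -/
noncomputable def affineForm (α : V6) (d : ℤ) (N : ℕ) : R6 →ᵃ[ℝ] ℝ where
  toFun x := (α.toR ⬝ᵥ x + d) / N
  linear := (N : ℝ)⁻¹ • dotProductBilin ℝ ℝ α.toR
  map_vadd' x y := by
    simp only [vadd_eq_add, dotProduct_add, LinearMap.smul_apply, dotProductBilin_apply_apply,
      smul_eq_mul]
    ring

theorem affineForm_apply (α : V6) (d : ℤ) (N : ℕ) (x : R6) :
    affineForm α d N x = (∑ i, (α.get i : ℝ) * x i + d) / N := by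
  change (∑ i, α.toR i * x i + d) / N = _
  simp only [V6.toR_apply]

theorem affineForm_toR (α : V6) (d : ℤ) (N : ℕ) (u : V6) :
    affineForm α d N u.toR = ((V6.dot α u + d : ℤ) : ℝ) / N := by
  rw [affineForm_apply, V6.dot_eq_sum]
  push_cast
  simp only [V6.toR_apply]

/-- The data of a block frame with integral points: the centroid is `c / den`, and the coordinate
function of the point `v i` is `x ↦ (α i ⬝ x + d i) / den`. -/
structure FrameData (n k : ℕ) where
  blk : Fin n → Fin k
  v : Fin n → V6
  den : ℕ
  c : V6
  α : Fin n → V6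
  d : Fin n → ℤ
  /-- The number of points in a block. -/
  sz : Fin k → ℕ

namespace FrameData

variable {n k : ℕ} (D : FrameData n k)

/-- The identities between integers which make the data a block frame. -/
structure Valid : Prop where
  card : ∀ K, (Finset.univ.filter (D.blk · = K)).card = D.sz K
  sz_pos : ∀ K, 0 < D.sz K
  k_pos : 0 < k
  den_pos : 0 < D.den
  coord : ∀ i j, (D.sz (D.blk i) : ℤ) * (V6.dot (D.α i) (D.v j) + D.d i) =
    (if i = j then (D.sz (D.blk i) : ℤ) * D.den else 0) -
      (if D.blk i = D.blk j then (D.den : ℤ) else 0)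
  recon : ∀ p q, ∑ i, (D.α i).get p * (D.v i).get q = if p = q then (D.den : ℤ) else 0
  recon_c : ∀ q, D.c.get q + ∑ i, D.d i * (D.v i).get q = 0
  zero_sum : ∀ K p, ∑ i ∈ Finset.univ.filter (D.blk · = K), (D.α i).get p = 0
  zero_sum_d : ∀ K, ∑ i ∈ Finset.univ.filter (D.blk · = K), D.d i = 0
  cent : ∀ K q, D.den * ∑ i ∈ Finset.univ.filter (D.blk · = K), (D.v i).get q =
    D.sz K * D.c.get q

instance : Decidable D.Valid :=
  decidable_of_iff ((∀ K, (Finset.univ.filter (D.blk · = K)).card = D.sz K) ∧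
    (∀ K, 0 < D.sz K) ∧ 0 < k ∧ 0 < D.den ∧
    (∀ i j, (D.sz (D.blk i) : ℤ) * (V6.dot (D.α i) (D.v j) + D.d i) =
      (if i = j then (D.sz (D.blk i) : ℤ) * D.den else 0) -
        (if D.blk i = D.blk j then (D.den : ℤ) else 0)) ∧
    (∀ p q, ∑ i, (D.α i).get p * (D.v i).get q = if p = q then (D.den : ℤ) else 0) ∧
    (∀ q, D.c.get q + ∑ i, D.d i * (D.v i).get q = 0) ∧
    (∀ K p, ∑ i ∈ Finset.univ.filter (D.blk · = K), (D.α i).get p = 0) ∧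
    (∀ K, ∑ i ∈ Finset.univ.filter (D.blk · = K), D.d i = 0) ∧
    ∀ K q, D.den * ∑ i ∈ Finset.univ.filter (D.blk · = K), (D.v i).get q = D.sz K * D.c.get q)
    ⟨fun ⟨h1, h2, h3, h4, h5, h6, h7, h8, h9, h10⟩ => ⟨h1, h2, h3, h4, h5, h6, h7, h8, h9, h10⟩,
      fun h => ⟨h.1, h.2, h.3, h.4, h.5, h.6, h.7, h.8, h.9, h.10⟩⟩

variable {D}

/-- The block frame with the given data. -/
noncomputable def Valid.toBlockFrame (h : D.Valid) : BlockFrame n k where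
  blk := D.blk
  v i := (D.v i).toR
  c := V6.quot D.den D.c
  a i := affineForm (D.α i) (D.d i) D.den
  s K := D.sz K
  s_eq K := by rw [h.card]
  s_pos K := by exact_mod_cast h.sz_pos K
  k_pos := h.k_pos
  coord i j := by
    have hd : (D.den : ℝ) ≠ 0 := by exact_mod_cast h.den_pos.ne'
    have hs : (D.sz (D.blk i) : ℝ) ≠ 0 := by exact_mod_cast (h.sz_pos (D.blk i)).ne'
    have e : (D.sz (D.blk i) : ℝ) * ((V6.dot (D.α i) (D.v j) + D.d i : ℤ) : ℝ) =
        (if i = j then (D.sz (D.blk i) : ℝ) * D.den else 0) -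
          (if D.blk i = D.blk j then (D.den : ℝ) else 0) := by
      exact_mod_cast congrArg (Int.cast : ℤ → ℝ) (h.coord i j)
    rw [affineForm_toR, div_eq_iff hd]
    apply mul_left_cancel₀ hs
    rw [e]
    split_ifs <;> field_simp
    all_goals simp
  recon x := by
    have hd : (D.den : ℝ) ≠ 0 := by exact_mod_cast h.den_pos.ne'
    funext q
    have e1 : (D.c.get q : ℝ) + ∑ i, (D.d i : ℝ) * (D.v i).get q = 0 := by
      exact_mod_cast congrArg (Int.cast : ℤ → ℝ) (h.recon_c q)
    have e2 : ∀ p, ∑ i, ((D.α i).get p : ℝ) * (D.v i).get q = if p = q then (D.den : ℝ) else 0 := by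
      intro p
      exact_mod_cast congrArg (Int.cast : ℤ → ℝ) (h.recon p q)
    have e3 : ∑ i, (∑ p, ((D.α i).get p : ℝ) * x p) * (D.v i).get q = D.den * x q := by
      simp only [Finset.sum_mul]
      rw [Finset.sum_comm, Finset.sum_eq_single q]
      · rw [← (e2 q).trans (if_pos rfl), Finset.sum_mul]
        exact Finset.sum_congr rfl fun i _ => by ring
      · intro p _ hp
        rw [← mul_zero (x p), ← (e2 p).trans (if_neg hp), Finset.mul_sum]
        exact Finset.sum_congr rfl fun i _ => by ring
      · simp
    apply mul_left_cancel₀ hd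
    rw [← e3, Pi.add_apply, Finset.sum_apply, mul_add, Finset.mul_sum]
    simp only [V6.quot, Pi.smul_apply, smul_eq_mul, affineForm_apply, V6.toR_apply]
    rw [← mul_assoc, mul_inv_cancel₀ hd, one_mul]
    have e4 : ∀ i, (D.den : ℝ) * ((∑ p, ((D.α i).get p : ℝ) * x p + D.d i) / D.den *
        (D.v i).get q) = (∑ p, ((D.α i).get p : ℝ) * x p) * (D.v i).get q +
          D.d i * (D.v i).get q := fun i => by
      rw [← mul_assoc, mul_div_cancel₀ _ hd, add_mul]
    rw [Finset.sum_congr rfl fun i _ => e4 i, Finset.sum_add_distrib]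
    linarith
  zero_sum K x := by
    have e1 : ∀ p, ∑ i ∈ Finset.univ.filter (D.blk · = K), ((D.α i).get p : ℝ) = 0 := fun p => by
      exact_mod_cast congrArg (Int.cast : ℤ → ℝ) (h.zero_sum K p)
    have e2 : ∑ i ∈ Finset.univ.filter (D.blk · = K), (D.d i : ℝ) = 0 := by
      exact_mod_cast congrArg (Int.cast : ℤ → ℝ) (h.zero_sum_d K)
    simp only [affineForm_apply]
    rw [← Finset.sum_div, Finset.sum_add_distrib, e2, Finset.sum_comm]
    simp only [← Finset.sum_mul, e1]
    simp
  cent K := by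
    have hd : (D.den : ℝ) ≠ 0 := by exact_mod_cast h.den_pos.ne'
    funext q
    have e1 : (D.den : ℝ) * ∑ i ∈ Finset.univ.filter (D.blk · = K), ((D.v i).get q : ℝ) =
        D.sz K * D.c.get q := by
      exact_mod_cast congrArg (Int.cast : ℤ → ℝ) (h.cent K q)
    rw [Finset.sum_apply]
    simp only [V6.quot, Pi.smul_apply, smul_eq_mul, V6.toR_apply]
    apply mul_left_cancel₀ hd
    rw [e1]
    field_simp

/-- The tests which make the convex hull of the points of a frame a tile of the Delaunay tiling of
the sum of the two forms, with the ellipsoid centred at `C / N`. -/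
structure TileValid (D : FrameData n k) (i₀ : Fin n) (N : ℕ) (C : V6) : Prop where
  valid : D.Valid
  card : n = 6 + k
  N_pos : 0 < N
  r_le : V6.bil 1 1 (V6.sub (V6.smul N (D.v i₀)) C) (V6.sub (V6.smul N (D.v i₀)) C) ≤ 4 * N ^ 2
  on : ∀ i, V6.onCheck 1 1 N C (D.v i₀) (D.v i) = true
  empty : V6.emptyCheck 1 1 N C (D.v i₀) = true
  contact : V6.contactCheck 1 1 N C (D.v i₀) (List.ofFn D.v) = true

/-- The tile with the given data. -/
noncomputable def TileValid.toTile {i₀ : Fin n} {N : ℕ} {C : V6} (h : D.TileValid i₀ N C) :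
    Tile where
  n := n
  k := k
  B := h.valid.toBlockFrame
  card := h.card
  o := V6.quot N C
  r := qf 1 1 ((D.v i₀).toR - V6.quot N C)
  r_le := by
    have hN : (0 : ℝ) < N := by exact_mod_cast h.N_pos
    have e : (V6.sub (V6.smul N (D.v i₀)) C).toR = (N : ℝ) • ((D.v i₀).toR - V6.quot N C) := by
      rw [V6.toR_sub, V6.toR_smul, smul_sub, V6.quot, smul_smul, mul_inv_cancel₀ hN.ne', one_smul]
      simp
    have h1 := h.r_le
    have h2 : qf 1 1 (V6.sub (V6.smul N (D.v i₀)) C).toR ≤ 4 * N ^ 2 := by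
      rw [V6.qf_toR]
      exact_mod_cast h1
    rw [e] at h2
    have h3 : qf 1 1 ((N : ℝ) • ((D.v i₀).toR - V6.quot N C)) =
        qf 1 1 ((D.v i₀).toR - V6.quot N C) * N ^ 2 := by
      simp only [qf, bf, form1, form2, Pi.smul_apply, smul_eq_mul]; ring
    rw [h3] at h2
    exact le_of_mul_le_mul_right h2 (by positivity)
  v_mem i := V6.mem_Z6 _
  on i := (V6.dev_eq_zero_iff h.N_pos).2 (h.on i)
  empty z hz := V6.dev_nonneg_of_check (by norm_num) h.N_pos h.empty hz
  contact z hz h0 := by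
    obtain ⟨w, hw, rfl⟩ :=
      V6.mem_of_dev_eq_zero (by norm_num) h.N_pos h.empty h.contact hz h0
    obtain ⟨i, rfl⟩ := List.mem_ofFn.1 hw
    exact ⟨i, rfl⟩

end FrameData

/-! ### The reference tiles -/

/-- The frame of the reference T-tope: three triangles with a common centroid. -/
def frameT : FrameData 9 3 where
  blk := ![0, 0, 0, 1, 1, 1, 2, 2, 2]
  v :=
    ![⟨0, 0, 0, 0, 0, 0⟩, ⟨0, 0, 0, 0, 1, 0⟩, ⟨0, 0, 0, 0, 0, 1⟩, ⟨2, 0, 1, 1, 1, 1⟩,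
      ⟨-1, 0, 0, -1, 0, 0⟩, ⟨-1, 0, -1, 0, 0, 0⟩, ⟨0, 1, 0, 0, 0, 0⟩, ⟨1, 0, 0, 0, 1, 1⟩,
      ⟨-1, -1, 0, 0, 0, 0⟩]
  den := 3
  c := ⟨0, 0, 0, 0, 1, 1⟩
  α :=
    ![⟨4, -2, -2, -2, -3, -3⟩, ⟨-2, 1, 1, 1, 3, 0⟩, ⟨-2, 1, 1, 1, 0, 3⟩, ⟨0, 0, 1, 1, 0, 0⟩,
      ⟨0, 0, 1, -2, 0, 0⟩, ⟨0, 0, -2, 1, 0, 0⟩, ⟨-1, 2, 1, 1, 0, 0⟩, ⟨2, -1, -2, -2, 0, 0⟩,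
      ⟨-1, -1, 1, 1, 0, 0⟩]
  d := ![2, -1, -1, 0, 0, 0, 0, 0, 0]
  sz := ![3, 3, 3]

/-- The frame of the reference R-tope: two tetrahedra with a common centroid. -/
def frameR : FrameData 8 2 where
  blk := ![0, 0, 0, 0, 1, 1, 1, 1]
  v :=
    ![⟨0, 1, 0, 0, 0, 0⟩, ⟨2, 0, 1, 1, 1, 1⟩, ⟨-1, -1, 0, 0, 0, 0⟩, ⟨-1, 0, 0, 0, 0, 0⟩,
      ⟨0, 0, 1, 0, 0, 0⟩, ⟨0, 0, 0, 1, 0, 0⟩, ⟨0, 0, 0, 0, 1, 0⟩, ⟨0, 0, 0, 0, 0, 1⟩]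
  den := 4
  c := ⟨0, 0, 1, 1, 1, 1⟩
  α :=
    ![⟨4, 0, -3, -3, -3, -3⟩, ⟨0, 0, 1, 1, 1, 1⟩, ⟨4, -4, -3, -3, -3, -3⟩, ⟨-8, 4, 5, 5, 5, 5⟩,
      ⟨0, 0, 3, -1, -1, -1⟩, ⟨0, 0, -1, 3, -1, -1⟩, ⟨0, 0, -1, -1, 3, -1⟩, ⟨0, 0, -1, -1, -1, 3⟩]
  d := ![3, -1, 3, -5, 0, 0, 0, 0]
  sz := ![4, 4]

/-- The frame of a simplex spanned by seven of the nine vertices of the reference Q-tope. -/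
def frameW : FrameData 7 1 where
  blk := ![0, 0, 0, 0, 0, 0, 0]
  v :=
    ![⟨0, 0, 0, 1, 0, 0⟩, ⟨0, 0, 0, 0, 1, 0⟩, ⟨0, 0, 0, 0, 0, 1⟩, ⟨-1, -1, 0, 0, 0, 0⟩,
      ⟨1, 0, 0, 1, 1, 1⟩, ⟨2, 0, 1, 1, 1, 1⟩, ⟨-1, 0, -1, 0, 0, 0⟩]
  den := 7
  c := ⟨1, -1, 0, 3, 3, 3⟩
  α :=
    ![⟨-7, 7, 7, 7, 0, 0⟩, ⟨-7, 7, 7, 0, 7, 0⟩, ⟨-7, 7, 7, 0, 0, 7⟩, ⟨0, -7, 0, 0, 0, 0⟩,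
      ⟨-7, 0, 0, 7, 7, 7⟩, ⟨14, -7, -7, -7, -7, -7⟩, ⟨14, -7, -14, -7, -7, -7⟩]
  d := ![-1, -1, -1, -1, -8, 6, 6]
  sz := ![7]

/-- The frame of the reference Q-tope: three triangles with a common centroid. -/
def frameQ : FrameData 9 3 where
  blk := ![0, 0, 0, 1, 1, 1, 2, 2, 2]
  v :=
    ![⟨0, 0, 0, 1, 0, 0⟩, ⟨0, 0, 0, 0, 1, 0⟩, ⟨0, 0, 0, 0, 0, 1⟩, ⟨0, 1, 0, 0, 0, 0⟩,
      ⟨-1, -1, 0, 0, 0, 0⟩, ⟨1, 0, 0, 1, 1, 1⟩, ⟨2, 0, 1, 1, 1, 1⟩, ⟨-1, 0, 0, 0, 0, 0⟩,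
      ⟨-1, 0, -1, 0, 0, 0⟩]
  den := 3
  c := ⟨0, 0, 0, 1, 1, 1⟩
  α :=
    ![⟨0, 0, 0, 2, -1, -1⟩, ⟨0, 0, 0, -1, 2, -1⟩, ⟨0, 0, 0, -1, -1, 2⟩, ⟨1, 1, 0, -1, -1, -1⟩,
      ⟨1, -2, 0, -1, -1, -1⟩, ⟨-2, 1, 0, 2, 2, 2⟩, ⟨2, -1, 0, -1, -1, -1⟩, ⟨-4, 2, 3, 2, 2, 2⟩,
      ⟨2, -1, -3, -1, -1, -1⟩]
  d := ![0, 0, 0, 1, 1, -2, 1, -2, 1]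
  sz := ![3, 3, 3]

theorem frameT_valid : frameT.Valid := by decide +kernel

theorem frameR_valid : frameR.Valid := by decide +kernel

theorem frameW_valid : frameW.Valid := by decide +kernel

theorem frameQ_valid : frameQ.Valid := by decide +kernel

theorem frameT_tileValid : frameT.TileValid 0 12 ⟨2, 1, 1, 1, 4, 4⟩ where
  valid := frameT_valid
  card := rfl
  N_pos := by norm_num
  r_le := by decide +kernel
  on := by decide +kernel
  empty := by decide +kernel
  contact := by decide +kernel

theorem frameR_tileValid : frameR.TileValid 0 4 ⟨0, 0, 1, 1, 1, 1⟩ where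
  valid := frameR_valid
  card := rfl
  N_pos := by norm_num
  r_le := by decide +kernel
  on := by decide +kernel
  empty := by decide +kernel
  contact := by decide +kernel

theorem frameW_tileValid : frameW.TileValid 0 24 ⟨4, -4, -1, 11, 11, 11⟩ where
  valid := frameW_valid
  card := rfl
  N_pos := by norm_num
  r_le := by decide +kernel
  on := by decide +kernel
  empty := by decide +kernel
  contact := by decide +kernel

/-- The vertices of the three reference tiles. -/
def tileVertices : Fin 3 → List V6 :=
  ![List.ofFn frameT.v, List.ofFn frameR.v, List.ofFn frameW.v]

/-- The three reference tiles. -/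
noncomputable def refTile : Fin 3 → Tile :=
  ![frameT_tileValid.toTile, frameR_tileValid.toTile, frameW_tileValid.toTile]

theorem range_toR {n : ℕ} (f : Fin n → V6) :
    Set.range (fun i => (f i).toR) = V6.toR '' {u | u ∈ List.ofFn f} := by
  ext x
  simp [List.mem_ofFn, Set.mem_image]

theorem range_refTile (j : Fin 3) :
    Set.range (refTile j).B.v = V6.toR '' {u | u ∈ tileVertices j} := by
  fin_cases j
  · exact range_toR frameT.v
  · exact range_toR frameR.v
  · exact range_toR frameW.v

/-- The tiles obtained from the reference tiles by the symmetries of the two forms. -/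
def tileFamily : Set Tile := {t | ∃ j τ, ∃ hτ : τ ∈ symGroup, t = (refTile j).map τ hτ}

/-- The test that the image of the `j`-th reference tile under `u ↦ z + w u` has all vertices `v i`
with `p i`, and a vertex which is not among the `v i`. -/
def neighbourCheck {n : ℕ} (v : Fin n → V6) (p : Fin n → Bool) (e : Fin 3 × List ℕ × V6) : Bool :=
  decide (∀ i, p i = true →
    v i ∈ (tileVertices e.1).map fun u => V6.add e.2.2 (applyWord e.2.1 u)) &&
  ((tileVertices e.1).map fun u => V6.add e.2.2 (applyWord e.2.1 u)).any fun u =>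
    decide (u ∉ List.ofFn v)

/-- A list of neighbours which passes the test for every transversal provides, for every facet of
the reference tile, another tile with the vertices of the facet. -/
theorem exists_neighbour {j : Fin 3} {n k : ℕ} {D : FrameData n k} {i₀ : Fin n} {N : ℕ} {C : V6}
    (hD : D.TileValid i₀ N C) (hj : refTile j = hD.toTile) {L : List (Fin 3 × List ℕ × V6)}
    (hL : ∀ w : Fin k → Fin n, (∀ K, D.blk (w K) = K) →
      L.any (neighbourCheck D.v fun i => decide (i ≠ w (D.blk i))) = true)
    {w : Fin (refTile j).k → Fin (refTile j).n} (hw : (refTile j).B.IsTransversal w) :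
    ∃ t' ∈ tileFamily, t'.B.hull ≠ (refTile j).B.hull ∧
      ∀ i ∈ (refTile j).B.rest w, (refTile j).B.v i ∈ Set.range t'.B.v := by
  revert w
  rw [hj]
  intro w hw
  obtain ⟨⟨j', l, z⟩, -, he⟩ := List.any_eq_true.1 (hL w hw)
  rw [neighbourCheck, Bool.and_eq_true, decide_eq_true_eq, List.any_eq_true] at he
  obtain ⟨h1, u, hu, h2⟩ := he
  rw [decide_eq_true_eq] at h2
  have hr : Set.range ((refTile j').map (moveEquiv l z) (moveEquiv_mem l z)).B.v =
      V6.toR '' {u | u ∈ (tileVertices j').map fun u => V6.add z (applyWord l u)} := by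
    change Set.range (fun i => moveEquiv l z ((refTile j').B.v i)) = _
    rw [Set.range_comp' (moveEquiv l z), range_refTile, Set.image_image]
    ext x
    simp [Set.mem_image, moveEquiv_toR]
  refine ⟨(refTile j').map (moveEquiv l z) (moveEquiv_mem l z), ⟨j', _, _, rfl⟩, ?_, ?_⟩
  · intro h
    have h3 := congrArg (· ∩ Z6) h
    simp only [Tile.hull_inter_Z6] at h3
    rw [hr] at h3
    have h4 : u.toR ∈ Set.range hD.toTile.B.v := by
      rw [← h3]
      exact ⟨u, hu, rfl⟩
    obtain ⟨i, hi⟩ := h4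
    exact h2 (List.mem_ofFn.2 ⟨i, V6.toR_injective hi⟩)
  · intro i hi
    rw [hr]
    exact ⟨D.v i, h1 i (decide_eq_true (p := i ≠ (show Fin k → Fin n from w) (D.blk i)) hi), rfl⟩

/-- The tiles across the facets of the reference T-tope. -/
def neighboursT : List (Fin 3 × List ℕ × V6) :=
  [(0, [1], ⟨-2, -1, -1, -1, 0, 0⟩), (0, [2, 0, 3], ⟨-1, -1, 0, 0, 0, 0⟩),
   (0, [2, 0, 3, 1], ⟨1, 0, 0, 0, 1, 1⟩), (0, [3, 1, 2], ⟨1, -1, 0, 1, 1, 1⟩),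
   (2, [1, 3, 1], ⟨1, -1, 0, 1, 1, 1⟩), (2, [4, 3, 2, 3, 2, 3, 1], ⟨-1, 1, -1, -1, 0, 0⟩),
   (0, [2, 1, 3], ⟨1, -1, 1, 0, 1, 1⟩), (2, [2, 1, 3], ⟨1, -1, 1, 0, 1, 1⟩),
   (2, [4, 2, 3, 1], ⟨-1, 1, -1, -1, 0, 0⟩), (0, [3, 0, 2], ⟨0, -1, 0, 0, 0, 1⟩),
   (2, [1, 3, 4], ⟨0, -1, 0, 0, 0, 1⟩), (2, [1, 3, 4, 3, 1, 3], ⟨0, -1, 0, 0, 0, 1⟩),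
   (2, [1, 3, 1, 3, 4, 3, 4], ⟨-2, 0, -1, -1, -1, 0⟩), (0, [2], ⟨0, 0, 0, 0, 0, 0⟩),
   (0, [3, 2, 0, 3], ⟨0, 0, 0, 0, 0, 0⟩), (2, [4, 2, 0, 3, 4], ⟨-2, 0, -1, -1, -1, 0⟩),
   (0, [3, 2, 3, 2], ⟨0, 0, 0, 0, 0, 0⟩), (0, [4, 2, 1], ⟨0, 0, 0, 0, 0, 0⟩),
   (0, [3, 0, 2, 1], ⟨0, -1, 0, 0, 1, 0⟩), (2, [1, 0, 3, 4], ⟨0, -1, 0, 0, 1, 0⟩),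
   (2, [1, 3, 4, 3, 1, 0, 3], ⟨0, -1, 0, 0, 1, 0⟩),
   (2, [4, 3, 4, 2, 3, 2, 3, 1], ⟨-2, 0, -1, -1, 0, -1⟩), (0, [0, 2], ⟨0, 0, 0, 0, 0, 0⟩),
   (0, [3, 1, 3], ⟨0, 0, 0, 0, 0, 0⟩), (2, [4, 2, 3, 4, 1], ⟨-2, 0, -1, -1, 0, -1⟩),
   (0, [3, 1, 3, 4], ⟨0, 0, 0, 0, 0, 0⟩), (0, [1, 2, 1], ⟨0, 0, 0, 0, 0, 0⟩)]

/-- The tiles across the facets of the reference R-tope. -/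
def neighboursR : List (Fin 3 × List ℕ × V6) :=
  [(2, [3, 4, 3, 1, 3, 1], ⟨1, -1, 0, 1, 1, 1⟩), (2, [3, 4, 3, 2, 1, 3], ⟨1, -1, 1, 0, 1, 1⟩),
   (2, [3, 4, 3, 1, 3], ⟨1, -1, 1, 1, 0, 1⟩), (2, [3, 4, 3, 1, 0, 3], ⟨1, -1, 1, 1, 1, 0⟩),
   (2, [3, 1, 3, 4, 3, 1, 3], ⟨0, 0, 0, 0, 0, 0⟩), (2, [2, 0, 3, 1, 3, 4], ⟨0, 0, 0, 0, 0, 0⟩),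
   (2, [0, 3, 1, 3, 4], ⟨0, 0, 0, 0, 0, 0⟩), (2, [3, 1, 3, 4], ⟨0, 0, 0, 0, 0, 0⟩),
   (2, [4, 3, 4, 1, 0, 3, 4], ⟨-1, 1, -1, 0, 0, 0⟩),
   (2, [1, 3, 4, 3, 4, 2, 1], ⟨1, -1, 1, 1, 1, 1⟩), (2, [0, 3, 4, 1, 3, 4], ⟨1, -1, 1, 1, 1, 1⟩),
   (2, [3, 4, 1, 3, 4], ⟨1, -1, 1, 1, 1, 1⟩), (2, [1, 3, 1], ⟨1, -1, 0, 1, 1, 1⟩),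
   (2, [2, 1, 3], ⟨1, -1, 1, 0, 1, 1⟩), (2, [1, 3], ⟨1, -1, 1, 1, 0, 1⟩),
   (2, [1, 0, 3], ⟨1, -1, 1, 1, 1, 0⟩)]

/-- The tiles across the facets of the reference white simplex. -/
def neighboursW : List (Fin 3 × List ℕ × V6) :=
  [(0, [3, 1, 2], ⟨1, -1, 0, 1, 1, 1⟩), (0, [1, 3, 1], ⟨1, -1, 0, 1, 1, 1⟩),
   (0, [4, 3, 1], ⟨-1, 0, -1, 0, 0, 0⟩), (1, [3, 4, 1], ⟨1, -1, 0, 1, 1, 1⟩),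
   (2, [1, 3, 1], ⟨1, -1, 0, 1, 1, 1⟩), (1, [3, 1], ⟨1, -1, 0, 1, 1, 1⟩),
   (2, [3, 4, 3, 1, 3, 1], ⟨1, -1, 0, 1, 1, 1⟩)]

theorem neighboursT_check : ∀ w : Fin 3 → Fin 9, (∀ K, frameT.blk (w K) = K) →
    neighboursT.any (neighbourCheck frameT.v fun i => decide (i ≠ w (frameT.blk i))) = true := by
  decide +kernel

theorem neighboursR_check : ∀ w : Fin 2 → Fin 8, (∀ K, frameR.blk (w K) = K) →
    neighboursR.any (neighbourCheck frameR.v fun i => decide (i ≠ w (frameR.blk i))) = true := by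
  decide +kernel

theorem neighboursW_check : ∀ w : Fin 1 → Fin 7, (∀ K, frameW.blk (w K) = K) →
    neighboursW.any (neighbourCheck frameW.v fun i => decide (i ≠ w (frameW.blk i))) = true := by
  decide +kernel

theorem facetClosed_tileFamily : Tile.FacetClosed tileFamily := by
  have key : ∀ j, ∀ w, (refTile j).B.IsTransversal w → ∃ t' ∈ tileFamily,
      t'.B.hull ≠ (refTile j).B.hull ∧
        ∀ i ∈ (refTile j).B.rest w, (refTile j).B.v i ∈ Set.range t'.B.v := by
    intro j
    fin_cases j
    · exact fun w hw => exists_neighbour frameT_tileValid rfl neighboursT_check hw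
    · exact fun w hw => exists_neighbour frameR_tileValid rfl neighboursR_check hw
    · exact fun w hw => exists_neighbour frameW_tileValid rfl neighboursW_check hw
  rintro _ ⟨j, τ, hτ, rfl⟩ w hw
  obtain ⟨_, ⟨j', σ, hσ, rfl⟩, h1, h2⟩ := key j w hw
  refine ⟨(refTile j').map (τ * σ) (mul_mem hτ hσ), ⟨j', _, _, rfl⟩, ?_, ?_⟩
  · intro h
    apply h1
    change ((refTile j').B.map (τ * σ)).hull = ((refTile j).B.map τ).hull at h
    rw [BlockFrame.map_hull, BlockFrame.map_hull, image_mul] at h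
    have := τ.injective.image_injective h
    rwa [← BlockFrame.map_hull] at this
  · intro i hi
    obtain ⟨i', hi'⟩ := h2 i hi
    refine ⟨i', ?_⟩
    change τ (σ ((refTile j').B.v i')) = τ ((refTile j).B.v i)
    exact congrArg τ hi'

theorem hull_tileFamily :
    (fun t : Tile => t.B.hull) '' tileFamily = ⋃ j, symOrbit (refTile j).B.hull := by
  ext P
  simp only [Set.mem_image, Set.mem_iUnion]
  constructor
  · rintro ⟨_, ⟨j, τ, hτ, rfl⟩, rfl⟩
    exact ⟨j, τ, hτ, BlockFrame.map_hull _ _⟩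
  · rintro ⟨j, τ, hτ, rfl⟩
    exact ⟨_, ⟨j, τ, hτ, rfl⟩, BlockFrame.map_hull _ _⟩

/-! ### Homology classes -/

/-- The map `x ↦ z - x` if the flag `s` is set, and `x ↦ z + x` otherwise. -/
noncomputable def homologyEquiv (s : Bool) (z : R6) : R6 ≃ᵃ[ℝ] R6 :=
  AffineEquiv.constVAdd ℝ R6 z *
    if s then (LinearEquiv.neg ℝ : R6 ≃ₗ[ℝ] R6).toAffineEquiv else 1

theorem homologyEquiv_apply (s : Bool) (z x : R6) :
    homologyEquiv s z x = z + if s then -x else x := by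
  cases s <;> rfl

theorem homologyEquiv_mem {s : Bool} {z : R6} (hz : z ∈ Z6) : homologyEquiv s z ∈ symGroup := by
  refine mul_mem (translation_mem hz) ?_
  cases s
  · exact one_mem _
  · exact neg_mem_symGroup

theorem homologous_iff {A B : Set R6} :
    Homologous A B ↔ ∃ s, ∃ z ∈ Z6, B = homologyEquiv s z '' A := by
  constructor
  · rintro ⟨z, hz, h | h⟩
    · exact ⟨false, z, hz, h⟩
    · exact ⟨true, z, hz, h⟩
  · rintro ⟨s, z, hz, h⟩
    cases s
    · exact ⟨z, hz, Or.inl h⟩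
    · exact ⟨z, hz, Or.inr h⟩

/-- Homology of points: `y` is `z + x` or `z - x` for a lattice vector `z`. -/
def PointHomologous (x y : R6) : Prop := ∃ s, ∃ z ∈ Z6, y = homologyEquiv s z x

theorem PointHomologous.symm {x y : R6} (h : PointHomologous x y) : PointHomologous y x := by
  obtain ⟨s, z, hz, rfl⟩ := h
  cases s
  · exact ⟨false, -z, neg_mem_Z6 hz, by simp [homologyEquiv_apply]⟩
  · exact ⟨true, z, hz, by simp [homologyEquiv_apply]⟩

theorem PointHomologous.trans {x y w : R6} (h : PointHomologous x y) (h' : PointHomologous y w) :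
    PointHomologous x w := by
  obtain ⟨s, z, hz, rfl⟩ := h
  obtain ⟨s', z', hz', rfl⟩ := h'
  refine ⟨xor s s', z' + if s' then -z else z, add_mem_Z6 hz' ?_, ?_⟩
  · cases s'
    · exact hz
    · exact neg_mem_Z6 hz
  · cases s <;> cases s' <;> simp [homologyEquiv_apply] <;> abel

theorem PointHomologous.refl (x : R6) : PointHomologous x x :=
  ⟨false, 0, zero_mem_Z6, by simp [homologyEquiv_apply]⟩

theorem PointHomologous.genR {x y : R6} (h : PointHomologous x y) (i : ℕ) :
    PointHomologous (genR i x) (genR i y) := by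
  obtain ⟨s, z, hz, rfl⟩ := h
  obtain ⟨u, rfl⟩ := mem_Z6_iff.1 hz
  refine ⟨s, _, V6.mem_Z6 (gen i u), ?_⟩
  rw [homologyEquiv_apply, homologyEquiv_apply, genR_add, genR_toR]
  cases s
  · rfl
  · rw [if_pos rfl, if_pos rfl, ← neg_one_smul ℝ x, genR_smul, neg_one_smul]

theorem Homologous.refl (A : Set R6) : Homologous A A :=
  ⟨0, zero_mem_Z6, Or.inl (by simp)⟩

theorem Homologous.symm {A B : Set R6} (h : Homologous A B) : Homologous B A := by
  obtain ⟨z, hz, rfl | rfl⟩ := h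
  · refine ⟨-z, neg_mem_Z6 hz, Or.inl ?_⟩
    rw [Set.image_image]
    simp
  · refine ⟨z, hz, Or.inr ?_⟩
    rw [Set.image_image]
    simp

theorem Homologous.trans {A B C : Set R6} (h : Homologous A B) (h' : Homologous B C) :
    Homologous A C := by
  obtain ⟨z, hz, rfl | rfl⟩ := h <;> obtain ⟨z', hz', rfl | rfl⟩ := h'
  · refine ⟨z' + z, add_mem_Z6 hz' hz, Or.inl ?_⟩
    simp only [Set.image_image, add_assoc]
  · refine ⟨z' + -z, add_mem_Z6 hz' (neg_mem_Z6 hz), Or.inr ?_⟩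
    rw [Set.image_image]
    congr 1
    funext x
    abel
  · refine ⟨z' + z, add_mem_Z6 hz' hz, Or.inr ?_⟩
    rw [Set.image_image]
    congr 1
    funext x
    abel
  · refine ⟨z' + -z, add_mem_Z6 hz' (neg_mem_Z6 hz), Or.inl ?_⟩
    rw [Set.image_image]
    congr 1
    funext x
    abel

theorem homologyClass_eq_iff {A B : Set R6} :
    {C | Homologous A C} = {C | Homologous B C} ↔ Homologous A B := by
  constructor
  · intro h
    have : B ∈ {C | Homologous A C} := by
      rw [h]
      exact Homologous.refl B
    exact this
  · intro h
    ext C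
    exact ⟨fun h' => h.symm.trans h', fun h' => h.trans h'⟩

theorem BlockFrame.sum_v {n k : ℕ} (B : BlockFrame n k) : ∑ i, B.v i = (n : ℝ) • B.c := by
  rw [B.sum_blocks, Finset.sum_congr rfl fun K _ => B.cent K, ← Finset.sum_smul]
  congr 1
  have h : ∑ i : Fin n, (1 : ℝ) = n := by simp
  rw [← h, B.sum_blocks]
  exact Finset.sum_congr rfl fun K _ => by rw [← B.s_eq]; simp

/-- The centroid of a tile is determined by its convex hull. -/
theorem Tile.c_eq_of_hull_eq {t t' : Tile} (ht : Function.Injective t.B.v)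
    (ht' : Function.Injective t'.B.v) (hn : t.n = t'.n) (h : t.B.hull = t'.B.hull) :
    t.B.c = t'.B.c := by
  have hr : Set.range t.B.v = Set.range t'.B.v := by
    rw [← hull_inter_Z6, ← hull_inter_Z6, h]
  have h1 : ∑ i, t.B.v i = ∑ i, t'.B.v i := by
    rw [← finsum_eq_sum_of_fintype, ← finsum_eq_sum_of_fintype,
      ← finsum_mem_range (f := fun x : R6 => x) ht,
      ← finsum_mem_range (f := fun x : R6 => x) ht', hr]
  rw [BlockFrame.sum_v, BlockFrame.sum_v, show (t.n : ℝ) = t'.n by rw [hn]] at h1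
  have hn0 : (t'.n : ℝ) ≠ 0 := by
    have := t'.card
    exact_mod_cast (by omega : t'.n ≠ 0)
  exact smul_right_injective R6 hn0 h1

/-- Two images of a tile are homologous if and only if the images of its centroid are. -/
theorem Tile.homologous_iff_c {t : Tile} (ht : Function.Injective t.B.v) {τ τ' : R6 ≃ᵃ[ℝ] R6}
    (hτ : τ ∈ symGroup) (hτ' : τ' ∈ symGroup) :
    Homologous (τ '' t.B.hull) (τ' '' t.B.hull) ↔ PointHomologous (τ t.B.c) (τ' t.B.c) := by
  rw [homologous_iff]
  constructor
  · rintro ⟨s, z, hz, h⟩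
    rw [← image_mul, ← BlockFrame.map_hull, ← BlockFrame.map_hull] at h
    exact ⟨s, z, hz, c_eq_of_hull_eq (t := t.map τ' hτ')
      (t' := t.map (homologyEquiv s z * τ) (mul_mem (homologyEquiv_mem hz) hτ))
      (τ'.injective.comp ht) ((homologyEquiv s z * τ).injective.comp ht) rfl h⟩
  · rintro ⟨s, z, hz, h⟩
    refine ⟨s, z, hz, ?_⟩
    rw [← image_mul, ← BlockFrame.map_hull, ← BlockFrame.map_hull]
    refine hull_eq_of_mem_interior (t := t.map τ' hτ') (y := τ' t.B.c)
      (t' := t.map (homologyEquiv s z * τ) (mul_mem (homologyEquiv_mem hz) hτ))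
      (t.B.map τ').c_mem_interior ?_
    rw [h]
    exact interior_subset (t.B.map (homologyEquiv s z * τ)).c_mem_interior

namespace V6

/-- The test that `u / N` and `w / N` are homologous points. -/
def congCheck (N : ℕ) (u w : V6) : Bool :=
  (decide ((w.x0 - u.x0) % N = 0) && decide ((w.x1 - u.x1) % N = 0) &&
    decide ((w.x2 - u.x2) % N = 0) && decide ((w.x3 - u.x3) % N = 0) &&
    decide ((w.x4 - u.x4) % N = 0) && decide ((w.x5 - u.x5) % N = 0)) ||
  (decide ((w.x0 + u.x0) % N = 0) && decide ((w.x1 + u.x1) % N = 0) &&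
    decide ((w.x2 + u.x2) % N = 0) && decide ((w.x3 + u.x3) % N = 0) &&
    decide ((w.x4 + u.x4) % N = 0) && decide ((w.x5 + u.x5) % N = 0))

theorem quot_eq_add_iff {N : ℕ} (hN : 0 < N) (u w z : V6) :
    quot N w = z.toR + quot N u ↔ w = add (smul N z) u := by
  have hN' : (N : ℝ) ≠ 0 := by positivity
  have e : z.toR + quot N u = quot N (add (smul N z) u) := by
    rw [quot, quot, toR_add, toR_smul, smul_add, smul_smul, Int.cast_natCast, inv_mul_cancel₀ hN',
      one_smul]
  rw [e]
  constructor
  · intro h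
    exact toR_injective (smul_right_injective R6 (inv_ne_zero hN') h)
  · intro h
    rw [h]

theorem quot_neg (N : ℕ) (u : V6) : quot N (neg u) = -quot N u := by
  rw [quot, quot, toR_neg, smul_neg]

theorem pointHomologous_iff {N : ℕ} (hN : 0 < N) (u w : V6) :
    PointHomologous (quot N u) (quot N w) ↔ congCheck N u w = true := by
  have key : ∀ u : V6, (∃ z ∈ Z6, quot N w = z + quot N u) ↔
      (w.x0 - u.x0) % N = 0 ∧ (w.x1 - u.x1) % N = 0 ∧ (w.x2 - u.x2) % N = 0 ∧
      (w.x3 - u.x3) % N = 0 ∧ (w.x4 - u.x4) % N = 0 ∧ (w.x5 - u.x5) % N = 0 := by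
    intro u
    constructor
    · rintro ⟨z, hz, h⟩
      obtain ⟨z, rfl⟩ := mem_Z6_iff.1 hz
      rw [quot_eq_add_iff hN] at h
      subst h
      simp [add, smul]
    · rintro ⟨h0, h1, h2, h3, h4, h5⟩
      obtain ⟨z0, h0⟩ := Int.dvd_of_emod_eq_zero h0
      obtain ⟨z1, h1⟩ := Int.dvd_of_emod_eq_zero h1
      obtain ⟨z2, h2⟩ := Int.dvd_of_emod_eq_zero h2
      obtain ⟨z3, h3⟩ := Int.dvd_of_emod_eq_zero h3
      obtain ⟨z4, h4⟩ := Int.dvd_of_emod_eq_zero h4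
      obtain ⟨z5, h5⟩ := Int.dvd_of_emod_eq_zero h5
      refine ⟨_, mem_Z6 ⟨z0, z1, z2, z3, z4, z5⟩, (quot_eq_add_iff hN _ _ _).2 ?_⟩
      ext <;> simp only [add, smul] <;> linarith
  have h1 : PointHomologous (quot N u) (quot N w) ↔
      (∃ z ∈ Z6, quot N w = z + quot N u) ∨ ∃ z ∈ Z6, quot N w = z + quot N (neg u) := by
    simp only [PointHomologous, homologyEquiv_apply, Bool.exists_bool, quot_neg]
    simp
  rw [h1, key, key]
  simp [congCheck, neg, and_assoc]

end V6

theorem wordEquiv_quot (l : List ℕ) (N : ℕ) (u : V6) :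
    wordEquiv l (V6.quot N u) = V6.quot N (applyWord l u) := by
  rw [← wordEquiv_linear, V6.quot, map_smul, wordEquiv_linear, wordEquiv_toR, V6.quot]

/-- The test that the images of `σ / N` under the words of `L` represent, up to homology of points,
every element of the orbit of `σ / N` exactly once. -/
def orbitCheck (N : ℕ) (σ : V6) (L : List (List ℕ)) : Bool :=
  let X := L.map fun l => applyWord l σ
  decide ([] ∈ L) &&
  (X.all fun x => (List.range 5).all fun i => X.any fun y => V6.congCheck N (gen i x) y) &&
  decide (X.Pairwise fun x y => V6.congCheck N x y = false)

theorem exists_pointHomologous {N : ℕ} (hN : 0 < N) {σ : V6} {L : List (List ℕ)}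
    (hL : orbitCheck N σ L = true) (l : List ℕ) :
    ∃ l' ∈ L, PointHomologous (V6.quot N (applyWord l σ)) (V6.quot N (applyWord l' σ)) := by
  simp only [orbitCheck, Bool.and_eq_true, decide_eq_true_eq, List.all_map, List.any_map,
    List.all_eq_true, List.any_eq_true, Function.comp_def, List.mem_range] at hL
  obtain ⟨⟨h0, h1⟩, -⟩ := hL
  induction l with
  | nil => exact ⟨[], h0, PointHomologous.refl _⟩
  | cons i l ih =>
    obtain ⟨l', hl', h⟩ := ih
    have h2 := h.genR i
    have e : ∀ u : V6, genR i (V6.quot N u) = V6.quot N (gen i u) := fun u => by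
      rw [V6.quot, genR_smul, genR_toR, V6.quot]
    rw [e, e] at h2
    change ∃ l' ∈ L, PointHomologous (V6.quot N (gen i (applyWord l σ))) _
    by_cases hi : i < 5
    · obtain ⟨l'', hl'', h3⟩ := h1 l' hl' i hi
      exact ⟨l'', hl'', h2.trans ((V6.pointHomologous_iff hN _ _).2 h3)⟩
    · have e' : ∀ u, gen i u = u := by
        intro u
        obtain ⟨j, rfl⟩ : ∃ j, i = j + 5 := ⟨i - 5, by omega⟩
        rfl
      rw [e']
      exact ⟨l', hl', h⟩

/-- The words of a list which passes the test enumerate the homology classes of the images of a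
tile, as a homology class is determined by the image of the centroid up to homology of points. -/
theorem ncard_homologyClasses {t : Tile} (ht : Function.Injective t.B.v) {N : ℕ} (hN : 0 < N)
    {σ : V6} (hc : t.B.c = V6.quot N σ) {L : List (List ℕ)} (hL : orbitCheck N σ L = true) :
    (homologyClasses (symOrbit t.B.hull)).ncard = L.length := by
  have hp : L.Pairwise fun l l' =>
      ¬PointHomologous (V6.quot N (applyWord l σ)) (V6.quot N (applyWord l' σ)) := by
    have h := hL
    simp only [orbitCheck, Bool.and_eq_true, decide_eq_true_eq, List.pairwise_map] at h
    refine h.2.imp ?_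
    intro l l' h h'
    rw [(V6.pointHomologous_iff hN _ _).1 h'] at h
    exact absurd h (by decide)
  have hnd : L.Nodup := by
    refine hp.imp ?_
    rintro l _ h rfl
    exact h (PointHomologous.refl _)
  have himg : homologyClasses (symOrbit t.B.hull) =
      (fun l => {B | Homologous (wordEquiv l '' t.B.hull) B}) '' {l | l ∈ L} := by
    apply Set.Subset.antisymm
    · rintro _ ⟨_, ⟨τ, hτ, rfl⟩, rfl⟩
      obtain ⟨l, hl⟩ := exists_word hτ
      obtain ⟨l', hl', h⟩ := exists_pointHomologous hN hL l
      refine ⟨l', hl', homologyClass_eq_iff.2 (Homologous.symm ?_)⟩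
      rw [Tile.homologous_iff_c ht hτ (wordEquiv_mem l')]
      refine PointHomologous.trans (PointHomologous.symm ?_) (y := wordEquiv l t.B.c) ?_
      · have h0 : τ 0 ∈ Z6 := ((mem_symGroup.1 hτ).1 0).2 zero_mem_Z6
        refine ⟨false, τ 0, h0, ?_⟩
        have := sub_eq_linear (τ := τ) t.B.c 0
        rw [sub_zero, hl] at this
        rw [homologyEquiv_apply, ← this]
        simp
      · rw [hc, wordEquiv_quot, wordEquiv_quot]
        exact h
    · rintro _ ⟨l, -, rfl⟩
      exact ⟨_, ⟨_, wordEquiv_mem l, rfl⟩, rfl⟩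
  rw [himg, Set.InjOn.ncard_image]
  · rw [← List.coe_toFinset, Set.ncard_coe_finset, List.toFinset_card_of_nodup hnd]
  · intro l hl l' hl' h
    by_contra hne
    have h1 := (Tile.homologous_iff_c ht (wordEquiv_mem l) (wordEquiv_mem l')).1
      (homologyClass_eq_iff.1 h)
    rw [hc, wordEquiv_quot, wordEquiv_quot] at h1
    have : Std.Symm fun l l' : List ℕ =>
        ¬PointHomologous (V6.quot N (applyWord l σ)) (V6.quot N (applyWord l' σ)) :=
      ⟨fun _ _ h h' => h h'.symm⟩
    exact hp.forall hl hl' hne h1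

/-- Words which carry the reference T-tope to representatives of the homology classes. -/
def wordsT : List (List ℕ) :=
  [[], [1], [2], [3], [4], [2, 1], [3, 1], [4, 1], [0, 2], [1, 2], [4, 2], [0, 3], [1, 3], [4, 3],
   [3, 4], [1, 2, 1], [4, 2, 1], [0, 3, 1], [1, 3, 1], [4, 3, 1], [3, 1, 2], [2, 0, 3], [2, 1, 3],
   [3, 4, 3]]

/-- Words which carry the reference R-tope to representatives of the homology classes. -/
def wordsR : List (List ℕ) :=
  [[], [1], [3], [4], [2, 1], [3, 1], [4, 1], [0, 3], [0, 2, 1], [3, 2, 1], [4, 2, 1], [3, 4, 1]]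

/-- Words which carry the reference white simplex to representatives of the homology classes. -/
def wordsW : List (List ℕ) :=
  [[], [1], [3], [4], [2, 1], [3, 1], [4, 1], [0, 3], [1, 3], [2, 3], [3, 4], [0, 2, 1], [3, 2, 1],
   [4, 2, 1], [1, 3, 1], [2, 3, 1], [4, 3, 1], [3, 4, 1], [1, 0, 3], [2, 0, 3], [2, 1, 3],
   [3, 1, 3], [0, 2, 3], [1, 2, 3], [3, 2, 3], [0, 3, 4], [1, 3, 4], [2, 3, 4], [4, 3, 4],
   [4, 0, 2, 1], [4, 3, 2, 1], [3, 4, 2, 1], [3, 1, 3, 1], [4, 1, 3, 1], [0, 2, 3, 1],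
   [3, 2, 3, 1], [4, 2, 3, 1], [3, 4, 3, 1], [1, 3, 4, 1], [2, 3, 4, 1], [4, 3, 4, 1],
   [3, 1, 0, 3], [3, 2, 0, 3], [3, 2, 1, 3], [0, 3, 1, 3], [1, 3, 1, 3], [4, 3, 1, 3],
   [1, 0, 2, 3], [3, 0, 2, 3], [3, 1, 2, 3], [1, 0, 3, 4], [2, 0, 3, 4], [4, 1, 3, 4],
   [0, 2, 3, 4], [3, 4, 3, 4], [1, 3, 4, 2, 1], [2, 3, 4, 2, 1], [4, 3, 4, 2, 1], [0, 3, 1, 3, 1],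
   [3, 4, 1, 3, 1], [4, 0, 2, 3, 1], [2, 3, 2, 3, 1], [3, 4, 2, 3, 1], [1, 3, 4, 3, 1],
   [4, 3, 4, 3, 1], [3, 1, 3, 4, 1], [4, 1, 3, 4, 1], [0, 2, 3, 4, 1], [3, 4, 3, 4, 1],
   [0, 3, 1, 0, 3], [4, 3, 1, 0, 3], [4, 3, 2, 0, 3], [1, 0, 3, 1, 3], [4, 0, 3, 1, 3],
   [3, 1, 3, 1, 3], [4, 1, 3, 1, 3], [3, 4, 3, 1, 3], [1, 3, 0, 2, 3], [4, 3, 1, 2, 3],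
   [0, 2, 0, 3, 4], [3, 4, 1, 3, 4], [3, 1, 3, 4, 2, 1], [4, 1, 3, 4, 2, 1], [0, 2, 3, 4, 2, 1],
   [3, 4, 3, 4, 2, 1], [0, 3, 4, 1, 3, 1], [3, 2, 3, 2, 3, 1], [1, 3, 4, 2, 3, 1],
   [3, 1, 3, 4, 3, 1], [4, 1, 3, 4, 3, 1], [3, 4, 1, 3, 4, 1], [4, 0, 3, 1, 0, 3],
   [3, 1, 0, 3, 1, 3], [3, 1, 3, 0, 2, 3], [1, 3, 4, 1, 3, 4], [3, 1, 3, 4, 2, 3, 1]]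

theorem orbitCheck_wordsT : orbitCheck 3 frameT.c wordsT = true := by decide +kernel

theorem orbitCheck_wordsR : orbitCheck 4 frameR.c wordsR = true := by decide +kernel

theorem orbitCheck_wordsW : orbitCheck 7 frameW.c wordsW = true := by decide +kernel

theorem ncard_homologyClasses_refTile :
    (homologyClasses (symOrbit (refTile 0).B.hull)).ncard = 24 ∧
    (homologyClasses (symOrbit (refTile 1).B.hull)).ncard = 12 ∧
    (homologyClasses (symOrbit (refTile 2).B.hull)).ncard = 96 :=
  ⟨ncard_homologyClasses (t := refTile 0) (V6.toR_injective.comp (by decide : frameT.v.Injective))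
      three_pos rfl orbitCheck_wordsT,
    ncard_homologyClasses (t := refTile 1) (V6.toR_injective.comp (by decide : frameR.v.Injective))
      four_pos rfl orbitCheck_wordsR,
    ncard_homologyClasses (t := refTile 2) (V6.toR_injective.comp (by decide : frameW.v.Injective))
      (by norm_num : 0 < 7) rfl orbitCheck_wordsW⟩

/-! ### Flat covers of the reference tiles -/

/-- A free sum is covered by flat sets if, for each transversal, the simplex which contains the
block `K₀` and omits the transversal from the other blocks has its vertices on an empty
ellipsoid. -/
theorem FrameData.Valid.flatCovered {n k : ℕ} {D : FrameData n k} (h : D.Valid) (K₀ : Fin k)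
    (i₀ : Fin n) {α β N : ℕ} (hαβ : 0 < α + β) (hN : 0 < N) {L : List V6}
    (he : ∀ C ∈ L, V6.emptyCheck α β N C (D.v i₀) = true)
    (hon : ∀ w : Fin k → Fin n, (∀ K, D.blk (w K) = K) → ∃ C ∈ L,
      ∀ i, D.blk i = K₀ ∨ i ≠ w (D.blk i) → V6.onCheck α β N C (D.v i₀) (D.v i) = true) :
    FlatCovered α β h.toBlockFrame.hull := by
  intro x hx
  obtain ⟨w, hw, hx⟩ := h.toBlockFrame.exists_mem_piece K₀ hx
  obtain ⟨C, hC, hon⟩ := hon w hw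
  refine ⟨_, ?_, ⟨V6.quot N C, _, fun z hz => V6.dev_nonneg_of_check hαβ hN (he C hC) hz, ?_⟩, hx⟩
  · rintro _ ⟨i, -, rfl⟩
    exact ⟨h.toBlockFrame.v_mem_hull i, V6.mem_Z6 _⟩
  · rintro _ ⟨i, hi, rfl⟩
    exact (V6.dev_eq_zero_iff hN).2 (hon i hi)

/-- All vertices of the T-tope and of the white simplex lie on a single empty ellipsoid of `E₆`, and
the R-tope is covered by the four simplexes which contain `S_G` and a triangle of `S_Q`. -/
theorem flatCovered_refTile_E6 (j : Fin 3) : FlatCovered 1 0 (refTile j).B.hull := by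
  fin_cases j
  · exact frameT_valid.flatCovered 0 0 (by norm_num) three_pos
      (L := [⟨2, 1, 1, 1, 1, 1⟩]) (by decide +kernel) (by decide +kernel)
  · exact frameR_valid.flatCovered 1 4 (by norm_num) three_pos
      (L := [⟨-1, -2, 1, 1, 1, 1⟩, ⟨-5, -1, -1, -1, -1, -1⟩, ⟨4, 2, 2, 2, 2, 2⟩,
        ⟨2, 1, 1, 1, 1, 1⟩]) (by decide +kernel) (by decide +kernel)
  · exact frameW_valid.flatCovered 0 0 (by norm_num) three_pos
      (L := [⟨1, -1, -1, 2, 2, 2⟩]) (by decide +kernel) (by decide +kernel)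

/-- All vertices of the T-tope and of the white simplex lie on a single empty ellipsoid of `E₆*`,
and the R-tope is covered by the four simplexes which contain `S_Q` and a triangle of `S_G`. -/
theorem flatCovered_refTile_E6Star (j : Fin 3) : FlatCovered 0 1 (refTile j).B.hull := by
  fin_cases j
  · exact frameT_valid.flatCovered 0 0 (by norm_num) three_pos
      (L := [⟨0, 0, 0, 0, 1, 1⟩]) (by decide +kernel) (by decide +kernel)
  · exact frameR_valid.flatCovered 0 0 (by norm_num) three_pos
      (L := [⟨0, 0, 0, 1, 1, 1⟩, ⟨0, 0, 1, 0, 1, 1⟩, ⟨0, 0, 1, 1, 0, 1⟩,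
        ⟨0, 0, 1, 1, 1, 0⟩]) (by decide +kernel) (by decide +kernel)
  · exact frameW_valid.flatCovered 0 0 (by norm_num) three_pos
      (L := [⟨0, 0, 0, 1, 1, 1⟩]) (by decide +kernel) (by decide +kernel)

theorem commensurate_symOrbits {F : Matrix (Fin 6) (Fin 6) ℝ} {κ : ℝ} (hκ : 0 < κ) {α β : ℕ}
    (hF : ∀ x, quadForm F x = κ * qf α β x) (h : ∀ j, FlatCovered α β (refTile j).B.hull) :
    Commensurate (⋃ j, symOrbit (refTile j).B.hull) (delaunayTiling F) := by
  refine commensurate_of_flatCovered hκ hF fun P hP => ?_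
  obtain ⟨j, τ, hτ, rfl⟩ := Set.mem_iUnion.1 hP
  refine ⟨?_, ?_, (h j).map hτ⟩
  · rw [← BlockFrame.map_hull]
    exact convex_convexHull ℝ _
  · rw [← BlockFrame.map_hull]
    have := ((refTile j).map τ hτ).hull_inter_Z6
    exact this ▸ Set.finite_range _

/-! ### The white simplexes -/

theorem toR_eq (a b c d e f : ℤ) : V6.toR ⟨a, b, c, d, e, f⟩ = ![(a : ℝ), b, c, d, e, f] := rfl

theorem refT_eq : refT = (refTile 0).B.hull := by
  have h : Set.range (refTile 0).B.v = V6.toR '' {u | u ∈ List.ofFn frameT.v} :=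
    range_toR _
  rw [BlockFrame.hull, h, refT]
  congr 1
  ext x
  simp [frameT, List.ofFn_succ, toR_eq, eq_comm]
  grind

theorem refR_eq : refR = (refTile 1).B.hull := by
  have h : Set.range (refTile 1).B.v = V6.toR '' {u | u ∈ List.ofFn frameR.v} :=
    range_toR _
  rw [BlockFrame.hull, h, refR]
  congr 1
  ext x
  simp [frameR, List.ofFn_succ, toR_eq, eq_comm]
  grind

theorem refQ_eq : refQ = convexHull ℝ (V6.toR '' {u | u ∈ List.ofFn frameQ.v}) := by
  rw [refQ, vertsQ₁, vertsQ₂, vertsQ₃]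
  congr 1
  ext x
  simp [frameQ, List.ofFn_succ, toR_eq, eq_comm]
  grind

theorem refQ_eq_hull : refQ = frameQ_valid.toBlockFrame.hull := by
  rw [refQ_eq, ← range_toR]
  rfl

/-- The vertices of the triangle `Δ_Q¹`. -/
def triangleQ : List V6 := [⟨0, 0, 0, 1, 0, 0⟩, ⟨0, 0, 0, 0, 1, 0⟩, ⟨0, 0, 0, 0, 0, 1⟩]

theorem vertsQ₁_eq : vertsQ₁ = V6.toR '' {u | u ∈ triangleQ} := by
  rw [vertsQ₁]
  ext x
  simp [triangleQ, toR_eq, eq_comm]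

/-- Three times the centres of the six Delaunay ellipsoids of `E₆` around the triangle `Δ_Q¹`. -/
def whiteCentres : List V6 :=
  [⟨1, -1, -1, 2, 2, 2⟩, ⟨-1, -2, 1, 1, 1, 1⟩, ⟨-1, 1, -2, 1, 1, 1⟩, ⟨4, 2, 2, 2, 2, 2⟩,
   ⟨-5, -1, -1, -1, -1, -1⟩, ⟨2, 1, 1, 1, 1, 1⟩]

/-- The deviation from the `E₆`-ellipsoid with centre `C / 3` through the triangle `Δ_Q¹`. -/
noncomputable def whiteDev (C : V6) (x : R6) : ℝ :=
  dev 1 0 (V6.quot 3 C) (qf 1 0 (V6.toR ⟨0, 0, 0, 1, 0, 0⟩ - V6.quot 3 C)) x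

/-- The test that `u` lies on the ellipsoid of `whiteDev`. -/
def whiteCheck (C u : V6) : Bool := V6.onCheck 1 0 3 C ⟨0, 0, 0, 1, 0, 0⟩ u

theorem whiteDev_eq_zero_iff (C u : V6) : whiteDev C u.toR = 0 ↔ whiteCheck C u = true :=
  V6.dev_eq_zero_iff three_pos

theorem whiteDev_nonneg {C : V6} (hC : C ∈ whiteCentres) {z : R6} (hz : z ∈ Z6) :
    0 ≤ whiteDev C z := by
  have h : ∀ C ∈ whiteCentres, V6.emptyCheck 1 0 3 C ⟨0, 0, 0, 1, 0, 0⟩ = true := by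
    decide +kernel
  exact V6.dev_nonneg_of_check (by norm_num) three_pos (h C hC) hz

/-- Symmetries `u ↦ z + w u` which carry the tetrahedron `S_G` of the reference R-tope to three
tetrahedra with the face `Δ_Q¹`. -/
def quarterMoves : List (List ℕ × V6) :=
  [([], ⟨0, 0, 0, 0, 0, 0⟩), ([3, 1], ⟨1, -1, 0, 1, 1, 1⟩), ([3, 4, 1], ⟨1, -1, 0, 1, 1, 1⟩)]

theorem quarterMoves_check : ∀ e ∈ quarterMoves, ∀ w : Fin 2 → Fin 8,
    (∀ K, frameR.blk (w K) = K) → ∃ C ∈ whiteCentres,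
      ∀ i, frameR.blk i = 1 ∨ i ≠ w (frameR.blk i) →
        whiteCheck C (V6.add e.2 (applyWord e.1 (frameR.v i))) = true := by
  decide +kernel

theorem frameQ_check : ∀ w : Fin 3 → Fin 9, (∀ K, frameQ.blk (w K) = K) →
    (∃ C ∈ whiteCentres,
      ∀ i, frameQ.blk i = 0 ∨ i ≠ w (frameQ.blk i) → whiteCheck C (frameQ.v i) = true) ∨
    ∃ e ∈ quarterMoves, ∀ i, frameQ.blk i = 0 ∨ i ≠ w (frameQ.blk i) →
      frameQ.v i ∈ (List.ofFn frameR.v).map fun u => V6.add e.2 (applyWord e.1 u) := by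
  decide +kernel

/-- The six Delaunay polytopes of `E₆` around `Δ_Q¹` cover the reference Q-tope. Of the nine pieces
`conv (Δ_Q¹ ∪ e₂ ∪ e₃)` with edges `e₂`, `e₃` of the other two triangles, six lie in one of these
polytopes; each of the other three lies in an image of the reference R-tope, where it splits
further. -/
theorem exists_white {y : R6} (hy : y ∈ refQ) :
    ∃ C ∈ whiteCentres, y ∈ convexHull ℝ {z | z ∈ Z6 ∧ whiteDev C z = 0} := by
  rw [refQ_eq_hull] at hy
  obtain ⟨w, hw, hy⟩ := frameQ_valid.toBlockFrame.exists_mem_piece 0 hy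
  rcases frameQ_check w hw with ⟨C, hC, h⟩ | ⟨e, he, h⟩
  · refine ⟨C, hC, convexHull_mono ?_ hy⟩
    rintro _ ⟨i, hi, rfl⟩
    exact ⟨V6.mem_Z6 _, (whiteDev_eq_zero_iff _ _).2 (h i hi)⟩
  · have h1 : y ∈ moveEquiv e.1 e.2 '' frameR_valid.toBlockFrame.hull := by
      rw [BlockFrame.hull, image_convexHull]
      refine convexHull_mono ?_ hy
      rintro _ ⟨i, hi, rfl⟩
      obtain ⟨u, hu, hui⟩ := List.mem_map.1 (h i hi)
      obtain ⟨i', rfl⟩ := List.mem_ofFn.1 hu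
      refine ⟨_, ⟨i', rfl⟩, ?_⟩
      change moveEquiv e.1 e.2 (frameR.v i').toR = (frameQ.v i).toR
      rw [moveEquiv_toR, hui]
    obtain ⟨y', hy', rfl⟩ := h1
    obtain ⟨w', hw', hy'⟩ := frameR_valid.toBlockFrame.exists_mem_piece 1 hy'
    obtain ⟨C, hC, h2⟩ := quarterMoves_check e he w' hw'
    refine ⟨C, hC, ?_⟩
    have h3 := Set.mem_image_of_mem (moveEquiv e.1 e.2) hy'
    rw [image_convexHull] at h3
    refine convexHull_mono ?_ h3
    rintro _ ⟨_, ⟨i, hi, rfl⟩, rfl⟩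
    change moveEquiv e.1 e.2 (frameR.v i).toR ∈ _
    rw [moveEquiv_toR]
    exact ⟨V6.mem_Z6 _, (whiteDev_eq_zero_iff _ _).2 (h2 i hi)⟩

/-- The vertices of the Q-tope are all the lattice points on an empty ellipsoid of `E₆*`. -/
theorem refQ_inter_Z6 : refQ ∩ Z6 = V6.toR '' {u | u ∈ List.ofFn frameQ.v} := by
  have he : V6.emptyCheck 0 1 3 ⟨0, 0, 0, 1, 1, 1⟩ (frameQ.v 0) = true := by decide +kernel
  have hL : V6.contactCheck 0 1 3 ⟨0, 0, 0, 1, 1, 1⟩ (frameQ.v 0) (List.ofFn frameQ.v) = true := by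
    decide +kernel
  have hon : ∀ i, V6.onCheck 0 1 3 ⟨0, 0, 0, 1, 1, 1⟩ (frameQ.v 0) (frameQ.v i) = true := by
    decide +kernel
  rw [refQ_eq]
  apply Set.Subset.antisymm
  · rintro z ⟨hz, hzZ⟩
    refine V6.mem_of_dev_eq_zero (by norm_num) three_pos he hL hzZ ?_
    refine dev_eq_zero_of_mem_convexHull
      (fun z hz => V6.dev_nonneg_of_check (by norm_num) three_pos he hz) ?_ hzZ hz
    rintro _ ⟨u, hu, rfl⟩
    obtain ⟨i, rfl⟩ := List.mem_ofFn.1 hu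
    exact (V6.dev_eq_zero_iff three_pos).2 (hon i)
  · rintro _ ⟨u, hu, rfl⟩
    exact ⟨subset_convexHull ℝ _ ⟨u, hu, rfl⟩, V6.mem_Z6 u⟩

/-- The lattice points which a Delaunay polytope of `E₆` around `Δ_Q¹` shares with the reference
Q-tope. -/
theorem white_inter {C : V6} (hC : C ∈ whiteCentres) :
    convexHull ℝ {z | z ∈ Z6 ∧ whiteDev C z = 0} ∩ refQ ∩ Z6 =
      V6.toR '' {u | u ∈ (List.ofFn frameQ.v).filter (whiteCheck C)} := by
  ext z
  rw [Set.inter_assoc, refQ_inter_Z6]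
  constructor
  · rintro ⟨hz, u, hu, rfl⟩
    have h := dev_eq_zero_of_mem_convexHull (fun z hz => whiteDev_nonneg hC hz)
      (fun z hz => hz.2) (V6.mem_Z6 u) hz
    exact ⟨u, List.mem_filter.2 ⟨hu, (whiteDev_eq_zero_iff C u).1 h⟩, rfl⟩
  · rintro ⟨u, hu, rfl⟩
    obtain ⟨hu, hc⟩ := List.mem_filter.1 hu
    exact ⟨subset_convexHull ℝ _ ⟨V6.mem_Z6 u, (whiteDev_eq_zero_iff C u).2 hc⟩, u, hu, rfl⟩

/-- Symmetries which carry the reference simplex to the six white simplexes of the reference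
Q-tope, in the order of `whiteCentres`. -/
def whiteMoves : List (List ℕ × V6) :=
  [([], ⟨0, 0, 0, 0, 0, 0⟩), ([3, 4, 3, 1, 3, 1], ⟨1, -1, 0, 1, 1, 1⟩),
   ([4, 0, 2, 3, 4, 2, 1], ⟨-3, 0, -1, -1, -1, -1⟩), ([4, 3, 4, 1, 0, 3, 4], ⟨-1, 1, -1, 0, 0, 0⟩),
   ([3, 1, 3, 4, 3, 1, 3], ⟨0, 0, 0, 0, 0, 0⟩), ([1, 3, 1], ⟨1, -1, 0, 1, 1, 1⟩)]

theorem whiteMoves_check : ∀ C ∈ whiteCentres, ∃ e ∈ whiteMoves,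
    (∀ u ∈ (List.ofFn frameQ.v).filter (whiteCheck C),
      u ∈ (List.ofFn frameW.v).map fun u => V6.add e.2 (applyWord e.1 u)) ∧
    ∀ u ∈ (List.ofFn frameW.v).map fun u => V6.add e.2 (applyWord e.1 u),
      u ∈ (List.ofFn frameQ.v).filter (whiteCheck C) := by
  decide +kernel

theorem white_mem_symOrbit {C : V6} (hC : C ∈ whiteCentres) :
    convexHull ℝ (convexHull ℝ {z | z ∈ Z6 ∧ whiteDev C z = 0} ∩ refQ ∩ Z6) ∈
      symOrbit (refTile 2).B.hull := by
  obtain ⟨e, -, h1, h2⟩ := whiteMoves_check C hC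
  refine ⟨moveEquiv e.1 e.2, moveEquiv_mem _ _, ?_⟩
  rw [white_inter hC, BlockFrame.hull, image_convexHull, range_refTile, Set.image_image]
  congr 1
  ext x
  constructor
  · rintro ⟨u, hu, rfl⟩
    obtain ⟨u', hu', rfl⟩ := List.mem_map.1 (h1 u hu)
    exact ⟨u', hu', moveEquiv_toR _ _ _⟩
  · rintro ⟨u', hu', rfl⟩
    exact ⟨_, h2 _ (List.mem_map.2 ⟨u', hu', rfl⟩), (moveEquiv_toR _ _ _).symm⟩

/-- A Delaunay polytope of `E₆` which contains the triangle `Δ_Q¹` contains its centroid, which is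
interior to the Q-tope; an interior point of the polytope near the centroid lies in one of the six
polytopes around the triangle, and hence the two coincide. -/
theorem delaunay_eq_white {m : ℝ} (hm : 0 < m) {G : Set R6} (hG : G ∈ delaunayTiling (formE6 m))
    (hface : IsFace G (convexHull ℝ vertsQ₁)) :
    ∃ C ∈ whiteCentres, G = convexHull ℝ {z | z ∈ Z6 ∧ whiteDev C z = 0} := by
  obtain ⟨hint, c, r, hdev, hGeq⟩ :=
    (mem_delaunayTiling (half_pos hm) (quadForm_formE6 m)).1 hG
  have hconv : Convex ℝ G := hGeq ▸ convex_convexHull ℝ _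
  have hsub : convexHull ℝ vertsQ₁ ⊆ G := IsExposed.subset hface
  have hcQ : frameQ_valid.toBlockFrame.c ∈ convexHull ℝ vertsQ₁ := by
    have hcent := frameQ_valid.toBlockFrame.cent 0
    have hv : ∀ i ∈ Finset.univ.filter (frameQ_valid.toBlockFrame.blk · = 0),
        frameQ_valid.toBlockFrame.v i ∈ convexHull ℝ vertsQ₁ := by
      intro i hi
      have h : ∀ i, frameQ.blk i = 0 → frameQ.v i ∈ triangleQ := by decide
      refine subset_convexHull ℝ _ ?_
      rw [vertsQ₁_eq]
      exact ⟨_, h i (Finset.mem_filter.1 hi).2, rfl⟩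
    have hs := frameQ_valid.toBlockFrame.s_pos 0
    have := (convex_convexHull ℝ vertsQ₁).centerMass_mem (t := Finset.univ.filter
      (frameQ_valid.toBlockFrame.blk · = 0)) (w := fun _ => 1) (fun _ _ => zero_le_one)
      (by rw [Finset.sum_const, nsmul_eq_mul, frameQ_valid.toBlockFrame.s_eq, mul_one]; exact hs) hv
    rw [Finset.centerMass, Finset.sum_const, nsmul_eq_mul, mul_one,
      frameQ_valid.toBlockFrame.s_eq] at this
    simp only [one_smul] at this
    rwa [hcent, smul_smul, inv_mul_cancel₀ hs.ne', one_smul] at this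
  obtain ⟨y, hyQ, hyG⟩ : (interior refQ ∩ interior G).Nonempty := by
    have h1 : frameQ_valid.toBlockFrame.c ∈ closure (interior G) := by
      rw [hconv.closure_interior_eq_closure_of_nonempty_interior hint]
      exact subset_closure (hsub hcQ)
    refine mem_closure_iff.1 h1 _ isOpen_interior ?_
    rw [refQ_eq_hull]
    exact frameQ_valid.toBlockFrame.c_mem_interior
  obtain ⟨C, hC, hyC⟩ := exists_white (interior_subset hyQ)
  refine ⟨C, hC, ?_⟩
  obtain ⟨A, hA⟩ := exists_affine_dev_sub 1 0 (V6.quot 3 C) c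
    (qf 1 0 (V6.toR ⟨0, 0, 0, 1, 0, 0⟩ - V6.quot 3 C)) r
  have hAG : ∀ x ∈ G, 0 ≤ A x := by
    intro x hx
    rw [hGeq] at hx
    refine affine_nonneg_of_mem_convexHull ?_ hx
    rintro z ⟨hz, h0⟩
    rw [hA, h0, sub_zero]
    exact whiteDev_nonneg hC hz
  have hAy : A y = 0 := by
    refine le_antisymm ?_ (hAG y (interior_subset hyG))
    have h := affine_nonneg_of_mem_convexHull (A := -A) ?_ hyC
    · simpa using h
    · rintro z ⟨hz, h0⟩
      have h1 : A z = 0 - dev 1 0 c r z := by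
        rw [hA, ← h0]
        rfl
      have := hdev z hz
      simp only [AffineMap.coe_neg, Pi.neg_apply]
      linarith
  rw [hGeq]
  congr 1
  ext z
  refine and_congr_right fun _ => ?_
  have h1 := hA z
  rw [affine_eq_zero_of_interior hAG hyG hAy z] at h1
  change _ ↔ dev 1 0 _ _ z = 0
  rw [sub_eq_zero.1 h1.symm]

/-- The ellipsoid centred at the centroid of `Δ_Q¹` meets the lattice in the vertices of `Δ_Q¹`
only, so that the difference of the deviations exhibits the triangle as a face. -/
theorem isFace_triangle {C : V6} (hC : C ∈ whiteCentres) :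
    IsFace (convexHull ℝ {z | z ∈ Z6 ∧ whiteDev C z = 0}) (convexHull ℝ vertsQ₁) := by
  have he : V6.emptyCheck 1 0 3 ⟨0, 0, 0, 1, 1, 1⟩ ⟨0, 0, 0, 1, 0, 0⟩ = true := by decide +kernel
  have hL : V6.contactCheck 1 0 3 ⟨0, 0, 0, 1, 1, 1⟩ ⟨0, 0, 0, 1, 0, 0⟩ triangleQ = true := by
    decide +kernel
  have hon : ∀ u ∈ triangleQ, whiteCheck ⟨0, 0, 0, 1, 1, 1⟩ u = true := by decide +kernel
  have hon' : ∀ C ∈ whiteCentres, ∀ u ∈ triangleQ, whiteCheck C u = true := by decide +kernel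
  obtain ⟨A, hA⟩ := exists_affine_dev_sub 1 0 (V6.quot 3 ⟨0, 0, 0, 1, 1, 1⟩) (V6.quot 3 C)
    (qf 1 0 (V6.toR ⟨0, 0, 0, 1, 0, 0⟩ - V6.quot 3 ⟨0, 0, 0, 1, 1, 1⟩))
    (qf 1 0 (V6.toR ⟨0, 0, 0, 1, 0, 0⟩ - V6.quot 3 C))
  have hA' : ∀ x, A x = whiteDev ⟨0, 0, 0, 1, 1, 1⟩ x - whiteDev C x := hA
  have hnn : ∀ z ∈ {z | z ∈ Z6 ∧ whiteDev C z = 0}, 0 ≤ A z := by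
    rintro z ⟨hz, h0⟩
    rw [hA', h0, sub_zero]
    exact V6.dev_nonneg_of_check (by norm_num) three_pos he hz
  have h := isFace_zero A fun x hx => affine_nonneg_of_mem_convexHull hnn hx
  convert h using 1
  have hsub : vertsQ₁ ⊆ {z | z ∈ Z6 ∧ whiteDev C z = 0} := by
    rw [vertsQ₁_eq]
    rintro _ ⟨u, hu, rfl⟩
    exact ⟨V6.mem_Z6 u, (whiteDev_eq_zero_iff C u).2 (hon' C hC u hu)⟩
  apply Set.Subset.antisymm
  · intro x hx
    refine ⟨convexHull_mono hsub hx, ?_⟩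
    have hz : ∀ z ∈ vertsQ₁, A z = 0 := by
      intro z hz
      have h1 := (hsub hz).2
      rw [vertsQ₁_eq] at hz
      obtain ⟨u, hu, rfl⟩ := hz
      rw [hA', h1, (whiteDev_eq_zero_iff _ u).2 (hon u hu), sub_zero]
    refine le_antisymm ?_ (affine_nonneg_of_mem_convexHull (fun z hz' => (hz z hz').ge) hx)
    have := affine_nonneg_of_mem_convexHull (A := -A) (fun z hz' => by simp [hz z hz']) hx
    simpa using this
  · rintro x ⟨hx, h0⟩
    refine convexHull_mono ?_ (mem_convexHull_zero hnn hx h0)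
    rintro z ⟨⟨hz, h1⟩, h2⟩
    rw [hA', h1, sub_zero] at h2
    rw [vertsQ₁_eq]
    exact V6.mem_of_dev_eq_zero (by norm_num) three_pos he hL hz h2

theorem whiteSimplexes_eq {m : ℝ} (hm : 0 < m) :
    whiteSimplexes m = symOrbit (refTile 2).B.hull := by
  apply Set.Subset.antisymm
  · rintro X ⟨W, ⟨G, hG, hface, rfl⟩, hX⟩
    obtain ⟨C, hC, rfl⟩ := delaunay_eq_white hm hG hface
    rw [equivalentTopes_eq hm] at hX
    obtain ⟨τ, hτ, rfl⟩ := hX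
    exact symOrbit_image hτ (white_mem_symOrbit hC)
  · rintro X ⟨τ, hτ, rfl⟩
    have hC : (⟨1, -1, -1, 2, 2, 2⟩ : V6) ∈ whiteCentres := by decide
    have hW : (refTile 2).B.hull =
        convexHull ℝ (convexHull ℝ {z | z ∈ Z6 ∧ whiteDev ⟨1, -1, -1, 2, 2, 2⟩ z = 0} ∩
          refQ ∩ Z6) := by
      have h : ∀ u, u ∈ tileVertices 2 ↔
          u ∈ (List.ofFn frameQ.v).filter (whiteCheck ⟨1, -1, -1, 2, 2, 2⟩) := by
        have h1 : ∀ u ∈ tileVertices 2,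
            u ∈ (List.ofFn frameQ.v).filter (whiteCheck ⟨1, -1, -1, 2, 2, 2⟩) := by
          decide +kernel
        have h2 : ∀ u ∈ (List.ofFn frameQ.v).filter (whiteCheck ⟨1, -1, -1, 2, 2, 2⟩),
            u ∈ tileVertices 2 := by
          decide +kernel
        exact fun u => ⟨h1 u, h2 u⟩
      rw [white_inter hC, BlockFrame.hull, range_refTile]
      simp only [h]
    refine ⟨(refTile 2).B.hull, ⟨_, ?_, isFace_triangle hC, hW⟩, ?_⟩
    · refine (mem_delaunayTiling (half_pos hm) (quadForm_formE6 m)).2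
        ⟨⟨(refTile 2).B.c, ?_⟩, _, _, fun z hz => whiteDev_nonneg hC hz, rfl⟩
      refine interior_mono ?_ (refTile 2).B.c_mem_interior
      rw [hW]
      exact convexHull_min (fun z hz => hz.1.1) (convex_convexHull ℝ _)
    · rw [equivalentTopes_eq hm]
      exact ⟨τ, hτ, rfl⟩

/-! ### The tiling `𝒟_R` -/

theorem tilingDR_eq {m : ℝ} (hm : 0 < m) :
    tilingDR m = ⋃ j, symOrbit (refTile j).B.hull := by
  have h : ∀ S : Fin 3 → Set (Set R6), ⋃ j, S j = S 0 ∪ S 1 ∪ S 2 := by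
    intro S
    ext x
    simp [Fin.exists_fin_succ, or_assoc]
  rw [h, tilingDR, TTopes, RTopes, equivalentTopes_eq hm, equivalentTopes_eq hm,
    whiteSimplexes_eq hm, refT_eq, refR_eq]

theorem mainTheorem2 (m : ℝ) (hm : 0 < m) :
    (homologyClasses (TTopes m)).ncard = 24 ∧
    (homologyClasses (RTopes m)).ncard = 12 ∧
    (homologyClasses (whiteSimplexes m)).ncard = 96 ∧
    (∀ W ∈ whiteSimplexes m, ∃ v : Fin 7 → R6, AffineIndependent ℝ v ∧
      (∀ i, v i ∈ Z6) ∧ W = convexHull ℝ (Set.range v)) ∧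
    IsZTiling (tilingDR m) ∧
    IsFacetToFacet (tilingDR m) ∧
    (∀ P ∈ tilingDR m, ∀ z ∈ Z6, (fun x => z + x) '' P ∈ tilingDR m) ∧
    Commensurate (tilingDR m) (delaunayTiling (formE6 m)) ∧
    Commensurate (tilingDR m) (delaunayTiling (formE6Star m)) := by
  obtain ⟨hT, hR, hW⟩ := ncard_homologyClasses_refTile
  refine ⟨?_, ?_, ?_, ?_, ?_, ?_, ?_, ?_, ?_⟩
  · rwa [TTopes, equivalentTopes_eq hm, refT_eq]
  · rwa [RTopes, equivalentTopes_eq hm, refR_eq]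
  · rwa [whiteSimplexes_eq hm]
  · intro W hW
    rw [whiteSimplexes_eq hm] at hW
    obtain ⟨τ, hτ, rfl⟩ := hW
    refine ⟨(frameW_valid.toBlockFrame.map τ).v, BlockFrame.affineIndependent_v _,
      ((refTile 2).map τ hτ).v_mem, ?_⟩
    exact (BlockFrame.map_hull frameW_valid.toBlockFrame τ).symm
  · rw [tilingDR_eq hm, ← hull_tileFamily]
    exact Tile.isZTiling facetClosed_tileFamily ⟨_, 0, 1, one_mem _, rfl⟩
  · rw [tilingDR_eq hm, ← hull_tileFamily]
    exact Tile.isFacetToFacet facetClosed_tileFamily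
  · rw [tilingDR_eq hm]
    intro P hP z hz
    obtain ⟨j, hj⟩ := Set.mem_iUnion.1 hP
    exact Set.mem_iUnion.2 ⟨j, symOrbit_image (translation_mem hz) hj⟩
  · rw [tilingDR_eq hm]
    exact commensurate_symOrbits (by positivity) (quadForm_formE6 m) flatCovered_refTile_E6
  · rw [tilingDR_eq hm]
    exact commensurate_symOrbits (by positivity) (quadForm_formE6Star m) flatCovered_refTile_E6Star
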